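/- Let $M$ be a smooth oriented 4-manifold, possibly with boundary (Hausdorff, $\sigma$-compact), and let $\jmath:\partial M\hookrightarrow M$ be the inclusion of its boundary. Indices $i,j,k$ run over $1,2,3$, are raised and lowered with $\delta_{ij}$, repeated indices are summed, and $\epsilon_{ijk}$ is the Levi-Civita symbol. For triples $e=(e^i)$, $A=(A^i)$ of smooth 1-forms on $M$ put $$F^i=\mathrm dA^i+\tfrac12\epsilon^i{}_{jk}A^j\wedge A^k,\qquad De^i=\mathrm de^i+\epsilon^i{}_{jk}A^j\wedge e^k .$$ (1) For $\alpha_1,\dots,\alpha_5\in\mathbb R$ let $$S_{\boldsymbol\alpha}(e,A)=\int_M\Big(\alpha_1\epsilon_{ijk}e^i\wedge e^j\wedge F^k+\alpha_2De_i\wedge De^i+\alpha_3F_i\wedge F^i+\alpha_4\epsilon_{ijk}De^i\wedge e^j\wedge e^k+\alpha_5F_i\wedge De^i\Big).$$ Then $(e,A)$ is a stationary point of $S_{\boldsymbol\alpha}$ (with respect to all smooth compactly supported variations of $(e,A)$, not required to vanish on $\partial M$; if $M$ is not compact, the action is taken over any compact set containing the support of the variation) if and only if, for all $i$, $$(\alpha_1-\alpha_2)\,\epsilon_{ijk}e^j\wedge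 F^k=0,\qquad(\alpha_1-\alpha_2)\,\epsilon_{ijk}De^j\wedge e^k=0\qquad\text{on }M,$$ $$\jmath^*\big(2\alpha_2De_i+\alpha_4\epsilon_{ijk}e^j\wedge e^k+\alpha_5F_i\big)=0,\qquad \jmath^*\big(\alpha_1\epsilon_{ijk}e^j\wedge e^k+2\alpha_3F_i+\alpha_5De_i\big)=0\qquad\text{on }\partial M .$$ (2) Let $A_+=(A_+^i)$, $A_-=(A_-^i)$ be triples of smooth 1-forms on $M$ with curvatures $F_\pm^i=\mathrm dA_\pm^i+\frac12\epsilon^i{}_{jk}A_\pm^j\wedge A_\pm^k$, and put $e^i=A_+^i-A_-^i$, $A^i=\alpha A_-^i+(1-\alpha)A_+^i$ with $\alpha=\frac12$. Then $(A_+,A_-)$ is a stationary point (in the same sense) of the two-connection action $S(A_+,A_-)=\int_MF_{+i}\wedge F_-^i$ if and only if, for all $i$, $\epsilon_{ijk}e^j\wedge F^k=0$ and $\epsilon_{ijk}De^j\wedge e^k=0$ on $M$, and $$\jmath^*(De^i)=0,\qquad \jmath^*\big(F_i+\tfrac18\epsilon_{ijk}e^j\wedge e^k\big)=0\qquad\text{on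 }\partial M .$$ These boundary equations hold if and only if the triad $\jmath^*e$ and the connection $\jmath^*A$ on the 3-manifold $\partial M$ satisfy the field equations of 3-dimensional Euclidean general relativity with cosmological constant $\Lambda=\frac14$ in first-order form, which for a triad $e$ and an $SO(3)$-connection $A$ on a 3-manifold are $De^i=0$ and $F_i+\frac{\Lambda}{2}\epsilon_{ijk}e^j\wedge e^k=0$. -/

import Mathlib

open Set Function Topology MeasureTheory
open scoped Manifold ContDiff

noncomputable section

namespace HKModel

/-! ### Exterior algebra of a vector space -/

section Algebra

variable {V : Type*} [AddCommGroup V] [Module ℝ V] [TopologicalSpace V]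

/-- The multilinear map `v ↦ a (v₁, …, v_k) * b (v_{k+1}, …, v_{k+l})`. -/
def mulMultilinear {k l : ℕ} (a : V [⋀^Fin k]→L[ℝ] ℝ) (b : V [⋀^Fin l]→L[ℝ] ℝ) :
    ContinuousMultilinearMap ℝ (fun _ : Fin (k + l) => V) ℝ where
  toMultilinearMap :=
    (LinearMap.mul' ℝ ℝ).compMultilinearMap
      ((MultilinearMap.domCoprod (a.toAlternatingMap : MultilinearMap ℝ (fun _ : Fin k => V) ℝ)
        (b.toAlternatingMap : MultilinearMap ℝ (fun _ : Fin l => V) ℝ)).domDomCongr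
        finSumFinEquiv)
  cont := by
    have h : Continuous fun v : Fin (k + l) → V =>
        a (fun i => v (Fin.castAdd l i)) * b (fun i => v (Fin.natAdd k i)) := by
      refine Continuous.mul ?_ ?_
      · exact a.cont.comp (continuous_pi fun i => continuous_apply _)
      · exact b.cont.comp (continuous_pi fun i => continuous_apply _)
    exact h

theorem mulMultilinear_apply {k l : ℕ} (a : V [⋀^Fin k]→L[ℝ] ℝ) (b : V [⋀^Fin l]→L[ℝ] ℝ)
    (v : Fin (k + l) → V) :
    mulMultilinear a b v =
      a (fun i => v (Fin.castAdd l i)) * b (fun i => v (Fin.natAdd k i)) := rfl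

/-- The wedge product of a `k`-covector and an `l`-covector,
`(a ∧ b)(v) = 1/(k! l!) ∑_σ sign(σ) a(v_{σ(1)}, …, v_{σ(k)}) b(v_{σ(k+1)}, …, v_{σ(k+l)})`. -/
def wedgeAlt {k l : ℕ} (a : V [⋀^Fin k]→L[ℝ] ℝ) (b : V [⋀^Fin l]→L[ℝ] ℝ) :
    V [⋀^Fin (k + l)]→L[ℝ] ℝ :=
  ((1 : ℝ) / ((k.factorial : ℝ) * (l.factorial : ℝ))) •
    ContinuousMultilinearMap.alternatization (mulMultilinear a b)

end Algebra

/-! ### Differential forms on a manifold -/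

section Forms

variable {E : Type*} [NormedAddCommGroup E] [NormedSpace ℝ E]
  {H : Type*} [TopologicalSpace H] (I : ModelWithCorners ℝ E H)
  (M : Type*) [TopologicalSpace M] [ChartedSpace H M]

/-- Real differential `k`-forms on `M` (not necessarily smooth). -/
abbrev Form (k : ℕ) : Type _ := (p : M) → TangentSpace I p [⋀^Fin k]→L[ℝ] ℝ

variable {I M}

/-- The pointwise wedge product of forms. -/
def wedge {k l : ℕ} (α : Form I M k) (β : Form I M l) : Form I M (k + l) :=
  fun p => wedgeAlt (α p) (β p)

/-- The coordinate expression of a form in the preferred chart at `q`, i.e. its pullback by the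
inverse of this chart. It is meaningful on the target of the extended chart. -/
def chartRep {k : ℕ} (q : M) (η : Form I M k) (y : E) : E [⋀^Fin k]→L[ℝ] ℝ :=
  (η ((extChartAt I q).symm y)).compContinuousLinearMap
    (mfderivWithin 𝓘(ℝ, E) I (extChartAt I q).symm (range I) y)

/-- A form is smooth if all its coordinate expressions are (up to the boundary). -/
def IsSmoothForm {k : ℕ} (η : Form I M k) : Prop :=
  ∀ q : M, ContDiffOn ℝ ∞ (chartRep q η) (extChartAt I q).target

/-- The exterior derivative, computed at each point `p` in the preferred chart at `p`. -/
def extD {k : ℕ} (η : Form I M k) : Form I M (k + 1) := fun p =>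
  (extDerivWithin (chartRep p η) (range I) (extChartAt I p p)).compContinuousLinearMap
    (mfderiv I 𝓘(ℝ, E) (extChartAt I p) p)

/-- The pullback of a form by a map `f`. -/
def pullback {E' : Type*} [NormedAddCommGroup E'] [NormedSpace ℝ E']
    {H' : Type*} [TopologicalSpace H'] {J : ModelWithCorners ℝ E' H'}
    {N : Type*} [TopologicalSpace N] [ChartedSpace H' N] {k : ℕ} (f : N → M)
    (η : Form I M k) : Form J N k := fun x =>
  (η (f x)).compContinuousLinearMap (mfderiv J I f x)

end Forms

/-! ### Integration of top-degree forms -/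

section Integration

variable {n : ℕ} {H : Type*} [TopologicalSpace H]
  (I : ModelWithCorners ℝ (EuclideanSpace ℝ (Fin n)) H)
  (M : Type*) [TopologicalSpace M] [ChartedSpace H M]

/-- `M` is oriented by its atlas: all coordinate changes have positive Jacobian determinant. -/
def IsOrientedAtlas : Prop :=
  ∀ c ∈ atlas H M, ∀ c' ∈ atlas H M, ∀ y ∈ (I.extendCoordChange c c').source,
    0 < (fderivWithin ℝ (I.extendCoordChange c c') (I.extendCoordChange c c').source y).det

/-- A smooth partition of unity subordinate to the chart domains of `M`. -/
def chartPartition [IsManifold I ∞ M] [T2Space M] [SigmaCompactSpace M] :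
    SmoothPartitionOfUnity M I M univ :=
  (SmoothPartitionOfUnity.exists_isSubordinate_chartAt_source I M).choose

variable {I M}

/-- The integral `∫_K η` of a form of top degree on a compact part `K` of a manifold `M`
oriented by its atlas (with `K = M` if `M` is compact), by a partition of unity. -/
def integralOn [IsManifold I ∞ M] [T2Space M] [SigmaCompactSpace M]
    (K : Set M) (η : Form I M n) : ℝ :=
  ∑ᶠ q : M, ∫ y in (extChartAt I q).target ∩ (extChartAt I q).symm ⁻¹' K,
    chartPartition I M q ((extChartAt I q).symm y) *
      chartRep q η y (EuclideanSpace.basisFun (Fin n) ℝ)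

end Integration

/-! ### The boundary of a manifold with boundary, as a manifold -/

section Boundary

variable (n : ℕ) (M : Type*) [TopologicalSpace M] [ChartedSpace (EuclideanHalfSpace (n + 1)) M]

/-- The boundary `∂M` of an `(n+1)`-dimensional manifold with boundary, with the subspace
topology. -/
abbrev Boundary : Type _ := {p : M // p ∈ (𝓡∂ (n + 1)).boundary M}

/-- The natural inclusion `∂M ↪ M`. -/
def boundaryIncl (x : Boundary n M) : M := x.1

variable {n M}

/-- The inclusion `y ↦ (0, y)` of `ℝⁿ` in the half-space. -/
def consZero (y : EuclideanSpace ℝ (Fin n)) : EuclideanHalfSpace (n + 1) :=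
  ⟨WithLp.toLp 2 (Fin.cons 0 fun i => y i), by simp⟩

/-- The projection forgetting the first coordinate. -/
def dropZero (z : EuclideanHalfSpace (n + 1)) : EuclideanSpace ℝ (Fin n) :=
  WithLp.toLp 2 fun i => z.1 i.succ

theorem dropZero_consZero (y : EuclideanSpace ℝ (Fin n)) : dropZero (consZero y) = y := by
  ext i
  simp [dropZero, consZero]

theorem consZero_dropZero {z : EuclideanHalfSpace (n + 1)} (hz : z.1 0 = 0) :
    consZero (dropZero z) = z := by
  apply Subtype.ext
  ext i
  refine Fin.cases ?_ (fun j => ?_) i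
  · simpa [consZero] using hz.symm
  · simp [consZero, dropZero]

theorem continuous_consZero : Continuous (consZero (n := n)) := by
  refine Continuous.subtype_mk ?_ _
  refine (PiLp.continuous_toLp 2 _).comp (continuous_pi fun i => ?_)
  refine Fin.cases ?_ (fun j => ?_) i
  · simpa using continuous_const
  · simpa using PiLp.continuous_apply 2 _ j

theorem continuous_dropZero : Continuous (dropZero (n := n)) := by
  refine (PiLp.continuous_toLp 2 _).comp (continuous_pi fun i => ?_)
  exact (PiLp.continuous_apply 2 _ i.succ).comp continuous_subtype_val

/-- In any chart, the boundary points are those whose first coordinate vanishes. -/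
theorem mem_boundary_iff [IsManifold (𝓡∂ (n + 1)) ∞ M]
    {c : OpenPartialHomeomorph M (EuclideanHalfSpace (n + 1))}
    (hc : c ∈ atlas (EuclideanHalfSpace (n + 1)) M) {p : M} (hp : p ∈ c.source) :
    p ∈ (𝓡∂ (n + 1)).boundary M ↔ (c p).1 0 = 0 := by
  have h1 : (𝓡∂ (n + 1)).IsInteriorPoint p ↔
      c.extend (𝓡∂ (n + 1)) p ∈ interior (range (𝓡∂ (n + 1))) := by
    rw [(𝓡∂ (n + 1)).isInteriorPoint_iff_of_mem_atlas (n := ∞) (by simp) hc hp]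
    exact ⟨fun h => c.interior_extend_target_subset_interior_range h,
      fun h => c.mem_interior_extend_target (c.map_source hp) h⟩
  have h2 : p ∈ (𝓡∂ (n + 1)).boundary M ↔ ¬ (𝓡∂ (n + 1)).IsInteriorPoint p :=
    (𝓡∂ (n + 1)).isBoundaryPoint_iff_not_isInteriorPoint p
  rw [h2, h1, interior_range_modelWithCornersEuclideanHalfSpace]
  have h3 : 0 ≤ (c p).1 0 := (c p).2
  change ¬ (0 < (c p).1 0) ↔ _
  constructor
  · intro h; linarith
  · intro h; linarith

/-- The chart of `∂M` around `p` induced by a chart `c` of `M`: `x ↦ (c¹(x), …, cⁿ(x))`. -/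
def boundaryChart [IsManifold (𝓡∂ (n + 1)) ∞ M] (p : Boundary n M)
    (c : OpenPartialHomeomorph M (EuclideanHalfSpace (n + 1)))
    (hc : c ∈ atlas (EuclideanHalfSpace (n + 1)) M) :
    OpenPartialHomeomorph (Boundary n M) (EuclideanSpace ℝ (Fin n)) where
  toFun x := dropZero (c x.1)
  invFun y := by
    classical
    exact if h : c.symm (consZero y) ∈ (𝓡∂ (n + 1)).boundary M then ⟨_, h⟩ else p
  source := {x | x.1 ∈ c.source}
  target := {y | consZero y ∈ c.target}
  map_source' x hx := by
    have h0 := (mem_boundary_iff hc hx).1 x.2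
    simpa [consZero_dropZero h0] using c.map_source hx
  map_target' y hy := by
    have hs : c.symm (consZero y) ∈ c.source := c.map_target hy
    have hb : c.symm (consZero y) ∈ (𝓡∂ (n + 1)).boundary M := by
      rw [mem_boundary_iff hc hs, c.right_inv hy]
      simp [consZero]
    simp only [hb, dite_true]
    exact hs
  left_inv' x hx := by
    have h0 := (mem_boundary_iff hc hx).1 x.2
    have hx' : c.symm (consZero (dropZero (c x.1))) = x.1 := by
      rw [consZero_dropZero h0, c.left_inv hx]
    have hb : c.symm (consZero (dropZero (c x.1))) ∈ (𝓡∂ (n + 1)).boundary M := by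
      rw [hx']; exact x.2
    simp only [hb, dite_true]
    exact Subtype.ext hx'
  right_inv' y hy := by
    have hs : c.symm (consZero y) ∈ c.source := c.map_target hy
    have hb : c.symm (consZero y) ∈ (𝓡∂ (n + 1)).boundary M := by
      rw [mem_boundary_iff hc hs, c.right_inv hy]
      simp [consZero]
    simp only [hb, dite_true]
    rw [c.right_inv hy, dropZero_consZero]
  open_source := c.open_source.preimage continuous_subtype_val
  open_target := c.open_target.preimage continuous_consZero
  continuousOn_toFun :=
    continuous_dropZero.comp_continuousOn
      (c.continuousOn.comp continuous_subtype_val.continuousOn fun _ hx => hx)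
  continuousOn_invFun := by
    refine continuousOn_iff_continuous_domRestrict.2 (Topology.IsInducing.subtypeVal.continuous_iff.2 ?_)
    have h : ContinuousOn (fun y => c.symm (consZero y)) {y | consZero y ∈ c.target} :=
      c.continuousOn_symm.comp continuous_consZero.continuousOn fun _ hy => hy
    refine (continuousOn_iff_continuous_domRestrict.1 h).congr fun y => ?_
    have hs : c.symm (consZero y.1) ∈ c.source := c.map_target y.2
    have hb : c.symm (consZero y.1) ∈ (𝓡∂ (n + 1)).boundary M := by
      rw [mem_boundary_iff hc hs, c.right_inv y.2]
      simp [consZero]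
    simp [Set.domRestrict, hb]

/-- The charts of `∂M` are those induced by the preferred charts of `M` at boundary points. -/
instance [IsManifold (𝓡∂ (n + 1)) ∞ M] :
    ChartedSpace (EuclideanSpace ℝ (Fin n)) (Boundary n M) where
  atlas := range fun p : Boundary n M =>
    boundaryChart p (chartAt (EuclideanHalfSpace (n + 1)) p.1) (chart_mem_atlas _ p.1)
  chartAt p := boundaryChart p (chartAt (EuclideanHalfSpace (n + 1)) p.1) (chart_mem_atlas _ p.1)
  mem_chart_source p := mem_chart_source (EuclideanHalfSpace (n + 1)) p.1
  chart_mem_atlas p := mem_range_self p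

/-- The pullback `j^* η` of a form on `M` by the natural inclusion `j : ∂M ↪ M`. -/
def boundaryPullback [IsManifold (𝓡∂ (n + 1)) ∞ M] {k : ℕ} (η : Form (𝓡∂ (n + 1)) M k) :
    Form (𝓡 n) (Boundary n M) k :=
  pullback (boundaryIncl n M) η

end Boundary

/-! ### Connections, triads and the actions -/

section Fields

variable {E : Type*} [NormedAddCommGroup E] [NormedSpace ℝ E]
  {H : Type*} [TopologicalSpace H] {I : ModelWithCorners ℝ E H}
  {M : Type*} [TopologicalSpace M] [ChartedSpace H M]

/-- The Levi-Civita symbol: the determinant of the `i`-th, `j`-th and `k`-th basis vectors. -/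
def eps (i j k : Fin 3) : ℝ :=
  (Matrix.of fun a : Fin 3 => (Pi.single (![i, j, k] a) 1 : Fin 3 → ℝ)).det

/-- The curvature `Fⁱ = dAⁱ + (1/2) εⁱ_{jk} Aʲ ∧ Aᵏ`. -/
def curv (A : Fin 3 → Form I M 1) : Fin 3 → Form I M 2 := fun i =>
  extD (A i) + (1 / 2 : ℝ) • ∑ j, ∑ k, eps i j k • wedge (A j) (A k)

/-- The covariant exterior derivative `Deⁱ = deⁱ + εⁱ_{jk} Aʲ ∧ eᵏ`. -/
def covD (A e : Fin 3 → Form I M 1) : Fin 3 → Form I M 2 := fun i =>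
  extD (e i) + ∑ j, ∑ k, eps i j k • wedge (A j) (e k)

/-- The 2-forms `ε_{ijk} eʲ ∧ eᵏ`. -/
def epsWedge (e : Fin 3 → Form I M 1) : Fin 3 → Form I M 2 := fun i =>
  ∑ j, ∑ k, eps i j k • wedge (e j) (e k)

/-- The Lagrangian
`α₁ ε_{ijk} eⁱ∧eʲ∧Fᵏ + α₂ De_i∧Deⁱ + α₃ F_i∧Fⁱ + α₄ ε_{ijk} Deⁱ∧eʲ∧eᵏ + α₅ F_i∧Deⁱ`. -/
def lagrangian (α₁ α₂ α₃ α₄ α₅ : ℝ) (e A : Fin 3 → Form I M 1) : Form I M 4 :=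
  α₁ • (∑ i, ∑ j, ∑ k, eps i j k • wedge (wedge (e i) (e j)) (curv A k)) +
    α₂ • (∑ i, wedge (covD A e i) (covD A e i)) +
    α₃ • (∑ i, wedge (curv A i) (curv A i)) +
    α₄ • (∑ i, ∑ j, ∑ k, eps i j k • wedge (wedge (covD A e i) (e j)) (e k)) +
    α₅ • (∑ i, wedge (curv A i) (covD A e i))

/-- The two-connection Lagrangian `F_{+i} ∧ F_-ⁱ`. -/
def twoConnLagrangian (Ap Am : Fin 3 → Form I M 1) : Form I M 4 :=
  ∑ i, wedge (curv Ap i) (curv Am i)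

/-- The 3-forms `ε_{ijk} eʲ ∧ Fᵏ`. -/
def hkCurv (e A : Fin 3 → Form I M 1) : Fin 3 → Form I M 3 := fun i =>
  ∑ j, ∑ k, eps i j k • wedge (e j) (curv A k)

/-- The 3-forms `ε_{ijk} Deʲ ∧ eᵏ`. -/
def hkTorsion (e A : Fin 3 → Form I M 1) : Fin 3 → Form I M 3 := fun i =>
  ∑ j, ∑ k, eps i j k • wedge (covD A e j) (e k)

/-- The field equations of 3-dimensional Euclidean general relativity with cosmological constant
`Λ`, for a triad `e` and an `SO(3)`-connection `A` on a 3-manifold (first-order form):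
`Deⁱ = 0` and `F_i + (Λ/2) ε_{ijk} eʲ ∧ eᵏ = 0`. -/
def EuclideanGR3 {N : Type*} [TopologicalSpace N] [ChartedSpace (EuclideanSpace ℝ (Fin 3)) N]
    (Λ : ℝ) (e A : Fin 3 → Form (𝓡 3) N 1) : Prop :=
  (∀ i, covD A e i = 0) ∧ ∀ i, curv A i + (Λ / 2) • epsWedge e i = 0

end Fields

/-! ### Stationary points -/

section Stationary

variable {H : Type*} [TopologicalSpace H]
  {I : ModelWithCorners ℝ (EuclideanSpace ℝ (Fin 4)) H}
  {M : Type*} [TopologicalSpace M] [ChartedSpace H M]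
  [IsManifold I ∞ M] [T2Space M] [SigmaCompactSpace M]

/-- `(X, Y)` is a stationary point of the action `∫ L(X, Y)`: for every compact `K` and all smooth
variations `x, y` vanishing outside `K`, the derivative of `∫_K L(X + t x, Y + t y)` at `t = 0`
vanishes. The set `K` may meet the boundary of `M`, where the variations are not constrained; for
compact `M` this is the stationarity of `∫_M L` under arbitrary smooth variations. -/
def IsStationary (L : (Fin 3 → Form I M 1) → (Fin 3 → Form I M 1) → Form I M 4)
    (X Y : Fin 3 → Form I M 1) : Prop :=
  ∀ (K : Set M) (x y : Fin 3 → Form I M 1), IsCompact K →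
    (∀ i, IsSmoothForm (x i)) → (∀ i, IsSmoothForm (y i)) →
    (∀ p ∉ K, ∀ i, x i p = 0 ∧ y i p = 0) →
    HasDerivAt (fun t : ℝ => integralOn K (L (X + t • x) (Y + t • y))) 0 0

end Stationary

end HKModel

end

noncomputable section

namespace HKModel

/-! ### Wedge products in low degree -/

section LowDegree

/-! Write W, T, F for the triples of 2-forms ε e∧e, De, dA + ½[A,A]. Each of the five terms of the
Lagrangian is an invariant contraction of two of these triples (`lagrangian_eq`). Along (e + t x, A
+ t a) each triple is a quadratic polynomial in t, so the action is a polynomial in t and its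
derivative at 0 is the integral of an explicit 4-form, `firstVariation`.

The heart of the matter is `firstVariation_eq`. The covariant Leibniz rule d(x·b) = Dx·b − x·Db
(`extD_pair_covD`) moves derivatives off the variations, and the identities DF = 0, DT = [F,e], DW =
2[T,e] evaluate what remains. All of them come from the graded Jacobi identity and the invariance of
the contraction (`brk_jacobi`, `sum_wedgeAlt_brk`). The α₃, α₄ and α₅ terms contribute only exact
forms. The α₂ term contributes the same bulk expression as the α₁ term with the opposite sign. What
is left is 2(α₁ − α₂)(x·[e,F] + a·[T,e]) plus the differential of x·(2α₂T + α₄W + α₅F) + a·(α₁W +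
2α₃F + α₅T).

The analytic half is Stokes' theorem and the fundamental lemma. In a chart, Stokes reduces to the
divergence theorem on a box resting on the boundary hyperplane
(`setIntegral_extDerivWithin_halfSpace`, `integralOn_extD`). Variations supported away from the
boundary isolate the bulk coefficients, which vanish in the interior and then everywhere by
continuity. The remaining exact term, tested with variations reaching the boundary, isolates the
pullbacks of the boundary coefficients (`eq_zero_of_integralOn_wedge_add_extD`). Both times the test
form is f·c·dxᵐ, where c is the coefficient to be killed, so that the integrand is f·c² ≥ 0.

For two connections, A₊ = A + ½e and A₋ = A − ½e give F₊ = F + ½T + ⅛W and F₋ = F − ½T + ⅛W. As W·W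
= 0, the Lagrangian F₊·F₋ is the one with α = (¼, −¼, 1, 0, 0), and the general result applies.
Since pullback to the boundary commutes with d and ∧, the boundary conditions are equations for the
pulled-back triad and connection. -/

theorem sum_perm_two (f : (Fin 2 → Fin 2) → ℝ) :
    ∑ σ : Equiv.Perm (Fin 2), (Equiv.Perm.sign σ : ℤ) * f σ = f ![0, 1] - f ![1, 0] := by
  have key : (Finset.univ : Finset (Equiv.Perm (Fin 2))) = {1, Equiv.swap 0 1} := by decide
  rw [key, Finset.sum_pair (by decide)]
  have h1 : ((1 : Equiv.Perm (Fin 2)) : Fin 2 → Fin 2) = ![0, 1] := by decide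
  have h2 : ((Equiv.swap 0 1 : Equiv.Perm (Fin 2)) : Fin 2 → Fin 2) = ![1, 0] := by decide
  rw [h1, h2]; simp [sub_eq_add_neg]

/-- Split by the image i of 0: a permutation is a permutation of the other indices followed by the
transposition of 0 and i, which costs a sign unless i = 0. Iterating lists the permutations of three
and four letters explicitly. -/
theorem sum_perm_succ {n : ℕ} (f : (Fin (n + 1) → Fin (n + 1)) → ℝ) :
    ∑ σ : Equiv.Perm (Fin (n + 1)), (Equiv.Perm.sign σ : ℤ) * f σ =
      ∑ i : Fin (n + 1), (if i = 0 then 1 else -1) * ∑ σ : Equiv.Perm (Fin n), (Equiv.Perm.sign σ : ℤ) *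
        f (Fin.cons i fun j => Equiv.swap 0 i (σ j).succ) := by
  rw [Finset.univ_perm_fin_succ, Finset.sum_map, ← Finset.univ_product_univ, Finset.sum_product]
  refine Finset.sum_congr rfl fun i _ => ?_
  rw [Finset.mul_sum]
  refine Finset.sum_congr rfl fun σ _ => ?_
  have h : ((Equiv.Perm.decomposeFin.symm (i, σ) : Equiv.Perm (Fin (n + 1))) : Fin (n + 1) → Fin (n + 1)) = Fin.cons i fun j => Equiv.swap 0 i (σ j).succ := by
    ext j; refine Fin.cases ?_ (fun j => ?_) j <;> simp
  simp only [Equiv.toEmbedding_apply, h, Equiv.Perm.decomposeFin.symm_sign]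
  split_ifs <;> simp

theorem sum_perm_three (f : (Fin 3 → Fin 3) → ℝ) :
    ∑ σ : Equiv.Perm (Fin 3), (Equiv.Perm.sign σ : ℤ) * f σ =
      f ![0, 1, 2] - f ![0, 2, 1] - f ![1, 0, 2] + f ![1, 2, 0] - f ![2, 1, 0] + f ![2, 0, 1] := by
  have h (i : Fin 3) (τ : Fin 2 → Fin 2) : (Fin.cons i fun j => Equiv.swap 0 i (τ j).succ : Fin 3 → Fin 3) =
    ![i, Equiv.swap 0 i (τ 0).succ, Equiv.swap 0 i (τ 1).succ] := by
    ext j; fin_cases j <;> rfl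
  have h2 (i : Fin 3) := sum_perm_two
    (fun τ => f ![i, Equiv.swap 0 i (τ 0).succ, Equiv.swap 0 i (τ 1).succ])
  refine (sum_perm_succ f).trans ((Fin.sum_univ_three _).trans ?_)
  simp only [h, h2]
  simp [Equiv.swap_apply_def]
  ring

theorem sum_perm_four (f : (Fin 4 → Fin 4) → ℝ) :
    ∑ σ : Equiv.Perm (Fin 4), (Equiv.Perm.sign σ : ℤ) * f σ =
      f ![0, 1, 2, 3] - f ![0, 1, 3, 2] - f ![0, 2, 1, 3] + f ![0, 2, 3, 1] + f ![0, 3, 1, 2] -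
      f ![0, 3, 2, 1] - f ![1, 0, 2, 3] + f ![1, 0, 3, 2] + f ![1, 2, 0, 3] - f ![1, 2, 3, 0] -
      f ![1, 3, 0, 2] + f ![1, 3, 2, 0] + f ![2, 0, 1, 3] - f ![2, 0, 3, 1] - f ![2, 1, 0, 3] +
      f ![2, 1, 3, 0] + f ![2, 3, 0, 1] - f ![2, 3, 1, 0] - f ![3, 0, 1, 2] + f ![3, 0, 2, 1] +
      f ![3, 1, 0, 2] - f ![3, 1, 2, 0] - f ![3, 2, 0, 1] + f ![3, 2, 1, 0] := by
  have h (i : Fin 4) (τ : Fin 3 → Fin 3) : (Fin.cons i fun j => Equiv.swap 0 i (τ j).succ : Fin 4 → Fin 4) =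
    ![i, Equiv.swap 0 i (τ 0).succ, Equiv.swap 0 i (τ 1).succ, Equiv.swap 0 i (τ 2).succ] := by
    ext j; fin_cases j <;> rfl
  have h2 (i : Fin 4) := sum_perm_three (fun τ =>
    f ![i, Equiv.swap 0 i (τ 0).succ, Equiv.swap 0 i (τ 1).succ, Equiv.swap 0 i (τ 2).succ])
  refine (sum_perm_succ f).trans ((Fin.sum_univ_four _).trans ?_)
  simp only [h, h2]
  simp [Equiv.swap_apply_def]
  ring

theorem fin_one_eta {X : Type*} (f : Fin 1 → X) : f = ![f 0] := by ext i; fin_cases i; rfl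

theorem fin_two_eta {X : Type*} (f : Fin 2 → X) : f = ![f 0, f 1] := by
  ext i; fin_cases i <;> rfl

theorem fin_three_eta {X : Type*} (f : Fin 3 → X) : f = ![f 0, f 1, f 2] := by
  ext i; fin_cases i <;> rfl

variable {V : Type*} [AddCommGroup V] [Module ℝ V] [TopologicalSpace V]

theorem wedgeAlt_apply {k l : ℕ} (a : V [⋀^Fin k]→L[ℝ] ℝ) (b : V [⋀^Fin l]→L[ℝ] ℝ) (v : Fin (k + l) → V) :
  wedgeAlt a b v = ((1 : ℝ) / ((k.factorial : ℝ) * (l.factorial : ℝ))) * ∑ σ : Equiv.Perm (Fin (k + l)), (Equiv.Perm.sign σ : ℤ) * (a (fun i => v (σ (Fin.castAdd l i))) * b (fun i => v (σ (Fin.natAdd k i)))) := by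
  simp [wedgeAlt, ContinuousMultilinearMap.alternatization_apply_apply, mulMultilinear_apply, Units.smul_def]

theorem map_pair_swap (B : V [⋀^Fin 2]→L[ℝ] ℝ) (u w : V) : B ![u, w] = -B ![w, u] := by
  have := B.toAlternatingMap.map_swap ![w, u] (show (0 : Fin 2) ≠ 1 by decide)
  rw [ContinuousAlternatingMap.coe_toAlternatingMap] at this
  rw [← this]
  congr 1; ext k; fin_cases k <;> rfl

theorem map_triple_swap (B : V [⋀^Fin 3]→L[ℝ] ℝ) (u w z : V) :
    B ![u, w, z] = -B ![w, u, z] ∧ B ![u, w, z] = -B ![u, z, w] := by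
  have h1 := B.toAlternatingMap.map_swap ![w, u, z] (show (0 : Fin 3) ≠ 1 by decide)
  have h2 := B.toAlternatingMap.map_swap ![u, z, w] (show (1 : Fin 3) ≠ 2 by decide)
  rw [ContinuousAlternatingMap.coe_toAlternatingMap] at h1 h2
  rw [← h1, ← h2]
  constructor <;> congr 1 <;> ext k <;> fin_cases k <;> rfl

/-- In this formula and the following ones the factor 1/(k! l!) cancels the permutations within the
two blocks, leaving one signed term per shuffle. -/
theorem wedgeAlt_one_one (a b : V [⋀^Fin 1]→L[ℝ] ℝ) (v : Fin 2 → V) :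
    wedgeAlt a b v = a ![v 0] * b ![v 1] - a ![v 1] * b ![v 0] := by
  rw [wedgeAlt_apply]
  have h := sum_perm_two fun τ => a ![v (τ 0)] * b ![v (τ 1)]
  have h' (σ : Equiv.Perm (Fin 2)) : a (fun i => v (σ (Fin.castAdd 1 i))) * b (fun i => v (σ (Fin.natAdd 1 i))) =
      a ![v (σ 0)] * b ![v (σ 1)] := by
    rw [fin_one_eta fun i => v (σ (Fin.castAdd 1 i)), fin_one_eta fun i => v (σ (Fin.natAdd 1 i))]; rfl
  simp only [h']
  erw [h]
  simp

theorem wedgeAlt_one_two (a : V [⋀^Fin 1]→L[ℝ] ℝ) (b : V [⋀^Fin 2]→L[ℝ] ℝ) (v : Fin 3 → V) :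
    wedgeAlt a b v = a ![v 0] * b ![v 1, v 2] - a ![v 1] * b ![v 0, v 2] + a ![v 2] * b ![v 0, v 1] := by
  rw [wedgeAlt_apply]
  have h := sum_perm_three fun τ => a ![v (τ 0)] * b ![v (τ 1), v (τ 2)]
  have h' (σ : Equiv.Perm (Fin 3)) : a (fun i => v (σ (Fin.castAdd 2 i))) * b (fun i => v (σ (Fin.natAdd 1 i))) =
      a ![v (σ 0)] * b ![v (σ 1), v (σ 2)] := by
    rw [fin_one_eta fun i => v (σ (Fin.castAdd 2 i)), fin_two_eta fun i => v (σ (Fin.natAdd 1 i))]; rfl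
  simp only [h']
  erw [h]
  simp [map_pair_swap b (v 2) (v 1), map_pair_swap b (v 2) (v 0), map_pair_swap b (v 1) (v 0)]
  ring

theorem wedgeAlt_two_one (a : V [⋀^Fin 2]→L[ℝ] ℝ) (b : V [⋀^Fin 1]→L[ℝ] ℝ) (v : Fin 3 → V) :
    wedgeAlt a b v = b ![v 0] * a ![v 1, v 2] - b ![v 1] * a ![v 0, v 2] + b ![v 2] * a ![v 0, v 1] := by
  rw [wedgeAlt_apply]
  have h := sum_perm_three fun τ => a ![v (τ 0), v (τ 1)] * b ![v (τ 2)]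
  have h' (σ : Equiv.Perm (Fin 3)) : a (fun i => v (σ (Fin.castAdd 1 i))) * b (fun i => v (σ (Fin.natAdd 2 i))) =
      a ![v (σ 0), v (σ 1)] * b ![v (σ 2)] := by
    rw [fin_two_eta fun i => v (σ (Fin.castAdd 1 i)), fin_one_eta fun i => v (σ (Fin.natAdd 2 i))]; rfl
  simp only [h']
  erw [h]
  simp [map_pair_swap a (v 2) (v 1), map_pair_swap a (v 2) (v 0), map_pair_swap a (v 1) (v 0)]
  ring

theorem wedgeAlt_two_two (a b : V [⋀^Fin 2]→L[ℝ] ℝ) (v : Fin 4 → V) :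
    wedgeAlt a b v = a ![v 0, v 1] * b ![v 2, v 3] - a ![v 0, v 2] * b ![v 1, v 3] +
      a ![v 0, v 3] * b ![v 1, v 2] + a ![v 1, v 2] * b ![v 0, v 3] -
      a ![v 1, v 3] * b ![v 0, v 2] + a ![v 2, v 3] * b ![v 0, v 1] := by
  rw [wedgeAlt_apply]
  have h := sum_perm_four fun τ => a ![v (τ 0), v (τ 1)] * b ![v (τ 2), v (τ 3)]
  have h' (σ : Equiv.Perm (Fin 4)) : a (fun i => v (σ (Fin.castAdd 2 i))) * b (fun i => v (σ (Fin.natAdd 2 i))) =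
      a ![v (σ 0), v (σ 1)] * b ![v (σ 2), v (σ 3)] := by
    rw [fin_two_eta fun i => v (σ (Fin.castAdd 2 i)), fin_two_eta fun i => v (σ (Fin.natAdd 2 i))]; rfl
  simp only [h']
  erw [h]
  have hs (c : V [⋀^Fin 2]→L[ℝ] ℝ) := And.intro (map_pair_swap c (v 1) (v 0)) <| And.intro (map_pair_swap c (v 2) (v 0)) <|
    And.intro (map_pair_swap c (v 3) (v 0)) <| And.intro (map_pair_swap c (v 2) (v 1)) <|
    And.intro (map_pair_swap c (v 3) (v 1)) (map_pair_swap c (v 3) (v 2))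
  simp [hs]
  ring

theorem wedgeAlt_one_three (a : V [⋀^Fin 1]→L[ℝ] ℝ) (b : V [⋀^Fin 3]→L[ℝ] ℝ) (v : Fin 4 → V) :
    wedgeAlt a b v = a ![v 0] * b ![v 1, v 2, v 3] - a ![v 1] * b ![v 0, v 2, v 3] +
      a ![v 2] * b ![v 0, v 1, v 3] - a ![v 3] * b ![v 0, v 1, v 2] := by
  rw [wedgeAlt_apply]
  have h := sum_perm_four fun τ => a ![v (τ 0)] * b ![v (τ 1), v (τ 2), v (τ 3)]
  have h' (σ : Equiv.Perm (Fin 4)) : a (fun i => v (σ (Fin.castAdd 3 i))) * b (fun i => v (σ (Fin.natAdd 1 i))) =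
      a ![v (σ 0)] * b ![v (σ 1), v (σ 2), v (σ 3)] := by
    rw [fin_one_eta fun i => v (σ (Fin.castAdd 3 i)), fin_three_eta fun i => v (σ (Fin.natAdd 1 i))]; rfl
  simp only [h']
  erw [h]
  -- Bringing all argument orders to the increasing one lets `ring` collect the 3! equal terms of
  -- each shuffle.
  have hs (x y z : V) : b ![y, z, x] = b ![x, y, z] ∧ b ![z, x, y] = b ![x, y, z] ∧ b ![y, x, z] = - b ![x, y, z] ∧
      b ![x, z, y] = - b ![x, y, z] ∧ b ![z, y, x] = - b ![x, y, z] := by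
    have h1 := map_triple_swap b x y z
    have h2 := map_triple_swap b z y x
    have h3 := map_triple_swap b y z x
    refine ⟨?_, ?_, ?_, ?_, ?_⟩ <;> linarith [h1.1, h1.2, h2.1, h2.2, h3.1, h3.2]
  simp [hs (v 0) (v 1) (v 2), hs (v 0) (v 1) (v 3), hs (v 0) (v 2) (v 3), hs (v 1) (v 2) (v 3), Nat.factorial]
  ring


/-! ### Bilinearity and naturality of the wedge product -/

section Bilinear

variable {k l : ℕ}

theorem wedgeAlt_add_left (a a' : V [⋀^Fin k]→L[ℝ] ℝ) (b : V [⋀^Fin l]→L[ℝ] ℝ) :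
    wedgeAlt (a + a') b = wedgeAlt a b + wedgeAlt a' b := by
  ext v
  simp only [wedgeAlt_apply, ContinuousAlternatingMap.add_apply, ← mul_add,
    ← Finset.sum_add_distrib, add_mul]

theorem wedgeAlt_add_right (a : V [⋀^Fin k]→L[ℝ] ℝ) (b b' : V [⋀^Fin l]→L[ℝ] ℝ) :
    wedgeAlt a (b + b') = wedgeAlt a b + wedgeAlt a b' := by
  ext v
  simp only [wedgeAlt_apply, ContinuousAlternatingMap.add_apply, ← mul_add,
    ← Finset.sum_add_distrib]

theorem wedgeAlt_smul_left (c : ℝ) (a : V [⋀^Fin k]→L[ℝ] ℝ) (b : V [⋀^Fin l]→L[ℝ] ℝ) :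
    wedgeAlt (c • a) b = c • wedgeAlt a b := by
  ext v
  simp only [wedgeAlt_apply, ContinuousAlternatingMap.smul_apply, smul_eq_mul, Finset.mul_sum]
  exact Finset.sum_congr rfl fun σ _ => by ring

theorem wedgeAlt_smul_right (c : ℝ) (a : V [⋀^Fin k]→L[ℝ] ℝ) (b : V [⋀^Fin l]→L[ℝ] ℝ) :
    wedgeAlt a (c • b) = c • wedgeAlt a b := by
  ext v
  simp only [wedgeAlt_apply, ContinuousAlternatingMap.smul_apply, smul_eq_mul, Finset.mul_sum]
  exact Finset.sum_congr rfl fun σ _ => by ring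

theorem wedgeAlt_compContinuousLinearMap {W : Type*} [AddCommGroup W] [Module ℝ W]
    [TopologicalSpace W] (a : V [⋀^Fin k]→L[ℝ] ℝ) (b : V [⋀^Fin l]→L[ℝ] ℝ) (f : W →L[ℝ] V) :
    (wedgeAlt a b).compContinuousLinearMap f =
      wedgeAlt (a.compContinuousLinearMap f) (b.compContinuousLinearMap f) := by
  ext v
  simp only [wedgeAlt_apply, ContinuousAlternatingMap.compContinuousLinearMap_apply]
  rfl

end Bilinear

end LowDegree

/-! ### The wedge product as a continuous bilinear map -/

section Normed

variable {E : Type*} [NormedAddCommGroup E] [NormedSpace ℝ E] {k l : ℕ}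

/-- A crude bound: the prefactor is at most 1 and each of the (k+l)! permutations contributes at
most ‖a‖‖b‖∏‖vᵢ‖. It serves only to make the wedge product continuous. -/
theorem norm_wedgeAlt_le (a : E [⋀^Fin k]→L[ℝ] ℝ) (b : E [⋀^Fin l]→L[ℝ] ℝ) :
    ‖wedgeAlt a b‖ ≤ ((k + l).factorial : ℝ) * ‖a‖ * ‖b‖ := by
  refine ContinuousAlternatingMap.opNorm_le_bound _ (by positivity) fun v => ?_
  rw [wedgeAlt_apply, norm_mul]
  have h1 : ‖(1 : ℝ) / ((k.factorial : ℝ) * (l.factorial : ℝ))‖ ≤ 1 := by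
    rw [Real.norm_of_nonneg (by positivity), div_le_one (by positivity)]
    have := Nat.mul_pos k.factorial_pos l.factorial_pos
    exact_mod_cast this
  have h2 : ‖∑ σ : Equiv.Perm (Fin (k + l)), ((Equiv.Perm.sign σ : ℤ) : ℝ) *
      (a (fun i => v (σ (Fin.castAdd l i))) * b (fun i => v (σ (Fin.natAdd k i))))‖ ≤
      ∑ σ : Equiv.Perm (Fin (k + l)), ‖a‖ * ‖b‖ * ∏ i, ‖v i‖ := by
    refine (norm_sum_le _ _).trans (Finset.sum_le_sum fun σ _ => ?_)
    have hs : ‖((Equiv.Perm.sign σ : ℤ) : ℝ)‖ = 1 := by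
      rcases Int.units_eq_one_or (Equiv.Perm.sign σ) with h | h <;> simp [h]
    -- The product of norms is reindexed by σ and cut after k factors, to match the two
    -- operator-norm bounds.
    rw [norm_mul, hs, one_mul, norm_mul, ← Equiv.prod_comp σ, Fin.prod_univ_add, mul_mul_mul_comm]
    exact mul_le_mul (a.le_opNorm _) (b.le_opNorm _) (norm_nonneg _) (by positivity)
  rw [Finset.sum_const, Finset.card_univ, Fintype.card_perm, Fintype.card_fin, nsmul_eq_mul] at h2
  calc _ ≤ 1 * (((k + l).factorial : ℝ) * (‖a‖ * ‖b‖ * ∏ i, ‖v i‖)) :=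
        mul_le_mul h1 h2 (norm_nonneg _) zero_le_one
    _ = _ := by ring

/-- The wedge product as a continuous bilinear map. -/
def wedgeCLM (E : Type*) [NormedAddCommGroup E] [NormedSpace ℝ E] (k l : ℕ) :
    E [⋀^Fin k]→L[ℝ] ℝ →L[ℝ] E [⋀^Fin l]→L[ℝ] ℝ →L[ℝ] E [⋀^Fin (k + l)]→L[ℝ] ℝ :=
  LinearMap.mkContinuous₂
    (LinearMap.mk₂ ℝ wedgeAlt wedgeAlt_add_left wedgeAlt_smul_left wedgeAlt_add_right
      wedgeAlt_smul_right) ((k + l).factorial : ℝ) norm_wedgeAlt_le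

theorem wedgeCLM_apply (a : E [⋀^Fin k]→L[ℝ] ℝ) (b : E [⋀^Fin l]→L[ℝ] ℝ) :
    wedgeCLM E k l a b = wedgeAlt a b := rfl

theorem contDiffOn_wedgeAlt {F : Type*} [NormedAddCommGroup F] [NormedSpace ℝ F]
    {n : WithTop ℕ∞} {s : Set F}
    {a : F → E [⋀^Fin k]→L[ℝ] ℝ} {b : F → E [⋀^Fin l]→L[ℝ] ℝ}
    (ha : ContDiffOn ℝ n a s) (hb : ContDiffOn ℝ n b s) :
    ContDiffOn ℝ n (fun y => wedgeAlt (a y) (b y)) s := by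
  have h := (wedgeCLM E k l).isBoundedBilinearMap.contDiff (n := n)
  exact h.comp_contDiffOn (f := fun y => (a y, b y)) (ha.prodMk hb)

theorem fderivWithin_wedgeAlt {F : Type*} [NormedAddCommGroup F] [NormedSpace ℝ F]
    {s : Set F} {x : F} {a : F → E [⋀^Fin k]→L[ℝ] ℝ} {b : F → E [⋀^Fin l]→L[ℝ] ℝ}
    (ha : DifferentiableWithinAt ℝ a s x) (hb : DifferentiableWithinAt ℝ b s x)
    (hs : UniqueDiffWithinAt ℝ s x) (v : F) :
    fderivWithin ℝ (fun y => wedgeAlt (a y) (b y)) s x v =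
      wedgeAlt (fderivWithin ℝ a s x v) (b x) + wedgeAlt (a x) (fderivWithin ℝ b s x v) := by
  have h := ((wedgeCLM E k l).hasFDerivWithinAt_of_bilinear ha.hasFDerivWithinAt
    hb.hasFDerivWithinAt).fderivWithin hs
  simp only [wedgeCLM_apply] at h
  rw [h]
  simp [wedgeCLM_apply, add_comm]

theorem extDerivWithin_apply' {η : E → E [⋀^Fin k]→L[ℝ] ℝ} {s : Set E} {x : E}
    (v : Fin (k + 1) → E) :
    extDerivWithin η s x v = ∑ i, (-1) ^ i.val * fderivWithin ℝ η s x (v i) (i.removeNth v) := by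
  simp [extDerivWithin, ContinuousAlternatingMap.alternatizeUncurryFin_apply]

theorem extDerivWithin_one_apply {η : E → E [⋀^Fin 1]→L[ℝ] ℝ} {s : Set E} {x : E}
    (v : Fin 2 → E) :
    extDerivWithin η s x v =
      fderivWithin ℝ η s x (v 0) ![v 1] - fderivWithin ℝ η s x (v 1) ![v 0] := by
  rw [extDerivWithin_apply', Fin.sum_univ_two, fin_one_eta (Fin.removeNth 0 v),
    fin_one_eta (Fin.removeNth 1 v)]
  simp [Fin.removeNth, sub_eq_add_neg]

theorem extDerivWithin_two_apply {η : E → E [⋀^Fin 2]→L[ℝ] ℝ} {s : Set E} {x : E}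
    (v : Fin 3 → E) :
    extDerivWithin η s x v = fderivWithin ℝ η s x (v 0) ![v 1, v 2] -
      fderivWithin ℝ η s x (v 1) ![v 0, v 2] + fderivWithin ℝ η s x (v 2) ![v 0, v 1] := by
  rw [extDerivWithin_apply', Fin.sum_univ_three, fin_two_eta (Fin.removeNth 0 v),
    fin_two_eta (Fin.removeNth 1 v), fin_two_eta (Fin.removeNth 2 v)]
  have h : Fin.succAbove (2 : Fin 3) (1 : Fin 2) = 1 := by decide
  have h' : Fin.succAbove (1 : Fin 3) (1 : Fin 2) = 2 := by decide
  simp [Fin.removeNth, sub_eq_add_neg, h, h']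

theorem extDerivWithin_three_apply {η : E → E [⋀^Fin 3]→L[ℝ] ℝ} {s : Set E} {x : E}
    (v : Fin 4 → E) :
    extDerivWithin η s x v = fderivWithin ℝ η s x (v 0) ![v 1, v 2, v 3] -
      fderivWithin ℝ η s x (v 1) ![v 0, v 2, v 3] + fderivWithin ℝ η s x (v 2) ![v 0, v 1, v 3] -
      fderivWithin ℝ η s x (v 3) ![v 0, v 1, v 2] := by
  rw [extDerivWithin_apply', Fin.sum_univ_four, fin_three_eta (Fin.removeNth 0 v),
    fin_three_eta (Fin.removeNth 1 v), fin_three_eta (Fin.removeNth 2 v),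
    fin_three_eta (Fin.removeNth 3 v)]
  have h : Fin.succAbove (1 : Fin 4) (2 : Fin 3) = 3 ∧ Fin.succAbove (2 : Fin 4) (1 : Fin 3) = 1 ∧
      Fin.succAbove (2 : Fin 4) (2 : Fin 3) = 3 ∧ Fin.succAbove (3 : Fin 4) (1 : Fin 3) = 1 ∧
      Fin.succAbove (3 : Fin 4) (2 : Fin 3) = 2 := by decide
  simp [Fin.removeNth, sub_eq_add_neg, h, show (-1 : ℝ) ^ 3 = -1 by norm_num]

/-- The graded Leibniz rule, checked by evaluating both sides with the shuffle formulas. Only the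
degrees (1,1) and (1,2) occur in the variation. -/
theorem extDerivWithin_wedgeAlt_one_one {a b : E → E [⋀^Fin 1]→L[ℝ] ℝ} {s : Set E} {x : E}
    (ha : DifferentiableWithinAt ℝ a s x) (hb : DifferentiableWithinAt ℝ b s x)
    (hs : UniqueDiffWithinAt ℝ s x) :
    extDerivWithin (fun y => wedgeAlt (a y) (b y)) s x =
      wedgeAlt (k := 2) (l := 1) (extDerivWithin a s x) (b x) -
        wedgeAlt (k := 1) (l := 2) (a x) (extDerivWithin b s x) := by
  ext v
  refine (extDerivWithin_two_apply v).trans ?_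
  simp only [fderivWithin_wedgeAlt ha hb hs, ContinuousAlternatingMap.sub_apply,
    ContinuousAlternatingMap.add_apply]
  erw [wedgeAlt_two_one, wedgeAlt_one_two]
  simp only [wedgeAlt_one_one, extDerivWithin_one_apply]
  simp
  ring

theorem extDerivWithin_wedgeAlt_one_two {a : E → E [⋀^Fin 1]→L[ℝ] ℝ}
    {b : E → E [⋀^Fin 2]→L[ℝ] ℝ} {s : Set E} {x : E}
    (ha : DifferentiableWithinAt ℝ a s x) (hb : DifferentiableWithinAt ℝ b s x)
    (hs : UniqueDiffWithinAt ℝ s x) :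
    extDerivWithin (fun y => wedgeAlt (a y) (b y)) s x =
      wedgeAlt (k := 2) (l := 2) (extDerivWithin a s x) (b x) -
        wedgeAlt (k := 1) (l := 3) (a x) (extDerivWithin b s x) := by
  ext v
  refine (extDerivWithin_three_apply v).trans ?_
  simp only [fderivWithin_wedgeAlt ha hb hs, ContinuousAlternatingMap.sub_apply,
    ContinuousAlternatingMap.add_apply]
  erw [wedgeAlt_two_two, wedgeAlt_one_three]
  simp only [wedgeAlt_one_two, extDerivWithin_one_apply, extDerivWithin_two_apply]
  simp
  ring

end Normed

/-! ### Calculus of forms in charts -/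

theorem two_le_infty : (2 : ℕ∞ω) ≤ ∞ :=
  WithTop.coe_le_coe.2 (le_top : (2 : ℕ∞) ≤ ⊤)

section Charts

variable {E : Type*} [NormedAddCommGroup E] [NormedSpace ℝ E]
  {H : Type*} [TopologicalSpace H] {I : ModelWithCorners ℝ E H}
  {M : Type*} [TopologicalSpace M] [ChartedSpace H M] {k l : ℕ}

/-- The value of a form, regarded as a covector of the model space. -/
def covec (η : Form I M k) (p : M) : E [⋀^Fin k]→L[ℝ] ℝ := η p

theorem chartRep_wedge (q : M) (α : Form I M k) (β : Form I M l) (y : E) :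
    chartRep q (wedge α β) y = wedgeAlt (chartRep q α y) (chartRep q β y) :=
  wedgeAlt_compContinuousLinearMap _ _ _

theorem chartRep_zero (q : M) : chartRep q (0 : Form I M k) = 0 := rfl

theorem chartRep_of_eq_zero (q : M) {α : Form I M k} {y : E}
    (h : α ((extChartAt I q).symm y) = 0) : chartRep q α y = 0 := by
  rw [chartRep, h]; rfl

/-- The product of a form with a function. -/
def fsmul (f : M → ℝ) (α : Form I M k) : Form I M k := fun p => f p • α p

theorem chartRep_fsmul (q : M) (f : M → ℝ) (α : Form I M k) (y : E) :
    chartRep q (fsmul f α) y = f ((extChartAt I q).symm y) • chartRep q α y := rfl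

theorem uniqueDiffWithinAt_range {q : M} {y : E} (hy : y ∈ (extChartAt I q).target) :
    UniqueDiffWithinAt ℝ (range I) y :=
  I.uniqueDiffOn y (extChartAt_target_subset_range q hy)

theorem coordChange_mem_target (p q : M) {y : E}
    (hp : (extChartAt I q).symm y ∈ (chartAt H p).source) :
    (extChartAt I p ∘ (extChartAt I q).symm) y ∈ (extChartAt I p).target :=
  (extChartAt I p).map_source (by rwa [extChartAt_source])

theorem eventually_mem_source (p q : M) {y : E} (hy : y ∈ (extChartAt I q).target)
    (hp : (extChartAt I q).symm y ∈ (chartAt H p).source) :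
    ∀ᶠ x in 𝓝[range I] y, x ∈ (extChartAt I q).target ∧
      (extChartAt I q).symm x ∈ (chartAt H p).source := by
  refine Filter.Eventually.and (extChartAt_target_mem_nhdsWithin_of_mem hy) ?_
  exact (continuousAt_extChartAt_symm'' hy).continuousWithinAt.eventually
    ((chartAt H p).open_source.mem_nhds hp)

theorem IsSmoothForm.contDiffWithinAt {η : Form I M k} (hη : IsSmoothForm η) {q : M} {y : E}
    (hy : y ∈ (extChartAt I q).target) : ContDiffWithinAt ℝ ∞ (chartRep q η) (range I) y :=
  (hη q y hy).mono_of_mem_nhdsWithin (extChartAt_target_mem_nhdsWithin_of_mem hy)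

theorem IsSmoothForm.differentiableWithinAt {η : Form I M k} (hη : IsSmoothForm η) {q : M} {y : E}
    (hy : y ∈ (extChartAt I q).target) : DifferentiableWithinAt ℝ (chartRep q η) (range I) y :=
  (hη.contDiffWithinAt hy).differentiableWithinAt (by simp)

variable [IsManifold I ∞ M]

theorem isManifold_one_of_infty : IsManifold I 1 M := .of_le (n := ∞) (by simp)

/-- The change of coordinates between preferred charts, on which it is smooth. -/
theorem contDiffWithinAt_coordChange (p q : M) {y : E} (hy : y ∈ (extChartAt I q).target)
    (hp : (extChartAt I q).symm y ∈ (chartAt H p).source) :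
    ContDiffWithinAt ℝ ∞ (extChartAt I p ∘ (extChartAt I q).symm) (range I) y := by
  refine contDiffWithinAt_ext_coord_change p q ?_
  rw [PartialEquiv.trans_source, PartialEquiv.symm_source]
  exact ⟨hy, by simpa using hp⟩

/-- The tangent space at a point is the model space seen through the preferred chart there, so the
derivative of an inverse chart is that of a coordinate change into the chart preferred at the image
point. -/
theorem mfderivWithin_extChartAt_symm_eq (q : M) {y : E} (hy : y ∈ (extChartAt I q).target) :
    (mfderivWithin 𝓘(ℝ, E) I (extChartAt I q).symm (range I) y : E →L[ℝ] E) =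
      fderivWithin ℝ (extChartAt I ((extChartAt I q).symm y) ∘ (extChartAt I q).symm)
        (range I) y := by
  have := isManifold_one_of_infty (I := I) (M := M)
  have h := mdifferentiableWithinAt_extChartAt_symm (I := I) hy
  simp only [mfderivWithin, h, writtenInExtChartAt, extChartAt_self_eq]
  simp
  rfl

theorem chartRep_eq (q : M) (η : Form I M k) {y : E} (hy : y ∈ (extChartAt I q).target) :
    chartRep q η y = (covec η ((extChartAt I q).symm y)).compContinuousLinearMap
      (fderivWithin ℝ (extChartAt I ((extChartAt I q).symm y) ∘ (extChartAt I q).symm)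
        (range I) y) := by
  rw [← mfderivWithin_extChartAt_symm_eq q hy]
  rfl

/-- At its own centre the preferred chart has identity derivative. Pointwise identities of forms can
therefore be checked at chart centres. -/
theorem chartRep_self (p : M) (η : Form I M k) :
    chartRep p η (extChartAt I p p) = covec η p := by
  have := isManifold_one_of_infty (I := I) (M := M)
  have h : (mfderivWithin 𝓘(ℝ, E) I (extChartAt I p).symm (range I) (extChartAt I p p) :
      E →L[ℝ] E) = ContinuousLinearMap.id ℝ E := mfderivWithin_range_extChartAt_symm
  have h2 : chartRep p η (extChartAt I p p) =
      (covec η ((extChartAt I p).symm (extChartAt I p p))).compContinuousLinearMap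
        (mfderivWithin 𝓘(ℝ, E) I (extChartAt I p).symm (range I) (extChartAt I p p) :
          E →L[ℝ] E) := rfl
  rw [h2, h, extChartAt_to_inv (I := I) p]
  rfl

/-- Coordinate expressions in two charts are related by the pullback by the coordinate change. -/
theorem chartRep_coordChange (p q : M) (η : Form I M k) {y : E}
    (hy : y ∈ (extChartAt I q).target) (hp : (extChartAt I q).symm y ∈ (chartAt H p).source) :
    chartRep q η y = (chartRep p η ((extChartAt I p ∘ (extChartAt I q).symm) y)).compContinuousLinearMap
      (fderivWithin ℝ (extChartAt I p ∘ (extChartAt I q).symm) (range I) y) := by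
  have hz := coordChange_mem_target p q hp
  have hinv : ∀ x, (extChartAt I q).symm x ∈ (chartAt H p).source →
      (extChartAt I p).symm ((extChartAt I p ∘ (extChartAt I q).symm) x) =
        (extChartAt I q).symm x := fun x hx =>
    (extChartAt I p).left_inv (by rwa [extChartAt_source])
  rw [chartRep_eq q η hy, chartRep_eq p η hz]
  have hr := hinv y hp
  set r := (extChartAt I q).symm y with hrdef
  rw [hr]
  have h1 := (contDiffWithinAt_coordChange p q hy hp).differentiableWithinAt (by simp)
  have h2 := (contDiffWithinAt_coordChange r p hz (by
    rw [hr]; exact mem_chart_source H r)).differentiableWithinAt (by simp)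
  have hmap : MapsTo (extChartAt I p ∘ (extChartAt I q).symm) (range I) (range I) :=
    fun x _ => mem_range_self _
  -- The chain rule for passing from q to r by way of p, valid near y, where all three charts are
  -- defined.
  have h3 : fderivWithin ℝ (extChartAt I r ∘ (extChartAt I q).symm) (range I) y =
      (fderivWithin ℝ (extChartAt I r ∘ (extChartAt I p).symm) (range I)
        ((extChartAt I p ∘ (extChartAt I q).symm) y)).comp
      (fderivWithin ℝ (extChartAt I p ∘ (extChartAt I q).symm) (range I) y) := by
    rw [← fderivWithin_comp y h2 h1 hmap (uniqueDiffWithinAt_range hy)]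
    refine Filter.EventuallyEq.fderivWithin_eq ?_ (by simp only [comp_apply] at hr ⊢; rw [hr])
    filter_upwards [eventually_mem_source p q hy hp] with x hx
    have := hinv x hx.2
    simp only [comp_apply] at this ⊢
    rw [this]
  rw [h3]
  rfl

theorem chartRep_extD_self (p : M) (η : Form I M k) :
    covec (extD η) p =
      extDerivWithin (chartRep p η) (range I) (extChartAt I p p) := by
  have := isManifold_one_of_infty (I := I) (M := M)
  have h : (mfderiv I 𝓘(ℝ, E) (extChartAt I p) p : E →L[ℝ] E) = ContinuousLinearMap.id ℝ E :=
    mfderiv_extChartAt_self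
  have h2 : covec (extD η) p =
      (extDerivWithin (chartRep p η) (range I) (extChartAt I p p)).compContinuousLinearMap
        (mfderiv I 𝓘(ℝ, E) (extChartAt I p) p : E →L[ℝ] E) := rfl
  rw [h2, h]
  rfl

/-- The exterior derivative is computed by the same formula in all charts. -/
theorem chartRep_extD {η : Form I M k} (hη : IsSmoothForm η) (q : M) {y : E}
    (hy : y ∈ (extChartAt I q).target) :
    chartRep q (extD η) y = extDerivWithin (chartRep q η) (range I) y := by
  rw [chartRep_eq q _ hy]
  set p := (extChartAt I q).symm y with hpdef
  have hp : (extChartAt I q).symm y ∈ (chartAt H p).source := mem_chart_source H p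
  have hyr := extChartAt_target_subset_range q hy
  -- Naturality of the exterior derivative under the coordinate change from the chart at q to the
  -- chart at p.
  have h : extDerivWithin (fun x =>
      (chartRep p η ((extChartAt I p ∘ (extChartAt I q).symm) x)).compContinuousLinearMap
        (fderivWithin ℝ (extChartAt I p ∘ (extChartAt I q).symm) (range I) x)) (range I) y =
      (extDerivWithin (chartRep p η) (range I) ((extChartAt I p ∘ (extChartAt I q).symm) y)
        ).compContinuousLinearMap
        (fderivWithin ℝ (extChartAt I p ∘ (extChartAt I q).symm) (range I) y) :=
    extDerivWithin_pullback (r := ∞)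
    (hη.differentiableWithinAt (coordChange_mem_target p q hp))
    (contDiffWithinAt_coordChange p q hy hp) (by
      rw [minSmoothness_of_isRCLikeNormedField]; exact two_le_infty)
    I.uniqueDiffOn (I.range_subset_closure_interior hyr) hyr fun x _ => mem_range_self _
  have h2 : covec (extD η) p =
    extDerivWithin (chartRep p η) (range I) ((extChartAt I p ∘ (extChartAt I q).symm) y) :=
    chartRep_extD_self p η
  rw [h2, ← h]
  refine (Filter.EventuallyEq.extDerivWithin_eq_of_mem ?_ hyr).symm
  filter_upwards [eventually_mem_source p q hy hp] with x hx
  exact chartRep_coordChange p q η hx.1 hx.2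

theorem extDerivWithin_contDiffOn {s : Set E} {η : E → E [⋀^Fin k]→L[ℝ] ℝ}
    (h : ContDiffOn ℝ ∞ η s) (hs : UniqueDiffOn ℝ s) :
    ContDiffOn ℝ ∞ (extDerivWithin η s) s :=
  (ContinuousAlternatingMap.alternatizeUncurryFinCLM ℝ E ℝ).contDiff.comp_contDiffOn
    (h.fderivWithin hs (by simp))

theorem IsSmoothForm.extD {η : Form I M k} (hη : IsSmoothForm η) : IsSmoothForm (extD η) := by
  intro q
  refine (extDerivWithin_contDiffOn (hη q) (uniqueDiffOn_extChartAt_target q)).congr fun y hy => ?_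
  -- The chart target is a neighbourhood of y within `range I`, so derivatives within the two sets
  -- agree.
  rw [chartRep_extD hη q hy, extDerivWithin, extDerivWithin,
    fderivWithin_of_mem_nhdsWithin (extChartAt_target_mem_nhdsWithin_of_mem hy)
      (uniqueDiffWithinAt_range hy) ((hη q y hy).differentiableWithinAt (by simp))]

omit [IsManifold I ∞ M]

theorem IsSmoothForm.add {α β : Form I M k} (hα : IsSmoothForm α) (hβ : IsSmoothForm β) :
    IsSmoothForm (α + β) := fun q => (hα q).add (hβ q)

theorem IsSmoothForm.sub {α β : Form I M k} (hα : IsSmoothForm α) (hβ : IsSmoothForm β) :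
    IsSmoothForm (α - β) := fun q => (hα q).sub (hβ q)

theorem IsSmoothForm.smul {α : Form I M k} (c : ℝ) (hα : IsSmoothForm α) :
    IsSmoothForm (c • α) := fun q => (hα q).const_smul c

theorem isSmoothForm_zero : IsSmoothForm (0 : Form I M k) := fun q =>
  contDiffOn_const (c := (0 : E [⋀^Fin k]→L[ℝ] ℝ)).congr fun _ _ => by
    rw [chartRep_zero]; rfl

theorem IsSmoothForm.sum {ι : Type*} {s : Finset ι} {α : ι → Form I M k}
    (hα : ∀ i ∈ s, IsSmoothForm (α i)) : IsSmoothForm (∑ i ∈ s, α i) := by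
  classical
  induction s using Finset.induction_on with
  | empty => simpa using isSmoothForm_zero
  | insert a s ha ih =>
    rw [Finset.sum_insert ha]
    exact (hα a (by simp)).add (ih fun i hi => hα i (by simp [hi]))

theorem IsSmoothForm.wedge {α : Form I M k} {β : Form I M l} (hα : IsSmoothForm α)
    (hβ : IsSmoothForm β) : IsSmoothForm (wedge α β) := fun q =>
  (contDiffOn_wedgeAlt (hα q) (hβ q)).congr fun y _ => chartRep_wedge q α β y

theorem contDiffOn_comp_extChartAt_symm [IsManifold I ∞ M] {f : M → ℝ}
    (hf : ContMDiff I 𝓘(ℝ, ℝ) ∞ f) (q : M) :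
    ContDiffOn ℝ ∞ (f ∘ (extChartAt I q).symm) (extChartAt I q).target :=
  contMDiffOn_iff_contDiffOn.1 (hf.comp_contMDiffOn (contMDiffOn_extChartAt_symm q))

theorem IsSmoothForm.fsmul [IsManifold I ∞ M] {f : M → ℝ} {α : Form I M k}
    (hf : ContMDiff I 𝓘(ℝ, ℝ) ∞ f) (hα : IsSmoothForm α) : IsSmoothForm (fsmul f α) := fun q =>
  (contDiffOn_comp_extChartAt_symm hf q).smul (hα q)

theorem uniqueDiffWithinAt_extChartAt (p : M) :
    UniqueDiffWithinAt ℝ (range I) (extChartAt I p p) :=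
  uniqueDiffWithinAt_range (mem_extChartAt_target p)

theorem form_ext {α β : Form I M k} (h : ∀ p, covec α p = covec β p) : α = β := funext h

variable [IsManifold I ∞ M]

theorem extD_add {α β : Form I M k} (hα : IsSmoothForm α) (hβ : IsSmoothForm β) :
    extD (α + β) = extD α + extD β := by
  refine form_ext fun p => ?_
  have h := mem_extChartAt_target (I := I) p
  refine (chartRep_extD_self p _).trans ((extDerivWithin_add (uniqueDiffWithinAt_extChartAt p)
    (hα.differentiableWithinAt h) (hβ.differentiableWithinAt h)).trans ?_)
  rw [← chartRep_extD_self, ← chartRep_extD_self]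
  rfl

theorem extD_smul (c : ℝ) (α : Form I M k) : extD (c • α) = c • extD α := by
  refine form_ext fun p => ?_
  refine (chartRep_extD_self p _).trans
    ((extDerivWithin_smul c (chartRep p α) (uniqueDiffWithinAt_extChartAt p)).trans ?_)
  rw [← chartRep_extD_self]
  rfl

theorem extD_sum {ι : Type*} {s : Finset ι} {α : ι → Form I M k}
    (hα : ∀ i ∈ s, IsSmoothForm (α i)) : extD (∑ i ∈ s, α i) = ∑ i ∈ s, extD (α i) := by
  classical
  induction s using Finset.induction_on with
  | empty => simpa using extD_smul (0 : ℝ) (0 : Form I M k)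
  | insert a s ha ih =>
    have hs : ∀ i ∈ s, IsSmoothForm (α i) := fun i hi => hα i (by simp [hi])
    rw [Finset.sum_insert ha, Finset.sum_insert ha,
      extD_add (hα a (by simp)) (IsSmoothForm.sum hs), ih hs]

theorem extD_wedge_one_one {α β : Form I M 1} (hα : IsSmoothForm α) (hβ : IsSmoothForm β) :
    extD (wedge α β) = (wedge (extD α) β : Form I M 3) - (wedge α (extD β) : Form I M 3) := by
  refine form_ext fun p => ?_
  have h := mem_extChartAt_target (I := I) p
  refine (chartRep_extD_self p _).trans ?_
  rw [show chartRep p (wedge α β) = _ from funext (chartRep_wedge p α β)]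
  refine (extDerivWithin_wedgeAlt_one_one (hα.differentiableWithinAt h)
    (hβ.differentiableWithinAt h) (uniqueDiffWithinAt_extChartAt p)).trans ?_
  rw [← chartRep_extD_self, ← chartRep_extD_self, chartRep_self, chartRep_self]
  rfl

theorem extD_wedge_one_two {α : Form I M 1} {β : Form I M 2} (hα : IsSmoothForm α)
    (hβ : IsSmoothForm β) :
    extD (wedge α β) = (wedge (extD α) β : Form I M 4) - (wedge α (extD β) : Form I M 4) := by
  refine form_ext fun p => ?_
  have h := mem_extChartAt_target (I := I) p
  refine (chartRep_extD_self p _).trans ?_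
  rw [show chartRep p (wedge α β) = _ from funext (chartRep_wedge p α β)]
  refine (extDerivWithin_wedgeAlt_one_two (hα.differentiableWithinAt h)
    (hβ.differentiableWithinAt h) (uniqueDiffWithinAt_extChartAt p)).trans ?_
  rw [← chartRep_extD_self, ← chartRep_extD_self, chartRep_self, chartRep_self]
  rfl

/-- The outer derivative at p needs `extD α` near p in one fixed chart, although it is defined in a
chart varying with the point. Chart independence, `chartRep_extD`, supplies this and reduces the
claim to the model space. -/
theorem extD_extD {α : Form I M k} (hα : IsSmoothForm α) : extD (extD α) = 0 := by
  refine form_ext fun p => ?_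
  have h := mem_extChartAt_target (I := I) p
  have hr := extChartAt_target_subset_range p h
  refine (chartRep_extD_self p _).trans ?_
  refine Eq.trans ?_ (extDerivWithin_extDerivWithin_apply (hα.contDiffWithinAt h) (by
      rw [minSmoothness_of_isRCLikeNormedField]; exact two_le_infty)
    I.uniqueDiffOn (I.range_subset_closure_interior hr) hr)
  refine Filter.EventuallyEq.extDerivWithin_eq_of_mem ?_ hr
  filter_upwards [extChartAt_target_mem_nhdsWithin p] with y hy
  exact chartRep_extD hα p hy

theorem extD_eq_zero {α : Form I M k} {p : M} (h : ∀ᶠ r in 𝓝 p, α r = 0) : extD α p = 0 := by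
  have hr := extChartAt_target_subset_range p (mem_extChartAt_target (I := I) p)
  have h1 : chartRep p α =ᶠ[𝓝[range I] (extChartAt I p p)] fun _ => 0 := by
    have hc : ContinuousAt (extChartAt I p).symm (extChartAt I p p) :=
      continuousAt_extChartAt_symm p
    rw [ContinuousAt, extChartAt_to_inv] at hc
    exact (hc.eventually h).filter_mono nhdsWithin_le_nhds |>.mono fun y hy =>
      chartRep_of_eq_zero p hy
  refine (chartRep_extD_self p _).trans ((h1.extDerivWithin_eq_of_mem hr).trans ?_)
  ext v
  simp [extDerivWithin_apply']
  rfl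

end Charts

/-! ### Algebra of triples of forms -/

section TripleAlgebra

/-- Each row of ε has two nonzero entries, so contraction with ε is a cross product. The identities
for brackets are then checked component by component. -/
theorem eps_sum {N : Type*} [AddCommGroup N] [Module ℝ N] (f : Fin 3 → Fin 3 → N) :
    (∑ j, ∑ k, eps 0 j k • f j k = f 1 2 - f 2 1) ∧ (∑ j, ∑ k, eps 1 j k • f j k = f 2 0 - f 0 2) ∧
      (∑ j, ∑ k, eps 2 j k • f j k = f 0 1 - f 1 0) := by
  refine ⟨?_, ?_, ?_⟩ <;>
  · simp [Fin.sum_univ_three, eps, Matrix.det_fin_three, Pi.single_apply]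
    try abel

variable {V : Type*} [AddCommGroup V] [Module ℝ V] [TopologicalSpace V] {k l : ℕ}

/-- The bracket `ε_{ijk} aʲ ∧ bᵏ` of triples of covectors. -/
def brk (a : Fin 3 → V [⋀^Fin k]→L[ℝ] ℝ) (b : Fin 3 → V [⋀^Fin l]→L[ℝ] ℝ) :
    Fin 3 → V [⋀^Fin (k + l)]→L[ℝ] ℝ := fun i =>
  ∑ j, ∑ k, eps i j k • wedgeAlt (a j) (b k)

theorem brk_apply (a : Fin 3 → V [⋀^Fin k]→L[ℝ] ℝ) (b : Fin 3 → V [⋀^Fin l]→L[ℝ] ℝ) :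
    brk a b = ![wedgeAlt (a 1) (b 2) - wedgeAlt (a 2) (b 1),
      wedgeAlt (a 2) (b 0) - wedgeAlt (a 0) (b 2), wedgeAlt (a 0) (b 1) - wedgeAlt (a 1) (b 0)] := by
  have h := eps_sum fun j k => wedgeAlt (a j) (b k)
  ext i : 1
  fin_cases i
  exacts [h.1, h.2.1, h.2.2]

/-- The signs from ε and from exchanging two 1-covectors cancel. -/
theorem brk_comm_one_one (a b : Fin 3 → V [⋀^Fin 1]→L[ℝ] ℝ) : brk a b = brk b a := by
  ext i v
  fin_cases i <;> simp [brk_apply, wedgeAlt_one_one] <;> ring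

/-- A 2-covector commutes with a 1-covector, so only the sign of ε survives. -/
theorem brk_comm_two_one (a : Fin 3 → V [⋀^Fin 1]→L[ℝ] ℝ) (b : Fin 3 → V [⋀^Fin 2]→L[ℝ] ℝ) :
    (brk b a : Fin 3 → V [⋀^Fin 3]→L[ℝ] ℝ) = -brk a b := by
  ext i v
  fin_cases i <;> simp [brk_apply] <;> erw [wedgeAlt_two_one, wedgeAlt_two_one, wedgeAlt_one_two, wedgeAlt_one_two]

/-- The graded Jacobi identity of so(3). The minus sign comes from moving a past b, both of odd
degree. -/
theorem brk_jacobi (a b c : Fin 3 → V [⋀^Fin 1]→L[ℝ] ℝ) :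
    (brk a (brk b c) : Fin 3 → V [⋀^Fin 3]→L[ℝ] ℝ) = brk (brk a b) c - brk b (brk a c) := by
  ext i v
  fin_cases i <;> simp [brk_apply] <;>
    erw [wedgeAlt_one_two, wedgeAlt_one_two, wedgeAlt_two_one, wedgeAlt_two_one, wedgeAlt_one_two,
      wedgeAlt_one_two] <;> simp [wedgeAlt_one_one] <;> ring

theorem sum_wedgeAlt_comm (b c : Fin 3 → V [⋀^Fin 2]→L[ℝ] ℝ) :
    ∑ i, wedgeAlt (b i) (c i) = ∑ i, wedgeAlt (c i) (b i) := by
  refine Finset.sum_congr rfl fun i _ => ?_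
  ext v
  refine (wedgeAlt_two_two _ _ v).trans (Eq.trans ?_ (wedgeAlt_two_two _ _ v).symm)
  ring

theorem brk_one_two_apply (a : Fin 3 → V [⋀^Fin 1]→L[ℝ] ℝ) (b : Fin 3 → V [⋀^Fin 2]→L[ℝ] ℝ)
    (c : Fin 3 → V [⋀^Fin 3]→L[ℝ] ℝ) (hc : c = brk a b) (i : Fin 3) (w : Fin 3 → V) :
    c i w = ∑ j, ∑ k, eps i j k * (a j ![w 0] * b k ![w 1, w 2] - a j ![w 1] * b k ![w 0, w 2] +
      a j ![w 2] * b k ![w 0, w 1]) := by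
  have h3 (j k : Fin 3) := wedgeAlt_one_two (a j) (b k) w
  have hb : c i = ∑ j, ∑ k, eps i j k • (wedgeAlt (a j) (b k) : V [⋀^Fin 3]→L[ℝ] ℝ) := by
    rw [hc]; rfl
  rw [hb]
  simp only [ContinuousAlternatingMap.sum_apply, ContinuousAlternatingMap.smul_apply, smul_eq_mul]
  simp only [← h3]

/-- Invariance of the contraction, that is, the cyclic symmetry of the scalar triple product. It is
what frees a variation from a bracket with A or e. -/
theorem sum_wedgeAlt_brk (a x : Fin 3 → V [⋀^Fin 1]→L[ℝ] ℝ) (b : Fin 3 → V [⋀^Fin 2]→L[ℝ] ℝ) :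
    (∑ i, wedgeAlt (brk a x i) (b i) : V [⋀^Fin 4]→L[ℝ] ℝ) =
      ∑ i, wedgeAlt (k := 1) (l := 3) (x i) (brk a b i) := by
  -- The brackets become opaque covectors of literal degree 3 and 2, to which the explicit wedge
  -- formulas apply.
  obtain ⟨c, hc⟩ : ∃ c : Fin 3 → V [⋀^Fin 3]→L[ℝ] ℝ, c = brk a b := ⟨_, rfl⟩
  obtain ⟨d, hd⟩ : ∃ d : Fin 3 → V [⋀^Fin 2]→L[ℝ] ℝ, d = brk a x := ⟨_, rfl⟩
  have hd' (i : Fin 3) (w : Fin 2 → V) : d i w =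
      ∑ j, ∑ k, eps i j k • (a j ![w 0] * x k ![w 1] - a j ![w 1] * x k ![w 0]) := by
    rw [hd]
    simp [brk, wedgeAlt_one_one]
  have hc' := brk_one_two_apply a b c hc
  have e0 (f : Fin 3 → Fin 3 → ℝ) := eps_sum f
  simp only [smul_eq_mul] at e0 hd'
  have goal : (∑ i, wedgeAlt (d i) (b i) : V [⋀^Fin 4]→L[ℝ] ℝ) =
      ∑ i, (wedgeAlt (x i) (c i) : V [⋀^Fin 4]→L[ℝ] ℝ) := by
    ext v
    have h (i : Fin 3) := wedgeAlt_two_two (d i) (b i) v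
    have h' (i : Fin 3) := wedgeAlt_one_three (x i) (c i) v
    simp only [Fin.sum_univ_three, ContinuousAlternatingMap.add_apply]
    rw [h, h, h, h', h', h']
    simp only [hc', hd', (e0 _).1, (e0 _).2.1, (e0 _).2.2]
    simp
    ring
  rw [hd, hc] at goal
  exact goal

end TripleAlgebra

/-! ### Brackets and contractions of triples of forms, and the Bianchi identities -/

section TripleForms

variable {E : Type*} [NormedAddCommGroup E] [NormedSpace ℝ E]
  {H : Type*} [TopologicalSpace H] {I : ModelWithCorners ℝ E H}
  {M : Type*} [TopologicalSpace M] [ChartedSpace H M] {k l : ℕ}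

theorem wedge_add_left (a a' : Form I M k) (b : Form I M l) :
    wedge (a + a') b = wedge a b + wedge a' b := funext fun _ => wedgeAlt_add_left _ _ _

theorem wedge_add_right (a : Form I M k) (b b' : Form I M l) :
    wedge a (b + b') = wedge a b + wedge a b' := funext fun _ => wedgeAlt_add_right _ _ _

theorem wedge_smul_left (c : ℝ) (a : Form I M k) (b : Form I M l) :
    wedge (c • a) b = c • wedge a b := funext fun _ => wedgeAlt_smul_left _ _ _

theorem wedge_smul_right (c : ℝ) (a : Form I M k) (b : Form I M l) :
    wedge a (c • b) = c • wedge a b := funext fun _ => wedgeAlt_smul_right _ _ _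

/-- The bracket `ε_{ijk} aʲ ∧ bᵏ` of triples of forms. -/
def bracket (a : Fin 3 → Form I M k) (b : Fin 3 → Form I M l) : Fin 3 → Form I M (k + l) :=
  fun i => ∑ j, ∑ k, eps i j k • wedge (a j) (b k)

/-- The contraction `a_i ∧ bⁱ` of triples of forms. -/
def pair (a : Fin 3 → Form I M k) (b : Fin 3 → Form I M l) : Form I M (k + l) :=
  ∑ i, wedge (a i) (b i)

theorem bracket_at (a : Fin 3 → Form I M k) (b : Fin 3 → Form I M l) (i : Fin 3) (p : M) :
    bracket a b i p = brk (fun j => a j p) (fun j => b j p) i := by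
  simp only [bracket, brk, Finset.sum_apply, Pi.smul_apply]
  rfl

theorem pair_at (a : Fin 3 → Form I M k) (b : Fin 3 → Form I M l) (p : M) :
    pair a b p = ∑ i, wedgeAlt (a i p) (b i p) := by
  simp only [pair, Finset.sum_apply]
  rfl

theorem bracket_add_left (a a' : Fin 3 → Form I M k) (b : Fin 3 → Form I M l) :
    bracket (a + a') b = bracket a b + bracket a' b := by
  ext1 i
  simp only [bracket, Pi.add_apply, wedge_add_left, smul_add, Finset.sum_add_distrib]

theorem bracket_add_right (a : Fin 3 → Form I M k) (b b' : Fin 3 → Form I M l) :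
    bracket a (b + b') = bracket a b + bracket a b' := by
  ext1 i
  simp only [bracket, Pi.add_apply, wedge_add_right, smul_add, Finset.sum_add_distrib]

theorem bracket_smul_left (c : ℝ) (a : Fin 3 → Form I M k) (b : Fin 3 → Form I M l) :
    bracket (c • a) b = c • bracket a b := by
  ext1 i
  simp only [bracket, Pi.smul_apply, wedge_smul_left, smul_comm _ c, Finset.smul_sum]

theorem bracket_smul_right (c : ℝ) (a : Fin 3 → Form I M k) (b : Fin 3 → Form I M l) :
    bracket a (c • b) = c • bracket a b := by
  ext1 i
  simp only [bracket, Pi.smul_apply, wedge_smul_right, smul_comm _ c, Finset.smul_sum]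

theorem pair_add_left (a a' : Fin 3 → Form I M k) (b : Fin 3 → Form I M l) :
    pair (a + a') b = pair a b + pair a' b := by
  simp only [pair, Pi.add_apply, wedge_add_left, Finset.sum_add_distrib]

theorem pair_add_right (a : Fin 3 → Form I M k) (b b' : Fin 3 → Form I M l) :
    pair a (b + b') = pair a b + pair a b' := by
  simp only [pair, Pi.add_apply, wedge_add_right, Finset.sum_add_distrib]

theorem pair_smul_left (c : ℝ) (a : Fin 3 → Form I M k) (b : Fin 3 → Form I M l) :
    pair (c • a) b = c • pair a b := by
  simp only [pair, Pi.smul_apply, wedge_smul_left, Finset.smul_sum]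

theorem pair_smul_right (c : ℝ) (a : Fin 3 → Form I M k) (b : Fin 3 → Form I M l) :
    pair a (c • b) = c • pair a b := by
  simp only [pair, Pi.smul_apply, wedge_smul_right, Finset.smul_sum]

theorem bracket_comm (a b : Fin 3 → Form I M 1) : bracket a b = bracket b a := by
  ext1 i
  funext p
  rw [bracket_at, bracket_at, brk_comm_one_one]

theorem bracket_two_one (a : Fin 3 → Form I M 1) (b : Fin 3 → Form I M 2) :
    (bracket b a : Fin 3 → Form I M 3) = (-1 : ℝ) • (bracket a b : Fin 3 → Form I M 3) := by
  ext1 i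
  funext p
  refine Eq.trans ?_ (neg_one_smul ℝ (bracket a b i p)).symm
  refine (bracket_at b a i p).trans (Eq.trans ?_ (congrArg Neg.neg (bracket_at a b i p)).symm)
  exact congrFun (brk_comm_two_one _ _) i

theorem bracket_jacobi (a b c : Fin 3 → Form I M 1) :
    (bracket a (bracket b c) : Fin 3 → Form I M 3) =
      (bracket (bracket a b) c : Fin 3 → Form I M 3) - bracket b (bracket a c) := by
  ext1 i
  funext p
  refine (bracket_at a _ i p).trans (Eq.trans ?_ (congrArg₂ HSub.hSub
    (bracket_at (bracket a b) c i p) (bracket_at b (bracket a c) i p)).symm)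
  simp only [bracket_at]
  exact congrFun (brk_jacobi _ _ _) i

theorem pair_comm (b c : Fin 3 → Form I M 2) : pair b c = pair c b := by
  funext p
  rw [pair_at, pair_at]
  exact sum_wedgeAlt_comm _ _

theorem pair_bracket_left (a x : Fin 3 → Form I M 1) (b : Fin 3 → Form I M 2) :
    (pair (bracket a x) b : Form I M 4) = (pair x (bracket a b : Fin 3 → Form I M 3) : Form I M 4) := by
  funext p
  refine (pair_at _ b p).trans (Eq.trans ?_ (pair_at x (bracket a b) p).symm)
  simp only [bracket_at]
  exact sum_wedgeAlt_brk _ _ _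

/-- Let X = [a,[a,a]]. The Jacobi identity gives X = [[a,a],a] − X and graded antisymmetry gives
[[a,a],a] = −X, hence 3X = 0. -/
theorem bracket_bracket_self (a : Fin 3 → Form I M 1) :
    (bracket a (bracket a a) : Fin 3 → Form I M 3) = 0 := by
  have h := bracket_jacobi a a a
  have h2 := bracket_two_one a (bracket a a)
  rw [h2] at h
  have h3 : (3 : ℝ) • (bracket a (bracket a a) : Fin 3 → Form I M 3) = 0 := by
    nth_rewrite 1 [show (3 : ℝ) = 1 + 2 by norm_num, add_smul, one_smul, h]
    module
  simpa using h3

/-- The Jacobi identity with two equal entries. With a = A this is the quadratic part of D² = [F,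
·]. -/
theorem bracket_bracket_self_left (a b : Fin 3 → Form I M 1) :
    (bracket a (bracket a b) : Fin 3 → Form I M 3) =
      (1 / 2 : ℝ) • (bracket (bracket a a) b : Fin 3 → Form I M 3) := by
  have h := bracket_jacobi a a b
  have h3 : (2 : ℝ) • (bracket a (bracket a b) : Fin 3 → Form I M 3) = bracket (bracket a a) b := by
    nth_rewrite 1 [two_smul, h]
    module
  rw [← h3]
  module

theorem bracket_bracket_self_right (a b : Fin 3 → Form I M 1) :
    (bracket a (bracket b b) : Fin 3 → Form I M 3) =
      (2 : ℝ) • (bracket (bracket a b) b : Fin 3 → Form I M 3) := by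
  rw [bracket_jacobi a b b, bracket_two_one b (bracket a b)]
  module

/-- Invariance turns the left side into a·[b,[b,b]], which is zero. This kills a·[e,W] in the
variation of the α₄ term, and W·W in the two-connection action. -/
theorem pair_bracket_bracket (a b : Fin 3 → Form I M 1) :
    pair (bracket a b) (bracket b b) = 0 := by
  rw [bracket_comm, pair_bracket_left, bracket_bracket_self]
  have := pair_smul_right (0 : ℝ) a (0 : Fin 3 → Form I M 3)
  rwa [zero_smul, zero_smul] at this

theorem epsWedge_eq (e : Fin 3 → Form I M 1) : epsWedge e = bracket e e := rfl

theorem hkCurv_eq (e A : Fin 3 → Form I M 1) : hkCurv e A = bracket e (curv A) := rfl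

theorem hkTorsion_eq (e A : Fin 3 → Form I M 1) : hkTorsion e A = bracket (covD A e) e := rfl

/-- The exterior derivative of a triple of forms. -/
def extD3 (a : Fin 3 → Form I M k) : Fin 3 → Form I M (k + 1) := fun i => extD (a i)

theorem curv_eq (A : Fin 3 → Form I M 1) :
    curv A = extD3 A + (1 / 2 : ℝ) • (bracket A A : Fin 3 → Form I M 2) := rfl

theorem covD_eq (A e : Fin 3 → Form I M 1) :
    covD A e = extD3 e + (bracket A e : Fin 3 → Form I M 2) := rfl

theorem IsSmoothForm.bracket {a : Fin 3 → Form I M k} {b : Fin 3 → Form I M l}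
    (ha : ∀ i, IsSmoothForm (a i)) (hb : ∀ i, IsSmoothForm (b i)) (i : Fin 3) :
    IsSmoothForm (bracket a b i) :=
  IsSmoothForm.sum fun j _ => IsSmoothForm.sum fun k _ => ((ha j).wedge (hb k)).smul _

theorem IsSmoothForm.pair {a : Fin 3 → Form I M k} {b : Fin 3 → Form I M l}
    (ha : ∀ i, IsSmoothForm (a i)) (hb : ∀ i, IsSmoothForm (b i)) :
    IsSmoothForm (pair a b) := IsSmoothForm.sum fun j _ => (ha j).wedge (hb j)

variable [IsManifold I ∞ M]

theorem IsSmoothForm.curv {A : Fin 3 → Form I M 1} (hA : ∀ i, IsSmoothForm (A i)) (i : Fin 3) :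
    IsSmoothForm (curv A i) := (hA i).extD.add ((IsSmoothForm.bracket hA hA i).smul _)

theorem IsSmoothForm.covD {A e : Fin 3 → Form I M 1} (hA : ∀ i, IsSmoothForm (A i))
    (he : ∀ i, IsSmoothForm (e i)) (i : Fin 3) :
    IsSmoothForm (covD A e i) := (he i).extD.add (IsSmoothForm.bracket hA he i)

theorem extD3_add {a b : Fin 3 → Form I M k} (ha : ∀ i, IsSmoothForm (a i))
    (hb : ∀ i, IsSmoothForm (b i)) : extD3 (a + b) = extD3 a + extD3 b :=
  funext fun i => extD_add (ha i) (hb i)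

theorem extD3_smul (c : ℝ) (a : Fin 3 → Form I M k) : extD3 (c • a) = c • extD3 a :=
  funext fun i => extD_smul c (a i)

theorem extD3_extD3 {a : Fin 3 → Form I M k} (ha : ∀ i, IsSmoothForm (a i)) :
    extD3 (extD3 a) = 0 := funext fun i => extD_extD (ha i)

theorem extD3_bracket {a b : Fin 3 → Form I M 1} (ha : ∀ i, IsSmoothForm (a i))
    (hb : ∀ i, IsSmoothForm (b i)) :
    extD3 (bracket a b) = (bracket (extD3 a) b : Fin 3 → Form I M 3) - bracket a (extD3 b) := by
  ext1 i
  have h (j k : Fin 3) := ((ha j).wedge (hb k)).smul (eps i j k)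
  change extD (∑ j, ∑ k, eps i j k • wedge (a j) (b k)) = _
  rw [extD_sum fun j _ => IsSmoothForm.sum fun k _ => h j k]
  simp only [extD_sum fun k _ => h _ k, extD_smul, extD_wedge_one_one (ha _) (hb _), smul_sub,
    Finset.sum_sub_distrib]
  rfl

theorem extD_pair {a : Fin 3 → Form I M 1} {b : Fin 3 → Form I M 2} (ha : ∀ i, IsSmoothForm (a i))
    (hb : ∀ i, IsSmoothForm (b i)) :
    extD (pair a b) = (pair (extD3 a) b : Form I M 4) - pair a (extD3 b) := by
  rw [pair, extD_sum fun j _ => (ha j).wedge (hb j)]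
  simp only [extD_wedge_one_two (ha _) (hb _), Finset.sum_sub_distrib]
  rfl

/-- Covariant Leibniz rule for the contraction. -/
theorem extD_pair_covD {A x : Fin 3 → Form I M 1} {b : Fin 3 → Form I M 2}
    (hx : ∀ i, IsSmoothForm (x i)) (hb : ∀ i, IsSmoothForm (b i)) :
    extD (pair x b) = (pair (covD A x) b : Form I M 4) -
      pair x (extD3 b + (bracket A b : Fin 3 → Form I M 3)) := by
  -- The two terms containing A cancel because the contraction is invariant.
  rw [extD_pair hx hb, covD_eq, pair_add_left, pair_add_right, pair_bracket_left]
  abel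

/-- The second Bianchi identity. -/
theorem bianchi_curv {A : Fin 3 → Form I M 1} (hA : ∀ i, IsSmoothForm (A i)) :
    extD3 (curv A) + (bracket A (curv A) : Fin 3 → Form I M 3) = 0 := by
  -- The cubic term [A,[A,A]] vanishes, and ½([dA,A] − [A,dA]) = −[A,dA] cancels the term left in
  -- [A,F].
  rw [curv_eq, extD3_add (a := extD3 A) (b := (1 / 2 : ℝ) • bracket A A) (fun i => (hA i).extD)
    (fun i => (IsSmoothForm.bracket hA hA i).smul _),
    extD3_smul, extD3_extD3 hA, extD3_bracket hA hA, bracket_add_right, bracket_smul_right,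
    bracket_bracket_self, bracket_two_one A (extD3 A)]
  module

/-- The first Bianchi identity. -/
theorem bianchi_covD {A e : Fin 3 → Form I M 1} (hA : ∀ i, IsSmoothForm (A i))
    (he : ∀ i, IsSmoothForm (e i)) :
    extD3 (covD A e) + (bracket A (covD A e) : Fin 3 → Form I M 3) = bracket (curv A) e := by
  rw [covD_eq, curv_eq,
    extD3_add (a := extD3 e) (fun i => (he i).extD) (fun i => IsSmoothForm.bracket hA he i),
    extD3_extD3 he, extD3_bracket hA he, bracket_add_right, bracket_add_left, bracket_smul_left,
    bracket_bracket_self_left]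
  module

/-- D acts as a graded derivation: D[e,e] = [De,e] − [e,De], and the two terms are equal. -/
theorem covD_epsWedge {A e : Fin 3 → Form I M 1} (he : ∀ i, IsSmoothForm (e i)) :
    extD3 (epsWedge e) + (bracket A (epsWedge e) : Fin 3 → Form I M 3) =
      (2 : ℝ) • (bracket (covD A e) e : Fin 3 → Form I M 3) := by
  rw [epsWedge_eq, extD3_bracket he he, bracket_bracket_self_right, covD_eq, bracket_add_left,
    bracket_two_one e (extD3 e)]
  module

end TripleForms

/-! ### The Lagrangians and their first variation -/

section Assoc

variable {V : Type*} [AddCommGroup V] [Module ℝ V] [TopologicalSpace V]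

theorem wedgeAlt_three_one (b : V [⋀^Fin 3]→L[ℝ] ℝ) (a : V [⋀^Fin 1]→L[ℝ] ℝ) (v : Fin 4 → V) :
    wedgeAlt b a v = a ![v 3] * b ![v 0, v 1, v 2] - a ![v 2] * b ![v 0, v 1, v 3] +
      a ![v 1] * b ![v 0, v 2, v 3] - a ![v 0] * b ![v 1, v 2, v 3] := by
  rw [wedgeAlt_apply]
  have h := sum_perm_four fun τ => b ![v (τ 0), v (τ 1), v (τ 2)] * a ![v (τ 3)]
  have h' (σ : Equiv.Perm (Fin 4)) : b (fun i => v (σ (Fin.castAdd 1 i))) * a (fun i => v (σ (Fin.natAdd 3 i))) =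
      b ![v (σ 0), v (σ 1), v (σ 2)] * a ![v (σ 3)] := by
    rw [fin_three_eta fun i => v (σ (Fin.castAdd 1 i)), fin_one_eta fun i => v (σ (Fin.natAdd 3 i))]; rfl
  simp only [h']
  erw [h]
  have hs (x y z : V) : b ![y, z, x] = b ![x, y, z] ∧ b ![z, x, y] = b ![x, y, z] ∧ b ![y, x, z] = - b ![x, y, z] ∧
      b ![x, z, y] = - b ![x, y, z] ∧ b ![z, y, x] = - b ![x, y, z] := by
    have h1 := map_triple_swap b x y z
    have h2 := map_triple_swap b z y x
    have h3 := map_triple_swap b y z x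
    refine ⟨?_, ?_, ?_, ?_, ?_⟩ <;> linarith [h1.1, h1.2, h2.1, h2.2, h3.1, h3.2]
  simp [hs (v 0) (v 1) (v 2), hs (v 0) (v 1) (v 3), hs (v 0) (v 2) (v 3), hs (v 1) (v 2) (v 3), Nat.factorial]
  ring

/-- The only instance of associativity required: it regroups De∧e∧e in the α₄ term as De∧(e∧e). -/
theorem wedgeAlt_assoc_two_one_one (b : V [⋀^Fin 2]→L[ℝ] ℝ) (x y : V [⋀^Fin 1]→L[ℝ] ℝ) :
    (wedgeAlt (k := 3) (l := 1) (wedgeAlt b x) y : V [⋀^Fin 4]→L[ℝ] ℝ) =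
      wedgeAlt (k := 2) (l := 2) b (wedgeAlt x y) := by
  obtain ⟨c, hc⟩ : ∃ c : V [⋀^Fin 3]→L[ℝ] ℝ, c = wedgeAlt b x := ⟨_, rfl⟩
  obtain ⟨d, hd⟩ : ∃ d : V [⋀^Fin 2]→L[ℝ] ℝ, d = wedgeAlt x y := ⟨_, rfl⟩
  have hd' := wedgeAlt_one_one x y
  have hc' := wedgeAlt_two_one b x
  rw [← hd] at hd'
  rw [← hc] at hc'
  have goal : (wedgeAlt c y : V [⋀^Fin 4]→L[ℝ] ℝ) = wedgeAlt b d := by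
    ext v
    refine (wedgeAlt_three_one c y v).trans (Eq.trans ?_ (wedgeAlt_two_two b d v).symm)
    simp only [hc', hd']
    simp
    ring
  rw [hd, hc] at goal
  exact goal

end Assoc

section Variation

variable {E : Type*} [NormedAddCommGroup E] [NormedSpace ℝ E]
  {H : Type*} [TopologicalSpace H] {I : ModelWithCorners ℝ E H}
  {M : Type*} [TopologicalSpace M] [ChartedSpace H M]

theorem wedge_assoc_two_one_one (b : Form I M 2) (x y : Form I M 1) :
    (wedge (wedge b x : Form I M 3) y : Form I M 4) = wedge b (wedge x y) :=
  funext fun p => wedgeAlt_assoc_two_one_one (b p) (x p) (y p)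

theorem eps_cyclic (i j k : Fin 3) : eps i j k = eps k i j := by
  fin_cases i <;> fin_cases j <;> fin_cases k <;>
    simp [eps, Matrix.det_fin_three]

theorem wedge_zero_left {k l : ℕ} (b : Form I M l) : wedge (0 : Form I M k) b = 0 := by
  have := wedge_smul_left (0 : ℝ) (0 : Form I M k) b
  rwa [zero_smul, zero_smul] at this

theorem wedge_zero_right {k l : ℕ} (b : Form I M k) : wedge b (0 : Form I M l) = 0 := by
  have := wedge_smul_right (0 : ℝ) b (0 : Form I M l)
  rwa [zero_smul, zero_smul] at this

theorem wedge_sum_left {k l : ℕ} {ι : Type*} (s : Finset ι) (a : ι → Form I M k) (b : Form I M l) :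
    wedge (∑ i ∈ s, a i) b = ∑ i ∈ s, wedge (a i) b := by
  classical
  induction s using Finset.induction_on with
  | empty => simpa using wedge_zero_left b
  | insert i s hi ih => rw [Finset.sum_insert hi, Finset.sum_insert hi, wedge_add_left, ih]

theorem wedge_sum_right {k l : ℕ} {ι : Type*} (s : Finset ι) (b : Form I M k) (a : ι → Form I M l) :
    wedge b (∑ i ∈ s, a i) = ∑ i ∈ s, wedge b (a i) := by
  classical
  induction s using Finset.induction_on with
  | empty => simpa using wedge_zero_right b
  | insert i s hi ih => rw [Finset.sum_insert hi, Finset.sum_insert hi, wedge_add_right, ih]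

/-- From here on the Lagrangian is index-free, and the calculus of `pair` and `bracket` applies to
it. -/
theorem lagrangian_eq (α₁ α₂ α₃ α₄ α₅ : ℝ) (e A : Fin 3 → Form I M 1) :
    lagrangian α₁ α₂ α₃ α₄ α₅ e A = α₁ • pair (epsWedge e) (curv A) +
      α₂ • pair (covD A e) (covD A e) + α₃ • pair (curv A) (curv A) +
      α₄ • pair (covD A e) (epsWedge e) + α₅ • pair (curv A) (covD A e) := by
  have h1 : (∑ i, ∑ j, ∑ k, eps i j k • wedge (wedge (e i) (e j)) (curv A k) : Form I M 4) =
      pair (epsWedge e) (curv A) := by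
    simp only [pair, epsWedge, wedge_sum_left, wedge_smul_left]
    -- The index of F becomes the outer one; cyclic symmetry of ε absorbs the relabelling.
    rw [Finset.sum_comm_cycle]
    refine Finset.sum_congr rfl fun k _ => ?_
    refine Finset.sum_congr rfl fun i _ => Finset.sum_congr rfl fun j _ => ?_
    rw [eps_cyclic]
  have h4 : (∑ i, ∑ j, ∑ k, eps i j k • wedge (wedge (covD A e i) (e j)) (e k) : Form I M 4) =
      pair (covD A e) (epsWedge e) := by
    simp only [pair, epsWedge, wedge_sum_right, wedge_smul_right]
    refine Finset.sum_congr rfl fun k _ => ?_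
    refine Finset.sum_congr rfl fun i _ => Finset.sum_congr rfl fun j _ => ?_
    congr 1
    exact wedge_assoc_two_one_one _ _ _
  rw [lagrangian, h1, h4]
  rfl

theorem epsWedge_add_smul (e x : Fin 3 → Form I M 1) (t : ℝ) :
    epsWedge (e + t • x) = epsWedge e + t • ((2 : ℝ) • (bracket e x : Fin 3 → Form I M 2)) +
      t ^ 2 • epsWedge x := by
  simp only [epsWedge_eq, bracket_add_left, bracket_add_right, bracket_smul_left,
    bracket_smul_right, bracket_comm x e]
  module

variable [IsManifold I ∞ M]

/-- An exact expansion, not just one to first order. It gives the first variation, and also the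
curvatures of A + ½e and A − ½e. -/
theorem curv_add_smul {A a : Fin 3 → Form I M 1} (hA : ∀ i, IsSmoothForm (A i))
    (ha : ∀ i, IsSmoothForm (a i)) (t : ℝ) :
    curv (A + t • a) = curv A + t • covD A a + t ^ 2 • ((1 / 2 : ℝ) • epsWedge a) := by
  rw [curv_eq, curv_eq, covD_eq, extD3_add (b := t • a) hA fun i => (ha i).smul t, extD3_smul]
  simp only [epsWedge_eq, bracket_add_left, bracket_add_right, bracket_smul_left,
    bracket_smul_right, bracket_comm a A]
  module

theorem covD_add_smul {A e a x : Fin 3 → Form I M 1} (he : ∀ i, IsSmoothForm (e i))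
    (hx : ∀ i, IsSmoothForm (x i)) (t : ℝ) :
    covD (A + t • a) (e + t • x) = covD A e +
      t • (covD A x + (bracket a e : Fin 3 → Form I M 2)) +
      t ^ 2 • (bracket a x : Fin 3 → Form I M 2) := by
  rw [covD_eq, covD_eq, covD_eq, extD3_add (b := t • x) he fun i => (hx i).smul t, extD3_smul]
  simp only [bracket_add_left, bracket_add_right, bracket_smul_left, bracket_smul_right]
  module

/-- The first variation of the Lagrangian in the direction `(x, a)`. -/
def firstVariation (α₁ α₂ α₃ α₄ α₅ : ℝ) (e A x a : Fin 3 → Form I M 1) : Form I M 4 :=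
  α₁ • (pair (epsWedge e) (covD A a) + pair ((2 : ℝ) • (bracket e x : Fin 3 → Form I M 2)) (curv A)) +
  α₂ • (pair (covD A e) (covD A x + (bracket a e : Fin 3 → Form I M 2)) +
    pair (covD A x + (bracket a e : Fin 3 → Form I M 2)) (covD A e)) +
  α₃ • (pair (curv A) (covD A a) + pair (covD A a) (curv A)) +
  α₄ • (pair (covD A e) ((2 : ℝ) • (bracket e x : Fin 3 → Form I M 2)) +
    pair (covD A x + (bracket a e : Fin 3 → Form I M 2)) (epsWedge e)) +
  α₅ • (pair (curv A) (covD A x + (bracket a e : Fin 3 → Form I M 2)) +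
    pair (covD A a) (covD A e))

/-- The boundary 2-forms conjugate to the variation of `e`. -/
def bdryE (α₂ α₄ α₅ : ℝ) (e A : Fin 3 → Form I M 1) : Fin 3 → Form I M 2 := fun i =>
  (2 * α₂) • covD A e i + α₄ • epsWedge e i + α₅ • curv A i

/-- The boundary 2-forms conjugate to the variation of `A`. -/
def bdryA (α₁ α₃ α₅ : ℝ) (e A : Fin 3 → Form I M 1) : Fin 3 → Form I M 2 := fun i =>
  α₁ • epsWedge e i + (2 * α₃) • curv A i + α₅ • covD A e i

omit [IsManifold I ∞ M] in
theorem bdryE_eq (α₂ α₄ α₅ : ℝ) (e A : Fin 3 → Form I M 1) :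
    bdryE α₂ α₄ α₅ e A = (2 * α₂) • covD A e + α₄ • epsWedge e + α₅ • curv A := rfl

omit [IsManifold I ∞ M] in
theorem bdryA_eq (α₁ α₃ α₅ : ℝ) (e A : Fin 3 → Form I M 1) :
    bdryA α₁ α₃ α₅ e A = α₁ • epsWedge e + (2 * α₃) • curv A + α₅ • covD A e := rfl

theorem IsSmoothForm.bdryE {α₂ α₄ α₅ : ℝ} {e A : Fin 3 → Form I M 1}
    (he : ∀ i, IsSmoothForm (e i)) (hA : ∀ i, IsSmoothForm (A i)) (i : Fin 3) :
    IsSmoothForm (bdryE α₂ α₄ α₅ e A i) :=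
  (((IsSmoothForm.covD hA he i).smul _).add ((IsSmoothForm.bracket he he i).smul _)).add
    ((IsSmoothForm.curv hA i).smul _)

theorem IsSmoothForm.bdryA {α₁ α₃ α₅ : ℝ} {e A : Fin 3 → Form I M 1}
    (he : ∀ i, IsSmoothForm (e i)) (hA : ∀ i, IsSmoothForm (A i)) (i : Fin 3) :
    IsSmoothForm (bdryA α₁ α₃ α₅ e A i) :=
  (((IsSmoothForm.bracket he he i).smul _).add ((IsSmoothForm.curv hA i).smul _)).add
    ((IsSmoothForm.covD hA he i).smul _)

/-- By DF = 0 the α₅ term drops; the other two are evaluated by DT = [F,e] and DW = 2[T,e]. -/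
theorem bdryE_bianchi {α₂ α₄ α₅ : ℝ} {e A : Fin 3 → Form I M 1} (he : ∀ i, IsSmoothForm (e i))
    (hA : ∀ i, IsSmoothForm (A i)) :
    extD3 (bdryE α₂ α₄ α₅ e A) + (bracket A (bdryE α₂ α₄ α₅ e A) : Fin 3 → Form I M 3) =
      (2 * α₂) • (bracket (curv A) e : Fin 3 → Form I M 3) +
        (2 * α₄) • (bracket (covD A e) e : Fin 3 → Form I M 3) := by
  have hT := IsSmoothForm.covD hA he
  have hW := IsSmoothForm.bracket he he
  have hF := IsSmoothForm.curv hA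
  have b1 := bianchi_curv hA
  have b2 := bianchi_covD hA he
  have b3 := covD_epsWedge (A := A) he
  rw [bdryE_eq, extD3_add (a := (2 * α₂) • covD A e + α₄ • epsWedge e) (b := α₅ • curv A)
      (fun i => ((hT i).smul _).add ((hW i).smul _)) (fun i => (hF i).smul _),
    extD3_add (a := (2 * α₂) • covD A e) (b := α₄ • epsWedge e)
      (fun i => (hT i).smul _) (fun i => (hW i).smul _)]
  simp only [extD3_smul, bracket_add_right, bracket_smul_right]
  rw [← b2, mul_comm 2 α₄, mul_smul α₄, ← b3]
  rw [eq_neg_of_add_eq_zero_right b1]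
  module

theorem bdryA_bianchi {α₁ α₃ α₅ : ℝ} {e A : Fin 3 → Form I M 1} (he : ∀ i, IsSmoothForm (e i))
    (hA : ∀ i, IsSmoothForm (A i)) :
    extD3 (bdryA α₁ α₃ α₅ e A) + (bracket A (bdryA α₁ α₃ α₅ e A) : Fin 3 → Form I M 3) =
      (2 * α₁) • (bracket (covD A e) e : Fin 3 → Form I M 3) +
        α₅ • (bracket (curv A) e : Fin 3 → Form I M 3) := by
  have hT := IsSmoothForm.covD hA he
  have hW := IsSmoothForm.bracket he he
  have hF := IsSmoothForm.curv hA
  have b1 := bianchi_curv hA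
  have b2 := bianchi_covD hA he
  have b3 := covD_epsWedge (A := A) he
  rw [bdryA_eq, extD3_add (a := α₁ • epsWedge e + (2 * α₃) • curv A) (b := α₅ • covD A e)
      (fun i => ((hW i).smul _).add ((hF i).smul _)) (fun i => (hT i).smul _),
    extD3_add (a := α₁ • epsWedge e) (b := (2 * α₃) • curv A)
      (fun i => (hW i).smul _) (fun i => (hF i).smul _)]
  simp only [extD3_smul, bracket_add_right, bracket_smul_right]
  rw [← b2, mul_comm 2 α₁, mul_smul α₁, ← b3]
  rw [eq_neg_of_add_eq_zero_right b1]
  module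

/-- The first variation is the sum of the Euler–Lagrange terms and an exact form. -/
theorem firstVariation_eq {α₁ α₂ α₃ α₄ α₅ : ℝ} {e A x a : Fin 3 → Form I M 1}
    (he : ∀ i, IsSmoothForm (e i)) (hA : ∀ i, IsSmoothForm (A i))
    (hx : ∀ i, IsSmoothForm (x i)) (ha : ∀ i, IsSmoothForm (a i)) :
    firstVariation α₁ α₂ α₃ α₄ α₅ e A x a =
      (2 * (α₁ - α₂)) • (pair x (hkCurv e A) + pair a (hkTorsion e A) : Form I M 4) +
      extD (pair x (bdryE α₂ α₄ α₅ e A) + pair a (bdryA α₁ α₃ α₅ e A) : Form I M 3) := by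
  have hE := IsSmoothForm.bdryE (α₂ := α₂) (α₄ := α₄) (α₅ := α₅) he hA
  have hB := IsSmoothForm.bdryA (α₁ := α₁) (α₃ := α₃) (α₅ := α₅) he hA
  rw [extD_add (IsSmoothForm.pair hx hE) (IsSmoothForm.pair ha hB),
    extD_pair_covD (A := A) hx hE, extD_pair_covD (A := A) ha hB, bdryE_bianchi he hA,
    bdryA_bianchi he hA, firstVariation, bdryE_eq, bdryA_eq, hkCurv_eq, hkTorsion_eq]
  have c1 := pair_comm (covD A e)
  have c2 := pair_comm (curv A)
  have c3 := pair_comm (epsWedge e)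
  have l1 := pair_bracket_left e x
  have l2 := pair_bracket_left e a
  have l3 : (pair a (bracket e (epsWedge e) : Fin 3 → Form I M 3) : Form I M 4) = 0 := by
    rw [← pair_bracket_left, bracket_comm]
    exact pair_bracket_bracket a e
  have t1 := bracket_two_one e (curv A)
  have t2 := bracket_two_one e (covD A e)
  -- After normalisation, [F,e] = −[e,F] and [e,T] = −[T,e] cancel the bulk parts of the α₄ and α₅
  -- terms and give those of α₁ and α₂ opposite signs.
  simp only [c1 (covD A x + _), c1 ((2 : ℝ) • _), c2 (covD A x + _), c3 (covD A a), c2 (covD A a),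
    bracket_comm a e, pair_add_left, pair_add_right, pair_smul_left, pair_smul_right, l1, l2, l3,
    t1, t2]
  module

/-- The product (F + ⅛W + ½T)·(F + ⅛W − ½T) equals (F + ⅛W)·(F + ⅛W) − ¼T·T, because the contraction
of 2-forms is symmetric; and W·W = 0. -/
theorem twoConnLagrangian_eq {e A : Fin 3 → Form I M 1} (he : ∀ i, IsSmoothForm (e i))
    (hA : ∀ i, IsSmoothForm (A i)) :
    twoConnLagrangian (A + (1 / 2 : ℝ) • e) (A + (-(1 / 2) : ℝ) • e) =
      lagrangian (1 / 4) (-(1 / 4)) 1 0 0 e A := by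
  have h (X Y : Fin 3 → Form I M 1) : twoConnLagrangian X Y = pair (curv X) (curv Y) := rfl
  have h0 : pair (epsWedge e) (epsWedge e) = 0 := pair_bracket_bracket e e
  rw [h, lagrangian_eq, curv_add_smul hA he, curv_add_smul hA he]
  simp only [pair_add_left, pair_add_right, pair_smul_left, pair_smul_right, h0,
    pair_comm (curv A) (epsWedge e), pair_comm (covD A e) (epsWedge e),
    pair_comm (covD A e) (curv A)]
  module

end Variation

/-! ### Reduction of the two-connection action to the general one -/

section StationaryTwo

variable {H : Type*} [TopologicalSpace H]
  {I : ModelWithCorners ℝ (EuclideanSpace ℝ (Fin 4)) H}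
  {M : Type*} [TopologicalSpace M] [ChartedSpace H M]
  [IsManifold I ∞ M] [T2Space M] [SigmaCompactSpace M]

/-- The fields are related by an invertible linear substitution with constant coefficients, which
preserves smoothness and supports of variations. -/
theorem isStationary_twoConnLagrangian_iff {e A : Fin 3 → Form I M 1}
    (he : ∀ i, IsSmoothForm (e i)) (hA : ∀ i, IsSmoothForm (A i)) :
    IsStationary twoConnLagrangian (A + (1 / 2 : ℝ) • e) (A + (-(1 / 2) : ℝ) • e) ↔
      IsStationary (lagrangian (1 / 4) (-(1 / 4)) 1 0 0) e A := by
  have key (x a : Fin 3 → Form I M 1) (hx : ∀ i, IsSmoothForm (x i))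
      (ha : ∀ i, IsSmoothForm (a i)) (t : ℝ) :
      twoConnLagrangian (A + (1 / 2 : ℝ) • e + t • (a + (1 / 2 : ℝ) • x))
        (A + (-(1 / 2) : ℝ) • e + t • (a + (-(1 / 2) : ℝ) • x)) =
      lagrangian (1 / 4) (-(1 / 4)) 1 0 0 (e + t • x) (A + t • a) := by
    rw [← twoConnLagrangian_eq (e := e + t • x) (A := A + t • a)
      (fun i => (he i).add ((hx i).smul t)) (fun i => (hA i).add ((ha i).smul t))]
    congr 1 <;> module
  constructor
  · intro h K x a hK hx ha h0
    have := h K (a + (1 / 2 : ℝ) • x) (a + (-(1 / 2) : ℝ) • x) hK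
      (fun i => (ha i).add ((hx i).smul _)) (fun i => (ha i).add ((hx i).smul _))
      fun p hp i => by
        simp only [Pi.add_apply, Pi.smul_apply, (h0 p hp i).1, (h0 p hp i).2]
        exact ⟨by module, by module⟩
    simpa only [key x a hx ha] using this
  · intro h K y z hK hy hz h0
    -- The inverse substitution: y = a + ½x and z = a − ½x give x = y − z and a = ½(y + z).
    have hx : ∀ i, IsSmoothForm ((y - z) i) := fun i => (hy i).sub (hz i)
    have ha : ∀ i, IsSmoothForm (((1 / 2 : ℝ) • (y + z)) i) := fun i => ((hy i).add (hz i)).smul _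
    have := h K (y - z) ((1 / 2 : ℝ) • (y + z)) hK hx ha fun p hp i => by
        simp only [Pi.add_apply, Pi.smul_apply, Pi.sub_apply, (h0 p hp i).1, (h0 p hp i).2]
        exact ⟨by module, by module⟩
    simp only [← key _ _ hx ha] at this
    have h1 : (1 / 2 : ℝ) • (y + z) + (1 / 2 : ℝ) • (y - z) = y := by module
    have h2 : (1 / 2 : ℝ) • (y + z) + (-(1 / 2) : ℝ) • (y - z) = z := by module
    rwa [h1, h2] at this

end StationaryTwo

/-! ### Integration of smooth forms of top degree -/

section Integral

variable {n : ℕ} {H : Type*} [TopologicalSpace H]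
  {I : ModelWithCorners ℝ (EuclideanSpace ℝ (Fin n)) H}
  {M : Type*} [TopologicalSpace M] [ChartedSpace H M]

/-- The density of a form of top degree in the preferred chart at `q`. -/
def density (q : M) (η : Form I M n) (y : EuclideanSpace ℝ (Fin n)) : ℝ :=
  chartRep q η y (EuclideanSpace.basisFun (Fin n) ℝ)

theorem density_add (q : M) (η ζ : Form I M n) (y : EuclideanSpace ℝ (Fin n)) :
    density q (η + ζ) y = density q η y + density q ζ y := rfl

theorem density_smul (q : M) (c : ℝ) (η : Form I M n) (y : EuclideanSpace ℝ (Fin n)) :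
    density q (c • η) y = c * density q η y := rfl

theorem density_of_eq_zero {q : M} {η : Form I M n} {y : EuclideanSpace ℝ (Fin n)}
    (h : η ((extChartAt I q).symm y) = 0) : density q η y = 0 := by
  rw [density, chartRep_of_eq_zero q h]; rfl

theorem continuousOn_apply_const {X E : Type*} [TopologicalSpace X] [NormedAddCommGroup E]
    [NormedSpace ℝ E] {k : ℕ} {f : X → E [⋀^Fin k]→L[ℝ] ℝ} {s : Set X} (hf : ContinuousOn f s)
    (v : Fin k → E) : ContinuousOn (fun x => f x v) s :=
  (ContinuousAlternatingMap.apply ℝ E ℝ v).continuous.comp_continuousOn hf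

theorem IsSmoothForm.continuousOn_density {η : Form I M n} (hη : IsSmoothForm η) (q : M) :
    ContinuousOn (density q η) (extChartAt I q).target :=
  continuousOn_apply_const (hη q).continuousOn _

theorem measurableSet_target_inter_preimage (q : M) {U : Set M} (hU : IsOpen U) :
    MeasurableSet ((extChartAt I q).target ∩ (extChartAt I q).symm ⁻¹' U) := by
  have ht : MeasurableSet (extChartAt I q).target := by
    rw [extChartAt_target]
    exact ((chartAt H q).open_target.preimage I.continuous_symm).measurableSet.inter
      I.isClosed_range.measurableSet
  obtain ⟨u, hu, h⟩ := continuousOn_iff'.1 (continuousOn_extChartAt_symm (I := I) q) U hU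
  rw [inter_comm, h]
  exact hu.measurableSet.inter ht

theorem measurableSet_target (q : M) : MeasurableSet (extChartAt I q).target := by
  simpa using measurableSet_target_inter_preimage (I := I) q isOpen_univ

theorem measurableSet_target_inter_preimage_closed (q : M) {K : Set M} (hK : IsClosed K) :
    MeasurableSet ((extChartAt I q).target ∩ (extChartAt I q).symm ⁻¹' K) := by
  have h := (measurableSet_target (I := I) q).diff
    (measurableSet_target_inter_preimage (I := I) q hK.isOpen_compl)
  convert h using 1
  ext y
  simp only [mem_inter_iff, mem_preimage, mem_sdiff, mem_compl_iff]
  tauto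

theorem isCompact_image_extChartAt (q : M) {S : Set M} (hS : IsCompact S)
    (hSs : S ⊆ (extChartAt I q).source) : IsCompact (extChartAt I q '' S) :=
  hS.image_of_continuousOn ((continuousOn_extChartAt q).mono hSs)

theorem image_extChartAt_subset_target (q : M) {S : Set M} (hSs : S ⊆ (extChartAt I q).source) :
    extChartAt I q '' S ⊆ (extChartAt I q).target := by
  rintro _ ⟨p, hp, rfl⟩
  exact (extChartAt I q).map_source (hSs hp)

/-- Continuity gives integrability on the compact image of S, and off that image the integrand is
zero. -/
theorem integrableOn_chart (q : M) {g : EuclideanSpace ℝ (Fin n) → ℝ}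
    {B : Set (EuclideanSpace ℝ (Fin n))} {S : Set M}
    (hg : ContinuousOn g (extChartAt I q).target) (hB : MeasurableSet B)
    (hBt : B ⊆ (extChartAt I q).target) (hS : IsCompact S) (hSs : S ⊆ (extChartAt I q).source)
    (h0 : ∀ y ∈ B, (extChartAt I q).symm y ∉ S → g y = 0) : IntegrableOn g B := by
  have hC := (hg.mono (image_extChartAt_subset_target q hSs)).integrableOn_compact (μ := volume)
    (isCompact_image_extChartAt q hS hSs)
  refine hC.of_forall_sdiff_eq_zero hB fun y hy => h0 y hy.1 fun hyS => hy.2 ?_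
  exact ⟨_, hyS, (extChartAt I q).right_inv (hBt hy.1)⟩

theorem alternating_map_basis_comp {m : ℕ} (f : EuclideanSpace ℝ (Fin m) [⋀^Fin m]→L[ℝ] ℝ)
    (T : EuclideanSpace ℝ (Fin m) →L[ℝ] EuclideanSpace ℝ (Fin m)) :
    f.compContinuousLinearMap T (EuclideanSpace.basisFun (Fin m) ℝ) =
      T.det * f (EuclideanSpace.basisFun (Fin m) ℝ) := by
  set b := (EuclideanSpace.basisFun (Fin m) ℝ).toBasis with hb
  have hbc : ((EuclideanSpace.basisFun (Fin m) ℝ : OrthonormalBasis (Fin m) ℝ _) :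
      Fin m → EuclideanSpace ℝ (Fin m)) = b := by simp [hb]
  have h := f.toAlternatingMap.eq_smul_basis_det b
  have h1 (v : Fin m → EuclideanSpace ℝ (Fin m)) : f v = f b * b.det v := by
    have := congrArg (fun g => g v) h
    simpa using this
  rw [hbc, ContinuousAlternatingMap.compContinuousLinearMap_apply, h1]
  have h2 : b.det (⇑T ∘ ⇑b) = T.det := by
    have := b.det_comp (T : EuclideanSpace ℝ (Fin m) →ₗ[ℝ] EuclideanSpace ℝ (Fin m)) b
    rw [b.det_self, mul_one] at this
    exact this
  rw [h2, mul_comm]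

variable [IsManifold I ∞ M]

theorem density_coordChange (p q : M) (η : Form I M n) {y : EuclideanSpace ℝ (Fin n)}
    (hy : y ∈ (extChartAt I q).target) (hp : (extChartAt I q).symm y ∈ (chartAt H p).source) :
    density q η y =
      (fderivWithin ℝ (extChartAt I p ∘ (extChartAt I q).symm) (range I) y).det *
        density p η ((extChartAt I p ∘ (extChartAt I q).symm) y) := by
  rw [density, chartRep_coordChange p q η hy hp, alternating_map_basis_comp]
  rfl

/-- Change of variables produces the absolute value of the Jacobian, densities transform with the
Jacobian itself, and orientation makes the two equal. The weight f makes room for partition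
functions. -/
theorem setIntegral_density_coordChange (hM : IsOrientedAtlas I M) (p q : M) (η : Form I M n)
    (f : M → ℝ) :
    ∫ y in (extChartAt I p).target ∩ (extChartAt I p).symm ⁻¹' (chartAt H q).source,
      f ((extChartAt I p).symm y) * density p η y =
    ∫ y in (extChartAt I q).target ∩ (extChartAt I q).symm ⁻¹' (chartAt H p).source,
      f ((extChartAt I q).symm y) * density q η y := by
  set φ := I.extendCoordChange (chartAt H q) (chartAt H p) with hφ
  have hsrc : φ.source =
      (extChartAt I q).target ∩ (extChartAt I q).symm ⁻¹' (chartAt H p).source := by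
    rw [hφ, PartialEquiv.trans_source, ← extChartAt_source I p]
    rfl
  have htgt : φ.target =
      (extChartAt I p).target ∩ (extChartAt I p).symm ⁻¹' (chartAt H q).source := by
    rw [hφ, ← I.extendCoordChange_symm, PartialEquiv.symm_target, PartialEquiv.trans_source,
      ← extChartAt_source I q]
    rfl
  rw [← hsrc, ← htgt, ← φ.image_source_eq_target]
  have hms : MeasurableSet φ.source := by
    rw [hsrc]
    exact measurableSet_target_inter_preimage q (chartAt H p).open_source
  have hmem : ∀ y ∈ φ.source, y ∈ (extChartAt I q).target ∧
      (extChartAt I q).symm y ∈ (chartAt H p).source := fun y hy => by rwa [hsrc] at hy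
  have hd : ∀ y ∈ φ.source, HasFDerivWithinAt φ (fderivWithin ℝ φ φ.source y) φ.source y :=
    fun y hy => by
      have h := contDiffWithinAt_coordChange p q (hmem y hy).1 (hmem y hy).2
      refine DifferentiableWithinAt.hasFDerivWithinAt ?_
      exact (h.differentiableWithinAt (by simp)).mono fun z hz =>
        extChartAt_target_subset_range q (hmem z hz).1
  rw [integral_image_eq_integral_abs_det_fderiv_smul volume hms hd φ.injOn]
  refine setIntegral_congr_fun hms fun y hy => ?_
  have hdet := hM _ (chart_mem_atlas H q) _ (chart_mem_atlas H p) y hy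
  have hfd : fderivWithin ℝ φ φ.source y =
      fderivWithin ℝ (extChartAt I p ∘ (extChartAt I q).symm) (range I) y := by
    have h := contDiffWithinAt_coordChange p q (hmem y hy).1 (hmem y hy).2
    have hn : φ.source ∈ 𝓝[range I] y := I.extendCoordChange_source_mem_nhdsWithin hy
    exact (fderivWithin_of_mem_nhdsWithin hn (uniqueDiffWithinAt_range (hmem y hy).1)
      ((h.differentiableWithinAt (by simp)).mono fun z hz =>
        extChartAt_target_subset_range q (hmem z hz).1)).symm
  have hinv : (extChartAt I p).symm (φ y) = (extChartAt I q).symm y :=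
    (extChartAt I p).left_inv (by rw [extChartAt_source]; exact (hmem y hy).2)
  simp only [smul_eq_mul]
  rw [abs_of_pos hdet, hinv, density_coordChange p q η (hmem y hy).1 (hmem y hy).2, ← hfd]
  have : (extChartAt I p ∘ (extChartAt I q).symm) y = φ y := rfl
  rw [this]
  ring

variable [T2Space M] [SigmaCompactSpace M]

theorem chartPartition_tsupport_subset (q : M) :
    tsupport (chartPartition I M q) ⊆ (chartAt H q).source :=
  (SmoothPartitionOfUnity.exists_isSubordinate_chartAt_source I M).choose_spec q

theorem contMDiff_chartPartition (q : M) :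
    ContMDiff I 𝓘(ℝ, ℝ) ∞ (chartPartition I M q) := (chartPartition I M q).contMDiff

/-- The indices of the partition of unity that matter on a compact set. -/
theorem finite_chartPartition_inter {K : Set M} (hK : IsCompact K) :
    {q : M | (support (chartPartition I M q) ∩ K).Nonempty}.Finite :=
  (chartPartition I M).locallyFinite.finite_nonempty_inter_compact hK

theorem integralOn_eq_sum {K : Set M} (hK : IsCompact K) (η : Form I M n) :
    integralOn K η = ∑ q ∈ (finite_chartPartition_inter (I := I) hK).toFinset,
      ∫ y in (extChartAt I q).target ∩ (extChartAt I q).symm ⁻¹' K,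
        chartPartition I M q ((extChartAt I q).symm y) * density q η y := by
  refine finsum_eq_sum_of_support_subset _ fun q hq => ?_
  rw [Finite.coe_toFinset]
  by_contra hne
  refine hq (setIntegral_eq_zero_of_forall_eq_zero fun y hy => ?_)
  have : chartPartition I M q ((extChartAt I q).symm y) = 0 := by
    by_contra h
    exact hne ⟨_, h, hy.2⟩
  rw [this, zero_mul]

theorem integrableOn_chartPartition_mul {K : Set M} (hK : IsCompact K) {η : Form I M n}
    (hη : IsSmoothForm η) (q : M) :
    IntegrableOn (fun y => chartPartition I M q ((extChartAt I q).symm y) * density q η y)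
      ((extChartAt I q).target ∩ (extChartAt I q).symm ⁻¹' K) := by
  refine integrableOn_chart q (S := K ∩ tsupport (chartPartition I M q)) ?_
    (measurableSet_target_inter_preimage_closed q hK.isClosed) inter_subset_left
    (hK.inter_right (isClosed_tsupport _)) ?_ fun y hy hyS => ?_
  · exact ((contDiffOn_comp_extChartAt_symm (contMDiff_chartPartition q) q).continuousOn).mul
      (hη.continuousOn_density q)
  · rw [extChartAt_source]
    exact inter_subset_right.trans (chartPartition_tsupport_subset q)
  · have : (extChartAt I q).symm y ∉ tsupport (chartPartition I M q) := fun h => hyS ⟨hy.2, h⟩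
    rw [image_eq_zero_of_notMem_tsupport this, zero_mul]

theorem integralOn_add {K : Set M} (hK : IsCompact K) {η ζ : Form I M n}
    (hη : IsSmoothForm η) (hζ : IsSmoothForm ζ) :
    integralOn K (η + ζ) = integralOn K η + integralOn K ζ := by
  simp only [integralOn_eq_sum hK, density_add, mul_add]
  rw [← Finset.sum_add_distrib]
  exact Finset.sum_congr rfl fun q _ => integral_add (integrableOn_chartPartition_mul hK hη q)
    (integrableOn_chartPartition_mul hK hζ q)

theorem integralOn_smul {K : Set M} (hK : IsCompact K) (c : ℝ) (η : Form I M n) :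
    integralOn K (c • η) = c * integralOn K η := by
  simp only [integralOn_eq_sum hK, density_smul, mul_left_comm _ c, integral_const_mul,
    Finset.mul_sum]

theorem integralOn_sum {K : Set M} (hK : IsCompact K) {ι : Type*} {s : Finset ι}
    {η : ι → Form I M n} (hη : ∀ i ∈ s, IsSmoothForm (η i)) :
    integralOn K (∑ i ∈ s, η i) = ∑ i ∈ s, integralOn K (η i) := by
  classical
  induction s using Finset.induction_on with
  | empty => simpa using integralOn_smul hK 0 (0 : Form I M n)
  | insert i s hi ih =>
    have hs : ∀ i ∈ s, IsSmoothForm (η i) := fun i hi => hη i (by simp [hi])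
    rw [Finset.sum_insert hi, Finset.sum_insert hi,
      integralOn_add hK (hη i (by simp)) (IsSmoothForm.sum hs), ih hs]

/-- The integral of a form supported in a chart domain is computed in this chart. -/
theorem integralOn_eq_setIntegral_density (hM : IsOrientedAtlas I M) {K S : Set M}
    (hK : IsCompact K) (hS : IsCompact S) (hSK : S ⊆ K) {q : M}
    (hSq : S ⊆ (chartAt H q).source) {η : Form I M n} (hη : IsSmoothForm η)
    (h0 : ∀ p ∉ S, η p = 0) :
    integralOn K η = ∫ y in (extChartAt I q).target, density q η y := by
  -- Each summand moves from chart r to chart q. Outside the overlap nothing is lost: η vanishes off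
  -- S, which lies in chart q, and the weight is supported in chart r.
  have hterm (r : M) : ∫ y in (extChartAt I r).target ∩ (extChartAt I r).symm ⁻¹' K,
      chartPartition I M r ((extChartAt I r).symm y) * density r η y =
      ∫ y in (extChartAt I q).target,
        chartPartition I M r ((extChartAt I q).symm y) * density q η y := by
    have h1 {U : Set M} (hU : MeasurableSet ((extChartAt I r).target ∩ (extChartAt I r).symm ⁻¹' U))
        (hSU : S ⊆ U) : ∫ y in (extChartAt I r).target ∩ (extChartAt I r).symm ⁻¹' U,
        chartPartition I M r ((extChartAt I r).symm y) * density r η y =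
        ∫ y in (extChartAt I r).target ∩ (extChartAt I r).symm ⁻¹' S,
        chartPartition I M r ((extChartAt I r).symm y) * density r η y := by
      refine setIntegral_eq_of_subset_of_forall_sdiff_eq_zero hU
        (inter_subset_inter_right _ (preimage_mono hSU)) fun y hy => ?_
      have : (extChartAt I r).symm y ∉ S := fun h => hy.2 ⟨hy.1.1, h⟩
      rw [density_of_eq_zero (h0 _ this), mul_zero]
    rw [h1 (measurableSet_target_inter_preimage_closed r hK.isClosed) hSK,
      ← h1 (measurableSet_target_inter_preimage r (chartAt H q).open_source) hSq,
      setIntegral_density_coordChange hM r q η (chartPartition I M r)]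
    refine (setIntegral_eq_of_subset_of_forall_sdiff_eq_zero (measurableSet_target q)
      inter_subset_left fun y hy => ?_).symm
    have : (extChartAt I q).symm y ∉ tsupport (chartPartition I M r) := fun h =>
      hy.2 ⟨hy.1, chartPartition_tsupport_subset r h⟩
    rw [image_eq_zero_of_notMem_tsupport this, zero_mul]
  rw [integralOn_eq_sum hK]
  simp only [hterm]
  have hSq' : S ⊆ (extChartAt I q).source := by rwa [extChartAt_source]
  rw [← integral_finsetSum]
  · refine setIntegral_congr_fun (measurableSet_target q) fun y hy => ?_
    by_cases hyS : (extChartAt I q).symm y ∈ S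
    -- At points of S the weights sum to 1; those omitted from the finite index set vanish on K,
    -- which contains S.
    · rw [← Finset.sum_mul, (chartPartition I M).sum_finsupport' _ (mem_univ _), one_mul]
      intro r hr
      rw [Finite.mem_toFinset]
      exact ⟨_, by simpa using hr, hSK hyS⟩
    · simp [density_of_eq_zero (h0 _ hyS)]
  · intro r _
    refine integrableOn_chart q ?_ (measurableSet_target q) Subset.rfl hS hSq' fun y _ hyS => ?_
    · exact ((contDiffOn_comp_extChartAt_symm (contMDiff_chartPartition r) q).continuousOn).mul
        (hη.continuousOn_density q)
    · rw [density_of_eq_zero (h0 _ hyS), mul_zero]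

end Integral

/-! ### Stokes' formula in a half-space -/

section HalfSpace

variable {n : ℕ}

/-- The linear inclusion `y ↦ (0, y)`. -/
def consZeroL (n : ℕ) : EuclideanSpace ℝ (Fin n) →L[ℝ] EuclideanSpace ℝ (Fin (n + 1)) :=
  LinearMap.toContinuousLinearMap
    { toFun := fun y => WithLp.toLp 2 (Fin.cons 0 fun i => y i)
      map_add' := fun x y => by
        ext i; refine Fin.cases ?_ (fun j => ?_) i <;> simp
      map_smul' := fun c x => by
        ext i; refine Fin.cases ?_ (fun j => ?_) i <;> simp }

theorem consZeroL_apply_zero (y : EuclideanSpace ℝ (Fin n)) : consZeroL n y 0 = 0 := rfl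

theorem consZeroL_apply_succ (y : EuclideanSpace ℝ (Fin n)) (i : Fin n) :
    consZeroL n y i.succ = y i := rfl

theorem coe_consZero (y : EuclideanSpace ℝ (Fin n)) : (consZero y).1 = consZeroL n y := rfl

theorem consZeroL_mem_range (y : EuclideanSpace ℝ (Fin n)) :
    consZeroL n y ∈ range (𝓡∂ (n + 1)) := by
  rw [range_modelWithCornersEuclideanHalfSpace]
  exact le_of_eq (consZeroL_apply_zero y).symm

theorem consZeroL_basisFun (i : Fin n) :
    consZeroL n (EuclideanSpace.basisFun (Fin n) ℝ i) =
      EuclideanSpace.basisFun (Fin (n + 1)) ℝ i.succ := by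
  ext j
  refine Fin.cases ?_ (fun j => ?_) j
  · rw [consZeroL_apply_zero]; simp [EuclideanSpace.basisFun_apply]
  · rw [consZeroL_apply_succ]; simp [EuclideanSpace.basisFun_apply]

/-- Enclose C in a box whose back face in direction 0 lies on the boundary hyperplane and apply the
divergence theorem. All other faces avoid C, and the back face carries the minus sign. -/
theorem setIntegral_extDerivWithin_halfSpace
    {w : EuclideanSpace ℝ (Fin (n + 1)) → EuclideanSpace ℝ (Fin (n + 1)) [⋀^Fin n]→L[ℝ] ℝ}
    (hw : ContDiffOn ℝ 1 w (range (𝓡∂ (n + 1)))) {C : Set (EuclideanSpace ℝ (Fin (n + 1)))}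
    (hC : IsCompact C) (h0 : ∀ y ∈ range (𝓡∂ (n + 1)), y ∉ C → w y = 0) :
    ∫ y in range (𝓡∂ (n + 1)), extDerivWithin w (range (𝓡∂ (n + 1))) y
        (EuclideanSpace.basisFun (Fin (n + 1)) ℝ) =
      -∫ z : EuclideanSpace ℝ (Fin n), w (consZeroL n z)
        (fun i => consZeroL n (EuclideanSpace.basisFun (Fin n) ℝ i)) := by
  set R' := range (𝓡∂ (n + 1)) with hR'
  have hmemR (y : EuclideanSpace ℝ (Fin (n + 1))) : y ∈ R' ↔ 0 ≤ y 0 := by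
    rw [hR', range_modelWithCornersEuclideanHalfSpace]; rfl
  have hU : UniqueDiffOn ℝ R' := (𝓡∂ (n + 1)).uniqueDiffOn
  -- The bound is strict, so that points with some |yᵢ| ≥ R, in particular the far faces of the box,
  -- are outside C.
  obtain ⟨R, hR0, hR⟩ : ∃ R : ℝ, 0 < R ∧ ∀ y ∈ C, ∀ i, |y i| < R := by
    obtain ⟨R, hR⟩ := hC.isBounded.exists_norm_le
    refine ⟨max R 0 + 1, by positivity, fun y hy i => ?_⟩
    have h1 := PiLp.norm_apply_le y i
    have h2 := hR y hy
    rw [Real.norm_eq_abs] at h1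
    linarith [le_max_left R 0]
  set e := (EuclideanSpace.basisFun (Fin (n + 1)) ℝ : Fin (n + 1) → _) with he
  set L : (Fin (n + 1) → ℝ) →L[ℝ] EuclideanSpace ℝ (Fin (n + 1)) :=
    ((PiLp.continuousLinearEquiv 2 ℝ (fun _ : Fin (n + 1) => ℝ)).symm :
      (Fin (n + 1) → ℝ) →L[ℝ] EuclideanSpace ℝ (Fin (n + 1))) with hL
  have hLap (x : Fin (n + 1) → ℝ) (i) : L x i = x i := rfl
  have hLe (i : Fin (n + 1)) : L (Pi.single i 1) = e i := by
    ext j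
    rw [hLap, he, EuclideanSpace.basisFun_apply]
    rfl
  set a : Fin (n + 1) → ℝ := fun i => if i = 0 then 0 else -R with ha
  set b : Fin (n + 1) → ℝ := fun _ => R with hb
  have hab : a ≤ b := fun i => by
    simp only [ha, hb]; split_ifs <;> linarith
  have hLmem : MapsTo L (Icc a b) R' := fun x hx => by
    rw [hmemR, hLap]
    simpa [ha] using hx.1 0
  -- The functions (−1)ⁱ w(e₀, …, êᵢ, …, eₙ) are the components of the vector field whose divergence
  -- is dw evaluated on the standard basis.
  set T : Fin (n + 1) → EuclideanSpace ℝ (Fin (n + 1)) [⋀^Fin n]→L[ℝ] ℝ →L[ℝ] ℝ := fun i =>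
    ((-1 : ℝ) ^ (i : ℕ)) • ContinuousAlternatingMap.apply ℝ _ ℝ (i.removeNth e) with hT
  have hTap (i) (f : EuclideanSpace ℝ (Fin (n + 1)) [⋀^Fin n]→L[ℝ] ℝ) :
    T i f = (-1 : ℝ) ^ (i : ℕ) * f (i.removeNth e) := rfl
  have hdc : ContinuousOn (fderivWithin ℝ w R') R' := hw.continuousOn_fderivWithin hU le_rfl
  have hzero : ∀ y ∈ R', y ∉ C → fderivWithin ℝ w R' y = 0 := fun y hy hyC => by
    have : w =ᶠ[𝓝[R'] y] fun _ => 0 := by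
      filter_upwards [self_mem_nhdsWithin, mem_nhdsWithin_of_mem_nhds
        (hC.isClosed.isOpen_compl.mem_nhds hyC)] with z hz hzC
      exact h0 z hz hzC
    rw [this.fderivWithin_eq (h0 y hy hyC)]
    simp
  have hnotC : ∀ y : EuclideanSpace ℝ (Fin (n + 1)), (∃ i, R ≤ |y i|) → y ∉ C :=
    fun y ⟨i, hi⟩ hy => absurd (hR y hy i) (not_lt.2 hi)
  have key := integral_divergence_of_hasFDerivAt_off_countable' a b hab
    (fun i x => T i (w (L x))) (fun i x => (T i).comp ((fderivWithin ℝ w R' (L x)).comp L))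
    ∅ countable_empty
    (fun i => (T i).continuous.comp_continuousOn
      (hw.continuousOn.comp L.continuous.continuousOn hLmem))
    (fun x hx i => by
      -- Inside the open box the first coordinate is positive, so the derivative within the
      -- half-space is a genuine derivative.
      have hx0 : 0 < x 0 := by simpa [ha] using (hx.1 0 (mem_univ _)).1
      have hn : R' ∈ 𝓝 (L x) := by
        rw [hR', range_modelWithCornersEuclideanHalfSpace]
        have : Continuous fun y : EuclideanSpace ℝ (Fin (n + 1)) => y 0 :=
          PiLp.continuous_apply 2 _ 0
        filter_upwards [this.continuousAt.eventually (lt_mem_nhds hx0)] with y hy using le_of_lt hy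
      have hd := ((hw (L x) (mem_of_mem_nhds hn)).differentiableWithinAt
        (by simp)).hasFDerivWithinAt.hasFDerivAt hn
      exact (T i).hasFDerivAt.comp x (hd.comp x L.hasFDerivAt))
    (by
      refine ContinuousOn.integrableOn_compact isCompact_Icc ?_
      refine continuousOn_finsetSum _ fun i _ => ?_
      refine (T i).continuous.comp_continuousOn ?_
      exact (hdc.comp L.continuous.continuousOn hLmem).clm_apply continuousOn_const)
  have hLHS : ∫ y in R', extDerivWithin w R' y e =
      ∫ x in Icc a b, ∑ i, (T i).comp ((fderivWithin ℝ w R' (L x)).comp L) (Pi.single i 1) := by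
    have hmp := (EuclideanSpace.volume_preserving_symm_measurableEquiv_toLp (Fin (n + 1))).symm
    have hsum (x : Fin (n + 1) → ℝ) :
        ∑ i, (T i).comp ((fderivWithin ℝ w R' (L x)).comp L) (Pi.single i 1) =
          extDerivWithin w R' (L x) e := by
      rw [extDerivWithin_apply']
      refine Finset.sum_congr rfl fun i _ => ?_
      rw [ContinuousLinearMap.comp_apply, ContinuousLinearMap.comp_apply, hLe, hTap]
    simp only [hsum]
    rw [← hmp.setIntegral_preimage_emb (MeasurableEquiv.measurableEmbedding _)]
    refine setIntegral_eq_of_subset_of_forall_sdiff_eq_zero ?_ hLmem fun x hx => ?_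
    · exact (MeasurableEquiv.measurable _) (𝓡∂ (n + 1)).isClosed_range.measurableSet
    · have hx1 : L x ∈ R' := hx.1
      have hx2 : L x ∉ C := by
        refine hnotC _ ?_
        by_contra hcon
        push Not at hcon
        refine hx.2 ⟨fun i => ?_, fun i => ?_⟩
        · simp only [ha]
          split_ifs with hi
          · subst hi; exact (hmemR _).1 hx1
          · exact (abs_lt.1 (hcon i)).1.le
        · exact (abs_lt.1 (hcon i)).2.le
      change extDerivWithin w R' (L x) e = 0
      rw [extDerivWithin_apply', hzero _ hx1 hx2]
      simp
  rw [hLHS, key]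
  have hwz (i : Fin (n + 1)) (x : Fin (n + 1) → ℝ) (hx : L x ∈ R') (h : ∃ j, R ≤ |x j|) :
      T i (w (L x)) = 0 := by
    rw [h0 _ hx (hnotC _ h), map_zero]
  have hins (i : Fin (n + 1)) (c : ℝ) (hc : c ∈ Icc (a i) (b i)) (x : Fin n → ℝ)
      (hx : x ∈ Icc (a ∘ i.succAbove) (b ∘ i.succAbove)) : L (i.insertNth c x) ∈ R' :=
    hLmem (Fin.insertNth_mem_Icc.2 ⟨hc, hx⟩)
  have hfront (i : Fin (n + 1)) :
      ∫ x in Icc (a ∘ i.succAbove) (b ∘ i.succAbove), T i (w (L (i.insertNth (b i) x))) = 0 := by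
    refine setIntegral_eq_zero_of_forall_eq_zero fun x hx => ?_
    refine hwz i _ (hins i _ (right_mem_Icc.2 (hab i)) x hx) ⟨i, ?_⟩
    simp [hb, abs_of_pos hR0]
  have hback (i : Fin n) :
      ∫ x in Icc (a ∘ i.succ.succAbove) (b ∘ i.succ.succAbove),
        T i.succ (w (L (i.succ.insertNth (a i.succ) x))) = 0 := by
    refine setIntegral_eq_zero_of_forall_eq_zero fun x hx => ?_
    refine hwz i.succ _ (hins i.succ _ (left_mem_Icc.2 (hab i.succ)) x hx) ⟨i.succ, ?_⟩
    simp [ha, abs_of_pos hR0]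
  simp only [hfront, zero_sub]
  -- Only the back face of coordinate 0 survives.
  rw [Fin.sum_univ_succ, Finset.sum_eq_zero fun i _ => by rw [hback i, neg_zero], add_zero]
  congr 1
  have hmp := (EuclideanSpace.volume_preserving_symm_measurableEquiv_toLp (Fin n)).symm
  rw [← hmp.integral_comp (MeasurableEquiv.measurableEmbedding _)]
  have hpt (x : Fin n → ℝ) : T 0 (w (L ((0 : Fin (n + 1)).insertNth (a 0) x))) =
      w (consZeroL n (WithLp.toLp 2 x))
        (fun i => consZeroL n (EuclideanSpace.basisFun (Fin n) ℝ i)) := by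
    have h1 : L ((0 : Fin (n + 1)).insertNth (a 0) x) = consZeroL n (WithLp.toLp 2 x) := by
      ext j
      rw [hLap, Fin.insertNth_zero']
      refine Fin.cases ?_ (fun j => ?_) j <;> simp [ha, consZeroL_apply_zero, consZeroL_apply_succ]
    rw [h1, hTap]
    simp only [Fin.val_zero, pow_zero, one_mul]
    congr 1
    funext i
    rw [consZeroL_basisFun, Fin.removeNth_apply, Fin.zero_succAbove]
  simp only [hpt]
  -- The face integral extends to the whole hyperplane because the integrand vanishes off the face.
  rw [← integral_indicator measurableSet_Icc]
  congr 1
  funext x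
  classical
  rw [indicator_apply]
  split_ifs with hx
  · rfl
  · rw [← hpt]
    have hR1 : L ((0 : Fin (n + 1)).insertNth (a 0) x) ∈ R' := by
      rw [hmemR, hLap]; simp [ha]
    symm
    refine hwz 0 _ hR1 ?_
    by_contra hcon
    push Not at hcon
    refine hx ⟨fun i => ?_, fun i => ?_⟩
    · have := (abs_lt.1 (hcon i.succ)).1.le
      simpa [ha] using this
    · have := (abs_lt.1 (hcon i.succ)).2.le
      simpa [hb] using this

end HalfSpace

/-! ### Stokes' formula for forms supported in a chart -/

section Stokes

variable {n : ℕ} {M : Type*} [TopologicalSpace M] [ChartedSpace (EuclideanHalfSpace (n + 1)) M]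

open Classical in
/-- The density on the boundary of a form of codegree one in the preferred chart at `q`. -/
def bdryDensity (q : M) (θ : Form (𝓡∂ (n + 1)) M n) (z : EuclideanSpace ℝ (Fin n)) : ℝ :=
  if consZeroL n z ∈ (extChartAt (𝓡∂ (n + 1)) q).target then
    chartRep q θ (consZeroL n z) fun i => consZeroL n (EuclideanSpace.basisFun (Fin n) ℝ i)
  else 0

variable [IsManifold (𝓡∂ (n + 1)) ∞ M]

omit [IsManifold (𝓡∂ (n + 1)) ∞ M] in
/-- Extension by zero of a form supported in a chart domain. -/
theorem contDiffOn_indicator_chartRep {k : ℕ} {q : M} {S : Set M} (hS : IsCompact S)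
    (hSq : S ⊆ (extChartAt (𝓡∂ (n + 1)) q).source) {θ : Form (𝓡∂ (n + 1)) M k}
    (hθ : IsSmoothForm θ) (h0 : ∀ p ∉ S, θ p = 0) :
    ContDiffOn ℝ ∞ ((extChartAt (𝓡∂ (n + 1)) q).target.indicator (chartRep q θ))
      (range (𝓡∂ (n + 1))) := by
  intro y hy
  by_cases hyt : y ∈ (extChartAt (𝓡∂ (n + 1)) q).target
  · refine (hθ.contDiffWithinAt hyt).congr_of_eventuallyEq ?_ (indicator_of_mem hyt _)
    filter_upwards [extChartAt_target_mem_nhdsWithin_of_mem hyt] with z hz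
    exact indicator_of_mem hz _
  · have hC := isCompact_image_extChartAt q hS hSq
    have hyC : y ∉ extChartAt (𝓡∂ (n + 1)) q '' S := fun h =>
      hyt (image_extChartAt_subset_target q hSq h)
    have hz : (extChartAt (𝓡∂ (n + 1)) q).target.indicator (chartRep q θ)
        =ᶠ[𝓝[range (𝓡∂ (n + 1))] y] fun _ => 0 := by
      filter_upwards [mem_nhdsWithin_of_mem_nhds (hC.isClosed.isOpen_compl.mem_nhds hyC)] with z hz
      by_cases hzt : z ∈ (extChartAt (𝓡∂ (n + 1)) q).target
      · rw [indicator_of_mem hzt]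
        exact chartRep_of_eq_zero q (h0 _ fun h => hz ⟨_, h, (extChartAt _ q).right_inv hzt⟩)
      · exact indicator_of_notMem hzt _
    exact contDiffWithinAt_const.congr_of_eventuallyEq hz (indicator_of_notMem hyt _)

variable [T2Space M] [SigmaCompactSpace M]

/-- Extended by zero, the chart expression of θ is smooth on the half-space, where Stokes' formula
is available. The boundary term stays a coordinate integral, since only its vanishing is ever
tested. -/
theorem integralOn_extD (hM : IsOrientedAtlas (𝓡∂ (n + 1)) M) {K S : Set M}
    (hK : IsCompact K) (hS : IsCompact S) (hSK : S ⊆ K) {q : M}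
    (hSq : S ⊆ (chartAt (EuclideanHalfSpace (n + 1)) q).source) {θ : Form (𝓡∂ (n + 1)) M n}
    (hθ : IsSmoothForm θ) (h0 : ∀ p ∉ S, θ p = 0) :
    integralOn K (extD θ) = -∫ z, bdryDensity q θ z := by
  have hSq' : S ⊆ (extChartAt (𝓡∂ (n + 1)) q).source := by rwa [extChartAt_source]
  have hC := isCompact_image_extChartAt q hS hSq'
  have hd0 : ∀ p ∉ S, extD θ p = 0 := fun p hp => extD_eq_zero <| by
    filter_upwards [hS.isClosed.isOpen_compl.mem_nhds hp] with r hr using h0 r hr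
  have hw0 : ∀ y, y ∉ extChartAt (𝓡∂ (n + 1)) q '' S →
      (extChartAt (𝓡∂ (n + 1)) q).target.indicator (chartRep q θ) y = 0 := fun y hy => by
    by_cases hzt : y ∈ (extChartAt (𝓡∂ (n + 1)) q).target
    · rw [indicator_of_mem hzt]
      exact chartRep_of_eq_zero q (h0 _ fun h => hy ⟨_, h, (extChartAt _ q).right_inv hzt⟩)
    · exact indicator_of_notMem hzt _
  have hst := setIntegral_extDerivWithin_halfSpace
    ((contDiffOn_indicator_chartRep hS hSq' hθ h0).of_le (by simp)) hC fun y _ hy => hw0 y hy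
  rw [integralOn_eq_setIntegral_density hM hK hS hSK hSq hθ.extD hd0]
  have h1 : ∫ y in (extChartAt (𝓡∂ (n + 1)) q).target, density q (extD θ) y =
      ∫ y in (extChartAt (𝓡∂ (n + 1)) q).target, extDerivWithin
        ((extChartAt (𝓡∂ (n + 1)) q).target.indicator (chartRep q θ)) (range (𝓡∂ (n + 1))) y
        (EuclideanSpace.basisFun (Fin (n + 1)) ℝ) := by
    refine setIntegral_congr_fun (measurableSet_target q) fun y hy => ?_
    rw [density, chartRep_extD hθ q hy]
    congr 1
    refine (Filter.EventuallyEq.extDerivWithin_eq_of_mem ?_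
      (extChartAt_target_subset_range q hy)).symm
    filter_upwards [extChartAt_target_mem_nhdsWithin_of_mem hy] with z hz
    exact indicator_of_mem hz _
  rw [h1, ← setIntegral_eq_of_subset_of_forall_sdiff_eq_zero
    (𝓡∂ (n + 1)).isClosed_range.measurableSet (extChartAt_target_subset_range q) ?_, hst]
  · congr 1
    congr 1
    funext z
    rw [bdryDensity]
    split_ifs with hz
    · rw [indicator_of_mem hz]
    · rw [indicator_of_notMem hz]; rfl
  · intro y hy
    have hyC : y ∉ extChartAt (𝓡∂ (n + 1)) q '' S := fun h =>
      hy.2 (image_extChartAt_subset_target q hSq' h)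
    have hz : (extChartAt (𝓡∂ (n + 1)) q).target.indicator (chartRep q θ)
        =ᶠ[𝓝[range (𝓡∂ (n + 1))] y] fun _ => 0 := by
      filter_upwards [mem_nhdsWithin_of_mem_nhds (hC.isClosed.isOpen_compl.mem_nhds hyC)] with z hz
      exact hw0 z hz
    rw [hz.extDerivWithin_eq_of_mem hy.1, extDerivWithin_apply']
    simp

end Stokes

/-! ### Stationarity in terms of the first variation -/

section FirstVariation

variable {H : Type*} [TopologicalSpace H]
  {I : ModelWithCorners ℝ (EuclideanSpace ℝ (Fin 4)) H}
  {M : Type*} [TopologicalSpace M] [ChartedSpace H M]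
  [IsManifold I ∞ M] [T2Space M] [SigmaCompactSpace M]

/-- The integral is a polynomial of degree at most 4 in t whose linear coefficient is the stated
one, so no differentiation under the integral sign is required. -/
theorem hasDerivAt_integralOn_pair {K : Set M} (hK : IsCompact K)
    {P₀ P₁ P₂ Q₀ Q₁ Q₂ : Fin 3 → Form I M 2}
    (hP₀ : ∀ i, IsSmoothForm (P₀ i)) (hP₁ : ∀ i, IsSmoothForm (P₁ i))
    (hP₂ : ∀ i, IsSmoothForm (P₂ i)) (hQ₀ : ∀ i, IsSmoothForm (Q₀ i))
    (hQ₁ : ∀ i, IsSmoothForm (Q₁ i)) (hQ₂ : ∀ i, IsSmoothForm (Q₂ i)) :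
    HasDerivAt (fun t : ℝ => integralOn K (pair (P₀ + t • P₁ + t ^ 2 • P₂)
      (Q₀ + t • Q₁ + t ^ 2 • Q₂) : Form I M 4))
      (integralOn K (pair P₀ Q₁ + pair P₁ Q₀ : Form I M 4)) 0 := by
  have s {a b : Fin 3 → Form I M 2} (ha : ∀ i, IsSmoothForm (a i)) (hb : ∀ i, IsSmoothForm (b i)) :
    IsSmoothForm (pair a b : Form I M 4) := IsSmoothForm.pair ha hb
  have hexp (t : ℝ) : integralOn K (pair (P₀ + t • P₁ + t ^ 2 • P₂)
      (Q₀ + t • Q₁ + t ^ 2 • Q₂) : Form I M 4) =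
      integralOn K (pair P₀ Q₀ : Form I M 4) + t * integralOn K (pair P₀ Q₁ + pair P₁ Q₀ : Form I M 4) +
      t ^ 2 * integralOn K (pair P₀ Q₂ + pair P₁ Q₁ + pair P₂ Q₀ : Form I M 4) +
      t ^ 3 * integralOn K (pair P₁ Q₂ + pair P₂ Q₁ : Form I M 4) +
      t ^ 4 * integralOn K (pair P₂ Q₂ : Form I M 4) := by
    have h : (pair (P₀ + t • P₁ + t ^ 2 • P₂) (Q₀ + t • Q₁ + t ^ 2 • Q₂) : Form I M 4) =
        pair P₀ Q₀ + t • (pair P₀ Q₁ + pair P₁ Q₀ : Form I M 4) +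
        t ^ 2 • (pair P₀ Q₂ + pair P₁ Q₁ + pair P₂ Q₀ : Form I M 4) +
        t ^ 3 • (pair P₁ Q₂ + pair P₂ Q₁ : Form I M 4) + t ^ 4 • (pair P₂ Q₂ : Form I M 4) := by
      simp only [pair_add_left, pair_add_right, pair_smul_left, pair_smul_right]
      module
    have h1 := (s hP₀ hQ₁).add (s hP₁ hQ₀)
    have h2 := ((s hP₀ hQ₂).add (s hP₁ hQ₁)).add (s hP₂ hQ₀)
    have h3 := (s hP₁ hQ₂).add (s hP₂ hQ₁)
    rw [h, integralOn_add hK ((((s hP₀ hQ₀).add (h1.smul _)).add (h2.smul _)).add (h3.smul _))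
        ((s hP₂ hQ₂).smul _),
      integralOn_add hK (((s hP₀ hQ₀).add (h1.smul _)).add (h2.smul _)) (h3.smul _),
      integralOn_add hK ((s hP₀ hQ₀).add (h1.smul _)) (h2.smul _),
      integralOn_add hK (s hP₀ hQ₀) (h1.smul _)]
    simp only [integralOn_smul hK]
  simp only [hexp]
  have hp (c0 c1 c2 c3 c4 : ℝ) : HasDerivAt (fun t : ℝ => c0 + t * c1 + t ^ 2 * c2 + t ^ 3 * c3 +
      t ^ 4 * c4) c1 0 := by
    have h := ((((hasDerivAt_const (0 : ℝ) c0).add ((hasDerivAt_id (0 : ℝ)).mul_const c1)).add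
      ((hasDerivAt_pow 2 (0 : ℝ)).mul_const c2)).add ((hasDerivAt_pow 3 (0 : ℝ)).mul_const c3)).add
      ((hasDerivAt_pow 4 (0 : ℝ)).mul_const c4)
    exact h.congr_deriv (by simp)
  exact hp _ _ _ _ _

theorem hasDerivAt_integralOn_lagrangian {K : Set M} (hK : IsCompact K) (α₁ α₂ α₃ α₄ α₅ : ℝ)
    {e A x a : Fin 3 → Form I M 1} (he : ∀ i, IsSmoothForm (e i)) (hA : ∀ i, IsSmoothForm (A i))
    (hx : ∀ i, IsSmoothForm (x i)) (ha : ∀ i, IsSmoothForm (a i)) :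
    HasDerivAt (fun t : ℝ => integralOn K (lagrangian α₁ α₂ α₃ α₄ α₅ (e + t • x) (A + t • a)))
      (integralOn K (firstVariation α₁ α₂ α₃ α₄ α₅ e A x a)) 0 := by
  have hW₀ : ∀ i, IsSmoothForm (epsWedge e i) := IsSmoothForm.bracket he he
  have hW₁ : ∀ i, IsSmoothForm (((2 : ℝ) • (bracket e x : Fin 3 → Form I M 2)) i) := fun i =>
    (IsSmoothForm.bracket he hx i).smul 2
  have hW₂ : ∀ i, IsSmoothForm (epsWedge x i) := IsSmoothForm.bracket hx hx
  have hF₀ := IsSmoothForm.curv hA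
  have hF₁ := IsSmoothForm.covD hA ha
  have hF₂ : ∀ i, IsSmoothForm (((1 / 2 : ℝ) • epsWedge a) i) := fun i =>
    (IsSmoothForm.bracket ha ha i).smul _
  have hT₀ := IsSmoothForm.covD hA he
  have hT₁ : ∀ i, IsSmoothForm ((covD A x + (bracket a e : Fin 3 → Form I M 2)) i) := fun i =>
    (IsSmoothForm.covD hA hx i).add (IsSmoothForm.bracket ha he i)
  have hT₂ : ∀ i, IsSmoothForm (bracket a x i) := IsSmoothForm.bracket ha hx
  have s {a b : Fin 3 → Form I M 2} (ha : ∀ i, IsSmoothForm (a i)) (hb : ∀ i, IsSmoothForm (b i)) :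
    IsSmoothForm (pair a b : Form I M 4) := IsSmoothForm.pair ha hb
  have split (f₁ f₂ f₃ f₄ f₅ : Form I M 4) (h₁ : IsSmoothForm f₁) (h₂ : IsSmoothForm f₂)
      (h₃ : IsSmoothForm f₃) (h₄ : IsSmoothForm f₄) (h₅ : IsSmoothForm f₅) :
      integralOn K (α₁ • f₁ + α₂ • f₂ + α₃ • f₃ + α₄ • f₄ + α₅ • f₅) =
        α₁ * integralOn K f₁ + α₂ * integralOn K f₂ + α₃ * integralOn K f₃ +
          α₄ * integralOn K f₄ + α₅ * integralOn K f₅ := by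
    rw [integralOn_add hK ((((h₁.smul _).add (h₂.smul _)).add (h₃.smul _)).add (h₄.smul _))
        (h₅.smul _), integralOn_add hK (((h₁.smul _).add (h₂.smul _)).add (h₃.smul _)) (h₄.smul _),
      integralOn_add hK ((h₁.smul _).add (h₂.smul _)) (h₃.smul _),
      integralOn_add hK (h₁.smul _) (h₂.smul _)]
    simp only [integralOn_smul hK]
  have het (t : ℝ) : ∀ i, IsSmoothForm ((e + t • x) i) := fun i => (he i).add ((hx i).smul t)
  have hAt (t : ℝ) : ∀ i, IsSmoothForm ((A + t • a) i) := fun i => (hA i).add ((ha i).smul t)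
  have hL (t : ℝ) : integralOn K (lagrangian α₁ α₂ α₃ α₄ α₅ (e + t • x) (A + t • a)) =
      α₁ * integralOn K (pair (epsWedge (e + t • x)) (curv (A + t • a)) : Form I M 4) +
      α₂ * integralOn K (pair (covD (A + t • a) (e + t • x)) (covD (A + t • a) (e + t • x)) :
        Form I M 4) +
      α₃ * integralOn K (pair (curv (A + t • a)) (curv (A + t • a)) : Form I M 4) +
      α₄ * integralOn K (pair (covD (A + t • a) (e + t • x)) (epsWedge (e + t • x)) : Form I M 4) +
      α₅ * integralOn K (pair (curv (A + t • a)) (covD (A + t • a) (e + t • x)) : Form I M 4) := by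
    rw [lagrangian_eq]
    exact split _ _ _ _ _ (s (IsSmoothForm.bracket (het t) (het t)) (IsSmoothForm.curv (hAt t)))
      (s (IsSmoothForm.covD (hAt t) (het t)) (IsSmoothForm.covD (hAt t) (het t)))
      (s (IsSmoothForm.curv (hAt t)) (IsSmoothForm.curv (hAt t)))
      (s (IsSmoothForm.covD (hAt t) (het t)) (IsSmoothForm.bracket (het t) (het t)))
      (s (IsSmoothForm.curv (hAt t)) (IsSmoothForm.covD (hAt t) (het t)))
  simp only [hL, epsWedge_add_smul, curv_add_smul hA ha, covD_add_smul he hx]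
  rw [firstVariation, split _ _ _ _ _ ((s hW₀ hF₁).add (s hW₁ hF₀)) ((s hT₀ hT₁).add (s hT₁ hT₀))
    ((s hF₀ hF₁).add (s hF₁ hF₀)) ((s hT₀ hW₁).add (s hT₁ hW₀)) ((s hF₀ hT₁).add (s hF₁ hT₀))]
  exact (((((hasDerivAt_integralOn_pair hK hW₀ hW₁ hW₂ hF₀ hF₁ hF₂).const_mul α₁).add
    ((hasDerivAt_integralOn_pair hK hT₀ hT₁ hT₂ hT₀ hT₁ hT₂).const_mul α₂)).add
    ((hasDerivAt_integralOn_pair hK hF₀ hF₁ hF₂ hF₀ hF₁ hF₂).const_mul α₃)).add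
    ((hasDerivAt_integralOn_pair hK hT₀ hT₁ hT₂ hW₀ hW₁ hW₂).const_mul α₄)).add
    ((hasDerivAt_integralOn_pair hK hF₀ hF₁ hF₂ hT₀ hT₁ hT₂).const_mul α₅)

theorem isStationary_lagrangian_iff (α₁ α₂ α₃ α₄ α₅ : ℝ)
    {e A : Fin 3 → Form I M 1} (he : ∀ i, IsSmoothForm (e i)) (hA : ∀ i, IsSmoothForm (A i)) :
    IsStationary (lagrangian α₁ α₂ α₃ α₄ α₅) e A ↔
      ∀ (K : Set M) (x a : Fin 3 → Form I M 1), IsCompact K →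
        (∀ i, IsSmoothForm (x i)) → (∀ i, IsSmoothForm (a i)) →
        (∀ p ∉ K, ∀ i, x i p = 0 ∧ a i p = 0) →
        integralOn K (firstVariation α₁ α₂ α₃ α₄ α₅ e A x a) = 0 := by
  refine forall_congr' fun K => forall_congr' fun x => forall_congr' fun a => ?_
  refine forall_congr' fun hK => forall_congr' fun hx => forall_congr' fun ha =>
    forall_congr' fun _ => ?_
  have h := hasDerivAt_integralOn_lagrangian hK α₁ α₂ α₃ α₄ α₅ he hA hx ha
  exact ⟨fun h' => h.unique h', fun h' => h' ▸ h⟩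

end FirstVariation

/-! ### Test forms -/

section TestForms

variable {E : Type*} [NormedAddCommGroup E] [NormedSpace ℝ E]

/-- A linear form as an alternating map. -/
def oneCovec (lam : E →L[ℝ] ℝ) : E [⋀^Fin 1]→L[ℝ] ℝ :=
  ContinuousAlternatingMap.ofSubsingleton ℝ E ℝ 0 lam

theorem oneCovec_apply (lam : E →L[ℝ] ℝ) (v : Fin 1 → E) : oneCovec lam v = lam (v 0) := rfl

variable {H : Type*} [TopologicalSpace H] {I : ModelWithCorners ℝ E H}
  {M : Type*} [TopologicalSpace M] [ChartedSpace H M]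

variable (I M) in
/-- The constant function `1` as a form of degree zero. -/
def oneForm : Form I M 0 := fun _ => ContinuousAlternatingMap.constOfIsEmpty ℝ _ (Fin 0) 1

theorem chartRep_oneForm (q : M) (y : E) : chartRep q (oneForm I M) y =
    ContinuousAlternatingMap.constOfIsEmpty ℝ E (Fin 0) 1 := rfl

theorem isSmoothForm_oneForm : IsSmoothForm (oneForm I M) := fun q =>
  contDiffOn_const.congr fun y _ => chartRep_oneForm q y

variable [IsManifold I ∞ M]

/-- Functions enter as multiples of the 0-form 1; their differentials provide globally smooth
1-forms for use as test forms. -/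
theorem chartRep_extD_fsmul_oneForm {g : M → ℝ} (hg : ContMDiff I 𝓘(ℝ, ℝ) ∞ g) (q : M) {y : E}
    (hy : y ∈ (extChartAt I q).target) :
    chartRep q (extD (fsmul g (oneForm I M))) y =
      oneCovec (fderivWithin ℝ (g ∘ (extChartAt I q).symm) (range I) y) := by
  refine (chartRep_extD (isSmoothForm_oneForm.fsmul hg) q hy).trans ?_
  have hd : DifferentiableWithinAt ℝ (g ∘ (extChartAt I q).symm) (range I) y :=
    ((contDiffOn_comp_extChartAt_symm hg q y hy).mono_of_mem_nhdsWithin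
      (extChartAt_target_mem_nhdsWithin_of_mem hy)).differentiableWithinAt (by simp)
  have h := hd.hasFDerivWithinAt.smul_const
    (ContinuousAlternatingMap.constOfIsEmpty ℝ E (Fin 0) (1 : ℝ))
  ext v
  refine (extDerivWithin_apply' v).trans ?_
  rw [show chartRep q (fsmul g (oneForm I M)) = fun y => (g ∘ (extChartAt I q).symm) y •
    ContinuousAlternatingMap.constOfIsEmpty ℝ E (Fin 0) (1 : ℝ) from rfl,
    h.fderivWithin (uniqueDiffWithinAt_range hy)]
  rw [Fin.sum_univ_succ, Fin.sum_univ_zero, add_zero, Fin.val_zero, pow_zero, one_mul]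
  exact mul_one _

variable [FiniteDimensional ℝ E] [T2Space M]

/-- Test forms of degree one with prescribed direction in the preferred chart at `p`. -/
theorem exists_test_form (p : M) {s : Set M} (hs : s ∈ 𝓝 p) (lam : E →L[ℝ] ℝ) {c : E → ℝ}
    (hc : ContDiffOn ℝ ∞ c (extChartAt I p).target) :
    ∃ (f : M → ℝ) (x : Form I M 1), Continuous f ∧ 0 ≤ f ∧ f p = 1 ∧ HasCompactSupport f ∧
      tsupport f ⊆ s ∧ tsupport f ⊆ (chartAt H p).source ∧ IsSmoothForm x ∧
      (∀ r ∉ tsupport f, x r = 0) ∧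
      ∀ y ∈ (extChartAt I p).target,
        chartRep p x y = (f ((extChartAt I p).symm y) * c y) • oneCovec lam := by
  -- Two nested cutoffs: `psi` makes the coordinate function lam globally smooth, and f is supported
  -- where `psi` is locally 1, so that on the support of f the differential is exactly lam.
  obtain ⟨psi⟩ : Nonempty (SmoothBumpFunction I p) := inferInstance
  have hV : ∀ᶠ r in 𝓝 p, ∀ᶠ r' in 𝓝 r, psi r' = 1 :=
    eventually_eventually_nhds.2 psi.eventuallyEq_one
  obtain ⟨f, -, hf⟩ := (SmoothBumpFunction.nhds_basis_tsupport (I := I) p).mem_iff.1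
    (Filter.inter_mem hs hV)
  have hg : ContMDiff I 𝓘(ℝ, ℝ) ∞ (fun r => psi r • lam (extChartAt I p r)) :=
    psi.contMDiff_smul (g := fun r => lam (extChartAt I p r))
      (lam.contDiff.contMDiff.comp_contMDiffOn contMDiffOn_extChartAt)
  have hh : ContMDiff I 𝓘(ℝ, ℝ) ∞ (fun r => f r • c (extChartAt I p r)) := by
    refine f.contMDiff_smul (g := fun r => c (extChartAt I p r)) ?_
    refine ContMDiffOn.comp (t := (extChartAt I p).target) (contMDiffOn_iff_contDiffOn.2 hc)
      contMDiffOn_extChartAt fun r hr => ?_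
    exact (extChartAt I p).map_source (by rwa [extChartAt_source])
  refine ⟨f, fsmul (fun r => f r • c (extChartAt I p r))
    (extD (fsmul (fun r => psi r • lam (extChartAt I p r)) (oneForm I M))), f.continuous,
    fun r => f.nonneg, f.eq_one, f.hasCompactSupport, hf.trans inter_subset_left,
    f.tsupport_subset_chartAt_source, ((isSmoothForm_oneForm.fsmul hg).extD).fsmul hh,
    fun r hr => ?_, fun y hy => ?_⟩
  · simp [fsmul, image_eq_zero_of_notMem_tsupport hr]
  · rw [chartRep_fsmul, (extChartAt I p).right_inv hy]
    by_cases hfy : f ((extChartAt I p).symm y) = 0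
    · rw [hfy, zero_smul, zero_smul, zero_mul, zero_smul]
    · have hy1 := (hf (subset_tsupport _ hfy)).2
      have hev : (fun r => psi r • lam (extChartAt I p r)) ∘ (extChartAt I p).symm
          =ᶠ[𝓝[range I] y] lam := by
        filter_upwards [(continuousAt_extChartAt_symm'' hy).continuousWithinAt.eventually hy1,
          extChartAt_target_mem_nhdsWithin_of_mem hy] with z hz hzt
        rw [comp_apply, hz, one_smul, (extChartAt I p).right_inv hzt]
      rw [chartRep_extD_fsmul_oneForm hg p hy,
        hev.fderivWithin_eq_of_mem (extChartAt_target_subset_range p hy),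
        lam.fderivWithin (uniqueDiffWithinAt_range hy)]
      rfl

end TestForms

/-! ### Alternating maps determined by their exterior products with linear forms -/

section Nondegenerate

theorem eq_zero_of_basisFun {n : ℕ} {f : EuclideanSpace ℝ (Fin n) [⋀^Fin n]→L[ℝ] ℝ}
    (h : f (EuclideanSpace.basisFun (Fin n) ℝ) = 0) : f = 0 := by
  have h1 := f.toAlternatingMap.eq_smul_basis_det (EuclideanSpace.basisFun (Fin n) ℝ).toBasis
  ext v
  have h2 := congrArg (fun g => g v) h1
  have h3 : f.toAlternatingMap (EuclideanSpace.basisFun (Fin n) ℝ).toBasis = 0 := by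
    rw [OrthonormalBasis.coe_toBasis]; exact h
  rw [h3, zero_smul] at h2
  exact h2

theorem eq_zero_of_basisFun_comp {n k : ℕ} {f : EuclideanSpace ℝ (Fin n) [⋀^Fin k]→L[ℝ] ℝ}
    (h : ∀ s : Fin k → Fin n, f (fun i => EuclideanSpace.basisFun (Fin n) ℝ (s i)) = 0) :
    f = 0 := by
  refine ContinuousAlternatingMap.toAlternatingMap_injective ?_
  refine Module.Basis.ext_alternating (EuclideanSpace.basisFun (Fin n) ℝ).toBasis fun s _ => ?_
  simpa using h s

theorem exists_notMem_range {k n : ℕ} (h : k < n) (s : Fin k → Fin n) : ∃ m, ∀ i, s i ≠ m := by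
  by_contra hcon
  push Not at hcon
  have := Fintype.card_le_of_surjective s hcon
  simp at this
  omega

theorem proj_basisFun {n : ℕ} (m i : Fin n) :
    (EuclideanSpace.proj m : EuclideanSpace ℝ (Fin n) →L[ℝ] ℝ)
      (EuclideanSpace.basisFun (Fin n) ℝ i) = if m = i then 1 else 0 := by
  simp [EuclideanSpace.basisFun_apply]

/-- Three basis vectors miss some index m. Evaluating dxᵐ ∧ f with eₘ in the first slot returns f on
the three vectors, as dxᵐ kills them. -/
theorem eq_zero_of_wedgeAlt_three {f : EuclideanSpace ℝ (Fin 4) [⋀^Fin 3]→L[ℝ] ℝ}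
    (h : ∀ m : Fin 4, wedgeAlt (k := 1) (l := 3) (oneCovec (EuclideanSpace.proj m)) f
      (EuclideanSpace.basisFun (Fin 4) ℝ) = 0) : f = 0 := by
  refine eq_zero_of_basisFun_comp fun s => ?_
  obtain ⟨m, hm⟩ := exists_notMem_range (by norm_num) s
  set b := EuclideanSpace.basisFun (Fin 4) ℝ
  have h1 := congrArg (fun g : EuclideanSpace ℝ (Fin 4) [⋀^Fin 4]→L[ℝ] ℝ =>
    g ![b m, b (s 0), b (s 1), b (s 2)]) (eq_zero_of_basisFun (n := 4) (h m))
  have h2 := wedgeAlt_one_three (oneCovec (EuclideanSpace.proj m)) f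
    ![b m, b (s 0), b (s 1), b (s 2)]
  have h3 (i : Fin 3) : (EuclideanSpace.proj m : EuclideanSpace ℝ (Fin 4) →L[ℝ] ℝ) (b (s i)) = 0 :=
    (proj_basisFun m (s i)).trans (if_neg (hm i).symm)
  have h4 : (EuclideanSpace.proj m : EuclideanSpace ℝ (Fin 4) →L[ℝ] ℝ) (b m) = 1 :=
    (proj_basisFun m m).trans (if_pos rfl)
  rw [fin_three_eta fun i => b (s i)]
  have h5 := h2.symm.trans h1
  simp only [oneCovec_apply, Matrix.cons_val, h3, h4, zero_mul, one_mul, sub_zero, add_zero] at h5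
  exact h5

theorem eq_zero_of_wedgeAlt_two {f : EuclideanSpace ℝ (Fin 3) [⋀^Fin 2]→L[ℝ] ℝ}
    (h : ∀ m : Fin 3, wedgeAlt (k := 1) (l := 2) (oneCovec (EuclideanSpace.proj m)) f
      (EuclideanSpace.basisFun (Fin 3) ℝ) = 0) : f = 0 := by
  refine eq_zero_of_basisFun_comp fun s => ?_
  obtain ⟨m, hm⟩ := exists_notMem_range (by norm_num) s
  set b := EuclideanSpace.basisFun (Fin 3) ℝ
  have h1 := congrArg (fun g : EuclideanSpace ℝ (Fin 3) [⋀^Fin 3]→L[ℝ] ℝ =>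
    g ![b m, b (s 0), b (s 1)]) (eq_zero_of_basisFun (n := 3) (h m))
  have h2 := wedgeAlt_one_two (oneCovec (EuclideanSpace.proj m)) f ![b m, b (s 0), b (s 1)]
  have h3 (i : Fin 2) : (EuclideanSpace.proj m : EuclideanSpace ℝ (Fin 3) →L[ℝ] ℝ) (b (s i)) = 0 :=
    (proj_basisFun m (s i)).trans (if_neg (hm i).symm)
  have h4 : (EuclideanSpace.proj m : EuclideanSpace ℝ (Fin 3) →L[ℝ] ℝ) (b m) = 1 :=
    (proj_basisFun m m).trans (if_pos rfl)
  rw [fin_two_eta fun i => b (s i)]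
  have h5 := h2.symm.trans h1
  simp only [oneCovec_apply, Matrix.cons_val, h3, h4, zero_mul, one_mul, sub_zero, add_zero] at h5
  exact h5

/-- As f vanishes off the compact set C inside U, continuity on U becomes global continuity, and a
nonnegative continuous function with zero integral vanishes. -/
theorem eq_zero_of_integral_eq_zero {n : ℕ} {f : EuclideanSpace ℝ (Fin n) → ℝ}
    {C U : Set (EuclideanSpace ℝ (Fin n))} (hC : IsCompact C) (hU : IsOpen U) (hCU : C ⊆ U)
    (hf : ContinuousOn f U) (h0 : ∀ y ∉ C, f y = 0) (hn : 0 ≤ f) (hi : ∫ y, f y = 0)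
    (y : EuclideanSpace ℝ (Fin n)) : f y = 0 := by
  by_contra hne
  have hc : Continuous f := by
    refine continuous_iff_continuousAt.2 fun z => ?_
    by_cases hz : z ∈ C
    · exact hf.continuousAt (hU.mem_nhds (hCU hz))
    · have : f =ᶠ[𝓝 z] fun _ => 0 := by
        filter_upwards [hC.isClosed.isOpen_compl.mem_nhds hz] with w hw using h0 w hw
      exact continuousAt_const.congr this.symm
  have hs : HasCompactSupport f := HasCompactSupport.intro hC h0
  exact (hc.integral_pos_of_hasCompactSupport_nonneg_nonzero (μ := volume) hs hn hne).ne' hi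

end Nondegenerate

/-! ### Boundary values -/

section BoundaryValues

variable {n : ℕ} {M : Type*} [TopologicalSpace M] [ChartedSpace (EuclideanHalfSpace (n + 1)) M]

theorem consZeroL_injective : Injective (consZeroL n) := fun x y h => by
  ext i
  rw [← consZeroL_apply_succ x, h, consZeroL_apply_succ]

theorem isClosedEmbedding_consZeroL : IsClosedEmbedding (consZeroL n) :=
  (consZeroL n).toLinearMap.isClosedEmbedding_of_injective
    (LinearMap.ker_eq_bot.2 consZeroL_injective)

theorem exists_consZeroL_eq {y : EuclideanSpace ℝ (Fin (n + 1))} (hy : y 0 = 0) :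
    ∃ z, consZeroL n z = y := by
  refine ⟨WithLp.toLp 2 fun i => y i.succ, ?_⟩
  ext i
  refine Fin.cases ?_ (fun j => ?_) i
  · rw [consZeroL_apply_zero, hy]
  · rw [consZeroL_apply_succ]

theorem isOpen_preimage_consZeroL_target (q : M) :
    IsOpen (consZeroL n ⁻¹' (extChartAt (𝓡∂ (n + 1)) q).target) := by
  have h : consZeroL n ⁻¹' (extChartAt (𝓡∂ (n + 1)) q).target =
      ((𝓡∂ (n + 1)).symm ∘ consZeroL n) ⁻¹' (chartAt (EuclideanHalfSpace (n + 1)) q).target := by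
    ext z
    rw [extChartAt_target]
    exact ⟨fun h => h.1, fun h => ⟨h, consZeroL_mem_range z⟩⟩
  rw [h]
  exact (chartAt _ q).open_target.preimage
    ((𝓡∂ (n + 1)).continuous_symm.comp (consZeroL n).continuous)

variable [IsManifold (𝓡∂ (n + 1)) ∞ M]

theorem mem_boundary_iff_extChartAt (q : M) {p : M}
    (hp : p ∈ (chartAt (EuclideanHalfSpace (n + 1)) q).source) :
    p ∈ (𝓡∂ (n + 1)).boundary M ↔ extChartAt (𝓡∂ (n + 1)) q p 0 = 0 :=
  mem_boundary_iff (chart_mem_atlas _ q) hp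

theorem symm_mem_boundary_iff (q : M) {y : EuclideanSpace ℝ (Fin (n + 1))}
    (hy : y ∈ (extChartAt (𝓡∂ (n + 1)) q).target) :
    (extChartAt (𝓡∂ (n + 1)) q).symm y ∈ (𝓡∂ (n + 1)).boundary M ↔ y 0 = 0 := by
  rw [mem_boundary_iff_extChartAt q, (extChartAt (𝓡∂ (n + 1)) q).right_inv hy]
  rw [← extChartAt_source (𝓡∂ (n + 1))]
  exact (extChartAt (𝓡∂ (n + 1)) q).map_target hy

/-- Coordinate changes preserve the hyperplane tangent to the boundary. -/
theorem fderivWithin_coordChange_consZeroL (p q : M) {z : EuclideanSpace ℝ (Fin n)}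
    (hz : consZeroL n z ∈ (extChartAt (𝓡∂ (n + 1)) q).target)
    (hp : (extChartAt (𝓡∂ (n + 1)) q).symm (consZeroL n z) ∈
      (chartAt (EuclideanHalfSpace (n + 1)) p).source) (v : EuclideanSpace ℝ (Fin n)) :
    fderivWithin ℝ (extChartAt (𝓡∂ (n + 1)) p ∘ (extChartAt (𝓡∂ (n + 1)) q).symm)
      (range (𝓡∂ (n + 1))) (consZeroL n z) (consZeroL n v) 0 = 0 := by
  have hd := ((contDiffWithinAt_coordChange p q hz hp).differentiableWithinAt
    (by simp)).hasFDerivWithinAt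
  have h1 : HasFDerivAt (fun w => (extChartAt (𝓡∂ (n + 1)) p ∘ (extChartAt (𝓡∂ (n + 1)) q).symm)
      (consZeroL n w)) ((fderivWithin ℝ (extChartAt (𝓡∂ (n + 1)) p ∘
        (extChartAt (𝓡∂ (n + 1)) q).symm) (range (𝓡∂ (n + 1))) (consZeroL n z)).comp
        (consZeroL n)) z := by
    rw [← hasFDerivWithinAt_univ]
    exact hd.comp z (consZeroL n).hasFDerivWithinAt fun w _ => consZeroL_mem_range w
  have h2 := (EuclideanSpace.proj (0 : Fin (n + 1)) :
    EuclideanSpace ℝ (Fin (n + 1)) →L[ℝ] ℝ).hasFDerivAt.comp z h1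
  -- Every chart detects boundary points by its first coordinate, so this coordinate of the
  -- transition is identically 0 along the hyperplane.
  have h3 : (fun w => (EuclideanSpace.proj (0 : Fin (n + 1)) :
      EuclideanSpace ℝ (Fin (n + 1)) →L[ℝ] ℝ) ((extChartAt (𝓡∂ (n + 1)) p ∘
      (extChartAt (𝓡∂ (n + 1)) q).symm) (consZeroL n w))) =ᶠ[𝓝 z] fun _ => 0 := by
    have hev := (consZeroL n).continuous.continuousWithinAt (s := univ) (x := z)
      |>.tendsto_nhdsWithin (t := range (𝓡∂ (n + 1))) fun w _ => consZeroL_mem_range w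
    rw [nhdsWithin_univ] at hev
    filter_upwards [hev.eventually (eventually_mem_source p q hz hp)] with w hw
    exact (mem_boundary_iff_extChartAt p hw.2).1
      ((symm_mem_boundary_iff q hw.1).2 (consZeroL_apply_zero w))
  have h4 := h2.unique ((hasFDerivAt_const (0 : ℝ) z).congr_of_eventuallyEq h3)
  exact congrArg (fun L => L v) h4

/-- The hypothesis concerns preferred charts only, but coordinate changes preserve the tangent
hyperplane, so the tangential component vanishes in the chart at q too. -/
theorem bdryDensity_eq_zero {θ : Form (𝓡∂ (n + 1)) M n}
    (hθ : ∀ p ∈ (𝓡∂ (n + 1)).boundary M,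
      (covec θ p).compContinuousLinearMap (consZeroL n) = 0) (q : M)
    (z : EuclideanSpace ℝ (Fin n)) : bdryDensity q θ z = 0 := by
  rw [bdryDensity]
  split_ifs with hz
  · rw [chartRep_eq q θ hz, ContinuousAlternatingMap.compContinuousLinearMap_apply]
    have h (i : Fin n) := exists_consZeroL_eq (fderivWithin_coordChange_consZeroL
      ((extChartAt (𝓡∂ (n + 1)) q).symm (consZeroL n z)) q hz (mem_chart_source _ _)
      (EuclideanSpace.basisFun (Fin n) ℝ i))
    choose w hw using h
    have h2 := congrArg (fun f => f w) (hθ _ ((symm_mem_boundary_iff q hz).2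
      (consZeroL_apply_zero z)))
    refine Eq.trans ?_ h2
    refine congrArg _ (funext fun i => (hw i).symm)
  · rfl

variable [T2Space M] [SigmaCompactSpace M]

/-- Stokes' theorem for a form whose pullback to the boundary vanishes. -/
theorem integralOn_extD_eq_zero (hM : IsOrientedAtlas (𝓡∂ (n + 1)) M) {K : Set M}
    (hK : IsCompact K) {θ : Form (𝓡∂ (n + 1)) M n} (hs : IsSmoothForm θ)
    (h0 : ∀ p ∉ K, θ p = 0)
    (hθ : ∀ p ∈ (𝓡∂ (n + 1)).boundary M,
      (covec θ p).compContinuousLinearMap (consZeroL n) = 0) :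
    integralOn K (extD θ) = 0 := by
  set F := (finite_chartPartition_inter (I := 𝓡∂ (n + 1)) hK).toFinset
  have hρ (q : M) : IsSmoothForm (fsmul (chartPartition (𝓡∂ (n + 1)) M q) θ) :=
    hs.fsmul (contMDiff_chartPartition q)
  -- Finitely many partition functions suffice on K; off K both sides are zero. Each summand has
  -- compact support in one chart.
  have hsum : θ = ∑ q ∈ F, fsmul (chartPartition (𝓡∂ (n + 1)) M q) θ := by
    funext p
    rw [Finset.sum_apply]
    simp only [fsmul]
    by_cases hp : p ∈ K
    · rw [← Finset.sum_smul]
      have h1 := (chartPartition (𝓡∂ (n + 1)) M).sum_eq_one (mem_univ p)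
      rw [finsum_eq_sum_of_support_subset (s := F)] at h1
      · rw [h1, one_smul]
      · intro q hq
        rw [Finite.coe_toFinset]
        exact ⟨p, hq, hp⟩
    · simp [h0 p hp]
  rw [hsum, extD_sum fun q _ => hρ q, integralOn_sum hK fun q _ => (hρ q).extD]
  refine Finset.sum_eq_zero fun q _ => ?_
  rw [integralOn_extD hM hK (hK.inter_right (isClosed_tsupport (chartPartition (𝓡∂ (n + 1)) M q)))
    inter_subset_left (inter_subset_right.trans (chartPartition_tsupport_subset q)) (hρ q)]
  · rw [neg_eq_zero]
    refine integral_eq_zero_of_ae (Filter.Eventually.of_forall fun z => ?_)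
    refine bdryDensity_eq_zero (fun p hp => ?_) q z
    have h1 : covec (fsmul (chartPartition (𝓡∂ (n + 1)) M q) θ) p =
      chartPartition (𝓡∂ (n + 1)) M q p • covec θ p := rfl
    have h2 := hθ p hp
    ext v
    have h3 := congrArg (fun f => f v) h2
    rw [h1]
    change chartPartition (𝓡∂ (n + 1)) M q p * _ = (0 : ℝ)
    exact mul_eq_zero_of_right _ h3
  · intro p hp
    by_cases hpK : p ∈ K
    · have : chartPartition (𝓡∂ (n + 1)) M q p = 0 :=
        image_eq_zero_of_notMem_tsupport fun h => hp ⟨hpK, h⟩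
      simp [fsmul, this]
    · simp [fsmul, h0 p hpK]

end BoundaryValues

/-! ### The fundamental lemma of the calculus of variations -/

section Fundamental

variable {M : Type*} [TopologicalSpace M] [ChartedSpace (EuclideanHalfSpace 4) M]
  [IsManifold (𝓡∂ 4) ∞ M] [T2Space M] [SigmaCompactSpace M]

/-- Let c be the coefficient of dxᵐ ∧ η. Testing with x = f·c·dxᵐ makes the integrand f·c² ≥ 0, so c
vanishes at p, where f = 1. -/
theorem covec_eq_zero_of_integralOn_wedge (hM : IsOrientedAtlas (𝓡∂ 4) M)
    {η : Form (𝓡∂ 4) M 3} (hη : IsSmoothForm η)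
    (h : ∀ (S : Set M) (x : Form (𝓡∂ 4) M 1), IsCompact S → Disjoint S ((𝓡∂ 4).boundary M) →
      IsSmoothForm x → (∀ p ∉ S, x p = 0) → integralOn S (wedge x η : Form (𝓡∂ 4) M 4) = 0)
    {p : M} (hp : p ∉ (𝓡∂ 4).boundary M) : covec η p = 0 := by
  rw [← chartRep_self]
  refine eq_zero_of_wedgeAlt_three fun m => ?_
  set c : EuclideanSpace ℝ (Fin 4) → ℝ := fun y =>
    wedgeAlt (k := 1) (l := 3) (oneCovec (EuclideanSpace.proj m)) (chartRep p η y)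
      (EuclideanSpace.basisFun (Fin 4) ℝ) with hcdef
  have hc : ContDiffOn ℝ ∞ c (extChartAt (𝓡∂ 4) p).target :=
    (ContinuousAlternatingMap.apply ℝ _ ℝ
      (EuclideanSpace.basisFun (Fin 4) ℝ)).contDiff.comp_contDiffOn
        (contDiffOn_wedgeAlt (k := 1) (l := 3) contDiffOn_const (hη p))
  have hs : ((𝓡∂ 4).boundary M)ᶜ ∈ 𝓝 p :=
    ((𝓡∂ 4).isClosed_boundary (M := M) (n := ∞) (by simp)).isOpen_compl.mem_nhds hp
  obtain ⟨f, x, hfc, hf0, hfp, hfs, hfS, hfq, hx, hx0, hxc⟩ :=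
    exists_test_form p hs (EuclideanSpace.proj m) hc
  have hwx : IsSmoothForm (wedge x η : Form (𝓡∂ 4) M 4) := hx.wedge hη
  have hw0 : ∀ r ∉ tsupport f, (wedge x η : Form (𝓡∂ 4) M 4) r = 0 := fun r hr => by
    have := wedge_zero_left (k := 1) η
    refine Eq.trans ?_ (congrFun this r)
    change wedgeAlt (x r) _ = _
    rw [hx0 r hr]
    rfl
  have hint := h (tsupport f) x hfs (disjoint_left.2 fun r hr => hfS hr) hx hx0
  rw [integralOn_eq_setIntegral_density hM hfs hfs Subset.rfl hfq hwx hw0] at hint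
  have hden : ∀ y ∈ (extChartAt (𝓡∂ 4) p).target, density p (wedge x η : Form (𝓡∂ 4) M 4) y =
      f ((extChartAt (𝓡∂ 4) p).symm y) * c y ^ 2 := fun y hy => by
    rw [density]
    refine (congrArg (fun g : EuclideanSpace ℝ (Fin 4) [⋀^Fin 4]→L[ℝ] ℝ =>
      g (EuclideanSpace.basisFun (Fin 4) ℝ)) ((chartRep_wedge p x η y).trans
        ((congrArg (fun a => wedgeAlt a (chartRep p η y)) (hxc y hy)).trans
          (wedgeAlt_smul_left _ _ _)))).trans ?_
    change (f _ * c y) * c y = _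
    ring
  rw [setIntegral_congr_fun (measurableSet_target p) hden,
    ← integral_indicator (measurableSet_target p)] at hint
  have hfq' : tsupport f ⊆ (extChartAt (𝓡∂ 4) p).source := by rwa [extChartAt_source]
  -- The chart target need not be open in ℝ⁴, but its part with positive first coordinate is, and
  -- that part contains the support of the integrand.
  have hU : IsOpen ((𝓡∂ 4).symm ⁻¹' (chartAt (EuclideanHalfSpace 4) p).target ∩
      {y : EuclideanSpace ℝ (Fin 4) | 0 < y 0}) :=
    ((chartAt _ p).open_target.preimage (𝓡∂ 4).continuous_symm).inter
      (isOpen_lt continuous_const (PiLp.continuous_apply 2 _ 0))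
  have hUt : (𝓡∂ 4).symm ⁻¹' (chartAt (EuclideanHalfSpace 4) p).target ∩
      {y : EuclideanSpace ℝ (Fin 4) | 0 < y 0} ⊆ (extChartAt (𝓡∂ 4) p).target := by
    rw [extChartAt_target, range_modelWithCornersEuclideanHalfSpace]
    exact fun y hy => ⟨hy.1, show 0 ≤ y 0 from le_of_lt hy.2⟩
  have hres := eq_zero_of_integral_eq_zero (isCompact_image_extChartAt p hfs hfq') hU
    (by
      rintro _ ⟨r, hr, rfl⟩
      have ht := (extChartAt (𝓡∂ 4) p).map_source (hfq' hr)
      have hr0 := mt (mem_boundary_iff_extChartAt p (hfq hr)).2 (hfS hr)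
      rw [extChartAt_target, range_modelWithCornersEuclideanHalfSpace] at ht
      exact ⟨ht.1, lt_of_le_of_ne ht.2 (Ne.symm hr0)⟩)
    (ContinuousOn.congr (f := fun y => f ((extChartAt (𝓡∂ 4) p).symm y) * c y ^ 2)
      ((hfc.comp_continuousOn ((continuousOn_extChartAt_symm p).mono hUt)).mul
        ((hc.continuousOn.mono hUt).pow 2)) fun y hy => indicator_of_mem (hUt hy) _)
    (fun y hy => by
      by_cases hyt : y ∈ (extChartAt (𝓡∂ 4) p).target
      · rw [indicator_of_mem hyt, image_eq_zero_of_notMem_tsupport fun h' =>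
          hy ⟨_, h', (extChartAt (𝓡∂ 4) p).right_inv hyt⟩, zero_mul]
      · exact indicator_of_notMem hyt _)
    (fun y => indicator_nonneg (fun y _ => mul_nonneg (hf0 _) (sq_nonneg _)) y)
    hint (extChartAt (𝓡∂ 4) p p)
  rw [indicator_of_mem (mem_extChartAt_target p), extChartAt_to_inv, hfp, one_mul] at hres
  exact pow_eq_zero_iff (two_ne_zero) |>.1 hres

omit [T2Space M] [SigmaCompactSpace M] in
/-- A smooth form vanishing in the interior vanishes. -/
theorem eq_zero_of_covec_eq_zero {k : ℕ} {η : Form (𝓡∂ 4) M k} (hη : IsSmoothForm η)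
    (h : ∀ p ∉ (𝓡∂ 4).boundary M, covec η p = 0) : η = 0 := by
  refine form_ext fun p => ?_
  rw [← chartRep_self]
  have hmem := mem_extChartAt_target (I := 𝓡∂ 4) p
  -- Interior points of the target are dense in it and represent interior points of M, so continuity
  -- carries the zero up to the boundary.
  have hcl : extChartAt (𝓡∂ 4) p p ∈ closure (interior (extChartAt (𝓡∂ 4) p).target) :=
    extChartAt_target_subset_closure_interior hmem
  have hmaps : MapsTo (chartRep p η) (interior (extChartAt (𝓡∂ 4) p).target) {0} := fun y hy => by
    refine chartRep_of_eq_zero p (h _ fun hb => ?_)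
    have hyt := interior_subset hy
    have hy' := interior_mono (extChartAt_target_subset_range p) hy
    rw [interior_range_modelWithCornersEuclideanHalfSpace] at hy'
    exact hy'.ne' ((symm_mem_boundary_iff p hyt).1 hb)
  have := ((hη p).continuousOn _ hmem).mono interior_subset |>.mem_closure hcl hmaps
  rwa [closure_singleton] at this

/-- The same argument on the hyperplane: Stokes turns the hypothesis into the vanishing of a
boundary integral of f·c². -/
theorem covec_comp_consZeroL_eq_zero (hM : IsOrientedAtlas (𝓡∂ 4) M)
    {η : Form (𝓡∂ 4) M 2} (hη : IsSmoothForm η)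
    (h : ∀ (S : Set M) (x : Form (𝓡∂ 4) M 1), IsCompact S → IsSmoothForm x →
      (∀ p ∉ S, x p = 0) → integralOn S (extD (wedge x η : Form (𝓡∂ 4) M 3)) = 0)
    {p : M} (hp : p ∈ (𝓡∂ 4).boundary M) :
    (covec η p).compContinuousLinearMap (consZeroL 3) = 0 := by
  rw [← chartRep_self]
  refine eq_zero_of_wedgeAlt_two fun m => ?_
  -- Coordinate 0 is transverse to the boundary, so tangential coordinate m has index `m.succ`.
  set lam : EuclideanSpace ℝ (Fin 4) →L[ℝ] ℝ := EuclideanSpace.proj m.succ with hlam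
  have hlc : (oneCovec lam).compContinuousLinearMap (consZeroL 3) =
    oneCovec (EuclideanSpace.proj m) := rfl
  rw [← hlc, ← wedgeAlt_compContinuousLinearMap]
  set c : EuclideanSpace ℝ (Fin 4) → ℝ := fun y =>
    wedgeAlt (k := 1) (l := 2) (oneCovec lam) (chartRep p η y)
      (fun i => consZeroL 3 (EuclideanSpace.basisFun (Fin 3) ℝ i)) with hcdef
  have hc : ContDiffOn ℝ ∞ c (extChartAt (𝓡∂ 4) p).target :=
    (ContinuousAlternatingMap.apply ℝ _ ℝ
      (fun i => consZeroL 3 (EuclideanSpace.basisFun (Fin 3) ℝ i))).contDiff.comp_contDiffOn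
        (contDiffOn_wedgeAlt (k := 1) (l := 2) contDiffOn_const (hη p))
  obtain ⟨f, x, hfc, hf0, hfp, hfs, -, hfq, hx, hx0, hxc⟩ :=
    exists_test_form p Filter.univ_mem lam hc
  have hwx : IsSmoothForm (wedge x η : Form (𝓡∂ 4) M 3) := hx.wedge hη
  have hw0 : ∀ r ∉ tsupport f, (wedge x η : Form (𝓡∂ 4) M 3) r = 0 := fun r hr => by
    have := wedge_zero_left (k := 1) η
    refine Eq.trans ?_ (congrFun this r)
    change wedgeAlt (x r) _ = _
    rw [hx0 r hr]
    rfl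
  have hint := h (tsupport f) x hfs hx hx0
  rw [integralOn_extD hM hfs hfs Subset.rfl hfq hwx hw0, neg_eq_zero] at hint
  have hden (z : EuclideanSpace ℝ (Fin 3))
      (hz : consZeroL 3 z ∈ (extChartAt (𝓡∂ 4) p).target) :
      bdryDensity p (wedge x η : Form (𝓡∂ 4) M 3) z =
      f ((extChartAt (𝓡∂ 4) p).symm (consZeroL 3 z)) * c (consZeroL 3 z) ^ 2 := by
    rw [bdryDensity, if_pos hz]
    refine (congrArg (fun g : EuclideanSpace ℝ (Fin 4) [⋀^Fin 3]→L[ℝ] ℝ =>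
      g (fun i => consZeroL 3 (EuclideanSpace.basisFun (Fin 3) ℝ i)))
        ((chartRep_wedge p x η _).trans
        ((congrArg (fun a => wedgeAlt a (chartRep p η (consZeroL 3 z))) (hxc _ hz)).trans
          (wedgeAlt_smul_left _ _ _)))).trans ?_
    change (f _ * c _) * c _ = _
    ring
  have hfq' : tsupport f ⊆ (extChartAt (𝓡∂ 4) p).source := by rwa [extChartAt_source]
  obtain ⟨z, hz⟩ := exists_consZeroL_eq
    ((mem_boundary_iff_extChartAt p (mem_chart_source _ p)).1 hp)
  have hmaps : MapsTo (consZeroL 3) (consZeroL 3 ⁻¹' (extChartAt (𝓡∂ 4) p).target)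
    (extChartAt (𝓡∂ 4) p).target := fun _ h => h
  have hres := eq_zero_of_integral_eq_zero
    (isClosedEmbedding_consZeroL.isCompact_preimage (isCompact_image_extChartAt p hfs hfq'))
    (isOpen_preimage_consZeroL_target p)
    (preimage_mono (image_extChartAt_subset_target p hfq'))
    (ContinuousOn.congr (f := fun z => f ((extChartAt (𝓡∂ 4) p).symm (consZeroL 3 z)) *
        c (consZeroL 3 z) ^ 2)
      ((hfc.comp_continuousOn ((continuousOn_extChartAt_symm p).comp
        (consZeroL 3).continuous.continuousOn hmaps)).mul
        ((hc.continuousOn.comp (consZeroL 3).continuous.continuousOn hmaps).pow 2)) hden)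
    (fun w hw => by
      by_cases hwt : consZeroL 3 w ∈ (extChartAt (𝓡∂ 4) p).target
      · rw [hden w hwt, image_eq_zero_of_notMem_tsupport fun h' =>
          hw ⟨_, h', (extChartAt (𝓡∂ 4) p).right_inv hwt⟩, zero_mul]
      · rw [bdryDensity, if_neg hwt])
    (fun w => by
      by_cases hwt : consZeroL 3 w ∈ (extChartAt (𝓡∂ 4) p).target
      · rw [hden w hwt]
        exact mul_nonneg (hf0 _) (sq_nonneg _)
      · rw [bdryDensity, if_neg hwt]; rfl)
    hint z
  rw [hden z (hz ▸ mem_extChartAt_target p), hz, extChartAt_to_inv, hfp, one_mul] at hres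
  exact pow_eq_zero_iff (two_ne_zero) |>.1 hres

end Fundamental

/-! ### Pullback to the boundary -/

section Pullback

variable {n : ℕ} {M : Type*} [TopologicalSpace M] [ChartedSpace (EuclideanHalfSpace (n + 1)) M]
  [IsManifold (𝓡∂ (n + 1)) ∞ M]

theorem consZeroL_mem_target {x : Boundary n M} {y : EuclideanSpace ℝ (Fin n)}
    (hy : y ∈ (extChartAt (𝓡 n) x).target) :
    consZeroL n y ∈ (extChartAt (𝓡∂ (n + 1)) x.1).target := by
  have hy' : consZero y ∈ (chartAt (EuclideanHalfSpace (n + 1)) x.1).target := by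
    rw [extChartAt_target] at hy; exact hy.1
  rw [← coe_consZero, extChartAt_target]
  refine ⟨?_, consZeroL_mem_range y⟩
  rw [mem_preimage, show (consZero y).1 = (𝓡∂ (n + 1)) (consZero y) from rfl,
    (𝓡∂ (n + 1)).left_inv]
  exact hy'

/-- The charts of the boundary are restrictions of the charts of the manifold. -/
theorem coe_extChartAt_symm {x : Boundary n M} {y : EuclideanSpace ℝ (Fin n)}
    (hy : y ∈ (extChartAt (𝓡 n) x).target) :
    ((extChartAt (𝓡 n) x).symm y).1 = (extChartAt (𝓡∂ (n + 1)) x.1).symm (consZeroL n y) := by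
  classical
  have hb := (symm_mem_boundary_iff x.1 (consZeroL_mem_target hy)).2 (consZeroL_apply_zero y)
  have h1 : (extChartAt (𝓡∂ (n + 1)) x.1).symm (consZeroL n y) =
      (chartAt (EuclideanHalfSpace (n + 1)) x.1).symm (consZero y) := by
    rw [← coe_consZero, extChartAt_coe_symm, comp_apply,
      show (consZero y).1 = (𝓡∂ (n + 1)) (consZero y) from rfl, (𝓡∂ (n + 1)).left_inv]
  rw [h1] at hb ⊢
  have h2 : (extChartAt (𝓡 n) x).symm y = (boundaryChart x
    (chartAt (EuclideanHalfSpace (n + 1)) x.1) (chart_mem_atlas _ x.1)).symm y := rfl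
  rw [h2]
  change Subtype.val (if h : (chartAt (EuclideanHalfSpace (n + 1)) x.1).symm (consZero y) ∈
    (𝓡∂ (n + 1)).boundary M then (⟨_, h⟩ : Boundary n M) else x) = _
  rw [dif_pos hb]

theorem consZeroL_extChartAt {x r : Boundary n M}
    (hr : r.1 ∈ (chartAt (EuclideanHalfSpace (n + 1)) x.1).source) :
    consZeroL n (extChartAt (𝓡 n) x r) = extChartAt (𝓡∂ (n + 1)) x.1 r.1 := by
  have h0 := (mem_boundary_iff (chart_mem_atlas _ x.1) hr).1 r.2
  have h1 : extChartAt (𝓡 n) x r =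
    dropZero (chartAt (EuclideanHalfSpace (n + 1)) x.1 r.1) := rfl
  rw [h1, ← coe_consZero, consZero_dropZero h0]
  rfl

/-- Transition maps of ∂M are those of M restricted to the hyperplane, with the zero coordinate
dropped. Smoothness makes the chart calculus for `extD` available on ∂M. -/
instance isManifold_boundary : IsManifold (𝓡 n) ∞ (Boundary n M) := by
  refine isManifold_of_contDiffOn _ _ _ ?_
  rintro _ _ ⟨p, rfl⟩ ⟨q, rfl⟩ y hy
  have hy1 : y ∈ (extChartAt (𝓡 n) p).target := by
    rw [extChartAt_target]
    exact ⟨hy.1.1, mem_range_self y⟩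
  have hsrc (w : EuclideanSpace ℝ (Fin n)) (hw : w ∈ (extChartAt (𝓡 n) p).target)
      (h : (extChartAt (𝓡 n) p).symm w ∈ (extChartAt (𝓡 n) q).source) :
      (extChartAt (𝓡∂ (n + 1)) p.1).symm (consZeroL n w) ∈
        (chartAt (EuclideanHalfSpace (n + 1)) q.1).source := by
    rw [← coe_extChartAt_symm hw]
    rw [extChartAt_source] at h
    exact h
  have hy2 := hsrc y hy1 (by rw [extChartAt_source]; exact hy.1.2)
  have hc := (contDiffWithinAt_coordChange q.1 p.1 (consZeroL_mem_target hy1) hy2).comp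
    (s := (𝓡 n).symm ⁻¹' ((extChartAt (𝓡 n) p).target ∩
      (extChartAt (𝓡 n) p).symm ⁻¹' (extChartAt (𝓡 n) q).source) ∩ range (𝓡 n)) y
    (consZeroL n).contDiff.contDiffWithinAt fun w _ => consZeroL_mem_range w
  have hkey : ContDiffWithinAt ℝ ∞ (extChartAt (𝓡 n) q ∘ (extChartAt (𝓡 n) p).symm)
      ((𝓡 n).symm ⁻¹' ((extChartAt (𝓡 n) p).target ∩
      (extChartAt (𝓡 n) p).symm ⁻¹' (extChartAt (𝓡 n) q).source) ∩ range (𝓡 n)) y := by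
    rw [contDiffWithinAt_euclidean] at hc ⊢
    have heq (i : Fin n) (w : EuclideanSpace ℝ (Fin n)) (hw : w ∈ (extChartAt (𝓡 n) p).target)
        (h : (extChartAt (𝓡 n) p).symm w ∈ (extChartAt (𝓡 n) q).source) :
        (extChartAt (𝓡 n) q ∘ (extChartAt (𝓡 n) p).symm) w i =
        ((extChartAt (𝓡∂ (n + 1)) q.1 ∘ (extChartAt (𝓡∂ (n + 1)) p.1).symm) ∘ consZeroL n) w
          i.succ := by
      have hs := hsrc w hw h
      rw [comp_apply, comp_apply, comp_apply, ← coe_extChartAt_symm hw, ← consZeroL_extChartAt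
        (by rwa [coe_extChartAt_symm hw]), consZeroL_apply_succ]
    refine fun i => (hc i.succ).congr (fun w hw => heq i w hw.1.1 hw.1.2) (heq i y hy1 ?_)
    rw [extChartAt_source]
    exact hy.1.2
  refine hkey.mono fun w hw => ⟨⟨?_, ?_⟩, hw.2⟩
  · rw [extChartAt_target]
    exact ⟨hw.1.1, mem_range_self _⟩
  · rw [mem_preimage, extChartAt_source]
    exact hw.1.2

theorem writtenInExtChartAt_boundaryIncl (x : Boundary n M) :
    writtenInExtChartAt (𝓡 n) (𝓡∂ (n + 1)) x (boundaryIncl n M)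
      =ᶠ[𝓝 (extChartAt (𝓡 n) x x)] consZeroL n := by
  filter_upwards [extChartAt_target_mem_nhds (I := 𝓡 n) x] with y hy
  change extChartAt (𝓡∂ (n + 1)) x.1 ((extChartAt (𝓡 n) x).symm y).1 = _
  rw [coe_extChartAt_symm hy, (extChartAt _ x.1).right_inv (consZeroL_mem_target hy)]

/-- In the charts at x the inclusion is the linear map `consZeroL`, hence equals its own derivative.
-/
theorem covec_boundaryPullback {k : ℕ} (η : Form (𝓡∂ (n + 1)) M k) (x : Boundary n M) :
    covec (boundaryPullback η) x = (covec η x.1).compContinuousLinearMap (consZeroL n) := by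
  have hev := writtenInExtChartAt_boundaryIncl x
  have hd : HasFDerivWithinAt (writtenInExtChartAt (𝓡 n) (𝓡∂ (n + 1)) x (boundaryIncl n M))
      (consZeroL n) (range (𝓡 n)) (extChartAt (𝓡 n) x x) :=
    ((consZeroL n).hasFDerivAt.congr_of_eventuallyEq hev).hasFDerivWithinAt
  have hm : HasMFDerivAt (𝓡 n) (𝓡∂ (n + 1)) (boundaryIncl n M) x (consZeroL n) :=
    ⟨continuous_subtype_val.continuousAt, hd⟩
  have h2 : covec (boundaryPullback η) x = (covec η x.1).compContinuousLinearMap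
    (mfderiv (𝓡 n) (𝓡∂ (n + 1)) (boundaryIncl n M) x :
      EuclideanSpace ℝ (Fin n) →L[ℝ] EuclideanSpace ℝ (Fin (n + 1))) := rfl
  rw [h2, hm.mfderiv]
  rfl

theorem boundaryPullback_eq_zero_iff {k : ℕ} (η : Form (𝓡∂ (n + 1)) M k) :
    boundaryPullback η = 0 ↔ ∀ p ∈ (𝓡∂ (n + 1)).boundary M,
      (covec η p).compContinuousLinearMap (consZeroL n) = 0 := by
  constructor
  · intro h p hp
    rw [← covec_boundaryPullback η ⟨p, hp⟩, h]
    rfl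
  · exact fun h => form_ext fun x => (covec_boundaryPullback η x).trans (h x.1 x.2)

theorem boundaryPullback_add {k : ℕ} (η ζ : Form (𝓡∂ (n + 1)) M k) :
    boundaryPullback (η + ζ) = boundaryPullback η + boundaryPullback ζ := rfl

theorem boundaryPullback_smul {k : ℕ} (c : ℝ) (η : Form (𝓡∂ (n + 1)) M k) :
    boundaryPullback (c • η) = c • boundaryPullback η := rfl

theorem boundaryPullback_sum {k : ℕ} {ι : Type*} (s : Finset ι)
    (η : ι → Form (𝓡∂ (n + 1)) M k) :
    boundaryPullback (∑ i ∈ s, η i) = ∑ i ∈ s, boundaryPullback (η i) :=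
  map_sum (AddMonoidHom.mk' (fun β : Form (𝓡∂ (n + 1)) M k => boundaryPullback β)
    boundaryPullback_add) η s

theorem boundaryPullback_wedge {k l : ℕ} (η : Form (𝓡∂ (n + 1)) M k)
    (ζ : Form (𝓡∂ (n + 1)) M l) :
    boundaryPullback (wedge η ζ) = wedge (boundaryPullback η) (boundaryPullback ζ) :=
  funext fun _ => wedgeAlt_compContinuousLinearMap _ _ _

/-- `consZeroL` intertwines the transition maps of ∂M with those of M; differentiating this identity
compares the two pullbacks away from the chart centre. -/
theorem chartRep_boundaryPullback {k : ℕ} (η : Form (𝓡∂ (n + 1)) M k) (x : Boundary n M)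
    {y : EuclideanSpace ℝ (Fin n)} (hy : y ∈ (extChartAt (𝓡 n) x).target) :
    chartRep x (boundaryPullback η) y =
      (chartRep x.1 η (consZeroL n y)).compContinuousLinearMap (consZeroL n) := by
  have hz := consZeroL_mem_target hy
  rw [chartRep_eq x _ hy, covec_boundaryPullback, chartRep_eq x.1 _ hz, coe_extChartAt_symm hy]
  set r := (extChartAt (𝓡 n) x).symm y with hrdef
  have hr : r.1 = (extChartAt (𝓡∂ (n + 1)) x.1).symm (consZeroL n y) := coe_extChartAt_symm hy
  rw [← hr]
  have hr' : (extChartAt (𝓡∂ (n + 1)) x.1).symm (consZeroL n y) ∈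
      (chartAt (EuclideanHalfSpace (n + 1)) r.1).source := hr ▸ mem_chart_source _ r.1
  have hrs : (extChartAt (𝓡 n) x).symm y ∈ (chartAt (EuclideanSpace ℝ (Fin n)) r).source :=
    mem_chart_source _ r
  have h1 := ((contDiffWithinAt_coordChange r.1 x.1 hz hr').differentiableWithinAt
    (by simp)).hasFDerivWithinAt.comp (s := range (𝓡 n)) y (consZeroL n).hasFDerivWithinAt
    fun w _ => consZeroL_mem_range w
  have h2 := (consZeroL n).hasFDerivAt.comp_hasFDerivWithinAt y
    ((contDiffWithinAt_coordChange r x hy hrs).differentiableWithinAt (by simp)).hasFDerivWithinAt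
  have heq (w : EuclideanSpace ℝ (Fin n)) (hw : w ∈ (extChartAt (𝓡 n) x).target ∧
      (extChartAt (𝓡 n) x).symm w ∈ (chartAt (EuclideanSpace ℝ (Fin n)) r).source) :
      (consZeroL n ∘ (extChartAt (𝓡 n) r ∘ (extChartAt (𝓡 n) x).symm)) w =
        ((extChartAt (𝓡∂ (n + 1)) r.1 ∘ (extChartAt (𝓡∂ (n + 1)) x.1).symm) ∘ consZeroL n) w := by
    rw [comp_apply, comp_apply, comp_apply, comp_apply, ← coe_extChartAt_symm hw.1]
    exact consZeroL_extChartAt hw.2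
  have h3 := h2.congr_of_eventuallyEq ((eventually_mem_source r x hy hrs).mono fun w hw =>
    (heq w hw).symm) (heq y ⟨hy, hrs⟩).symm
  have h4 := (uniqueDiffWithinAt_range hy).eq h3 h1
  change (covec η r.1).compContinuousLinearMap ((consZeroL n).comp _) =
    (covec η r.1).compContinuousLinearMap (ContinuousLinearMap.comp _ (consZeroL n))
  rw [h4]

/-- The exterior derivative commutes with the pullback to the boundary. -/
theorem boundaryPullback_extD {k : ℕ} {η : Form (𝓡∂ (n + 1)) M k} (hη : IsSmoothForm η) :
    boundaryPullback (extD η) = extD (boundaryPullback η) := by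
  refine form_ext fun x => ?_
  have hx := mem_extChartAt_target (I := 𝓡 n) x
  have hr : extChartAt (𝓡 n) x x ∈ range (𝓡 n) := extChartAt_target_subset_range x hx
  have hxx := consZeroL_extChartAt (mem_chart_source (EuclideanHalfSpace (n + 1)) x.1)
  rw [covec_boundaryPullback, chartRep_extD_self, chartRep_extD_self, ← hxx]
  have hf (w) (hw : w ∈ range (𝓡 n)) : fderivWithin ℝ (consZeroL n) (range (𝓡 n)) w =
      consZeroL n := (consZeroL n).fderivWithin ((𝓡 n).uniqueDiffOn w hw)
  -- In coordinates the claim is naturality of the exterior derivative under the linear map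
  -- `consZeroL`.
  have h := extDerivWithin_pullback (r := ∞) (s := range (𝓡 n)) (x := extChartAt (𝓡 n) x x)
    (f := consZeroL n) (t := range (𝓡∂ (n + 1)))
    (hη.differentiableWithinAt (consZeroL_mem_target hx))
    (consZeroL n).contDiff.contDiffWithinAt
    (by rw [minSmoothness_of_isRCLikeNormedField]; exact two_le_infty)
    (𝓡 n).uniqueDiffOn ((𝓡 n).range_subset_closure_interior hr) hr
    fun w _ => consZeroL_mem_range w
  rw [hf _ hr] at h
  rw [← h]
  refine Filter.EventuallyEq.extDerivWithin_eq_of_mem ?_ hr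
  filter_upwards [extChartAt_target_mem_nhdsWithin x, self_mem_nhdsWithin] with w hw hwr
  rw [chartRep_boundaryPullback η x hw, hf w hwr]

theorem boundaryPullback_bracket {k l : ℕ} (a : Fin 3 → Form (𝓡∂ (n + 1)) M k)
    (b : Fin 3 → Form (𝓡∂ (n + 1)) M l) (i : Fin 3) :
    boundaryPullback (bracket a b i) =
      bracket (fun i => boundaryPullback (a i)) (fun i => boundaryPullback (b i)) i := by
  simp only [bracket, boundaryPullback_sum, boundaryPullback_smul, boundaryPullback_wedge]

theorem boundaryPullback_curv {A : Fin 3 → Form (𝓡∂ (n + 1)) M 1}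
    (hA : ∀ i, IsSmoothForm (A i)) (i : Fin 3) :
    boundaryPullback (curv A i) = curv (fun i => boundaryPullback (A i)) i := by
  change boundaryPullback (extD (A i) + (1 / 2 : ℝ) • (bracket A A i : Form _ M 2)) = _
  rw [boundaryPullback_add, boundaryPullback_smul, boundaryPullback_extD (hA i),
    boundaryPullback_bracket]
  rfl

theorem boundaryPullback_covD {A e : Fin 3 → Form (𝓡∂ (n + 1)) M 1}
    (he : ∀ i, IsSmoothForm (e i)) (i : Fin 3) :
    boundaryPullback (covD A e i) =
      covD (fun i => boundaryPullback (A i)) (fun i => boundaryPullback (e i)) i := by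
  change boundaryPullback (extD (e i) + (bracket A e i : Form _ M 2)) = _
  rw [boundaryPullback_add, boundaryPullback_extD (he i), boundaryPullback_bracket]
  rfl

theorem boundaryPullback_epsWedge (e : Fin 3 → Form (𝓡∂ (n + 1)) M 1) (i : Fin 3) :
    boundaryPullback (epsWedge e i) = epsWedge (fun i => boundaryPullback (e i)) i :=
  boundaryPullback_bracket e e i

end Pullback

/-! ### Stationarity and the field equations -/

section FieldEquations

variable {M : Type*} [TopologicalSpace M] [ChartedSpace (EuclideanHalfSpace 4) M]
  [IsManifold (𝓡∂ 4) ∞ M]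

omit [IsManifold (𝓡∂ 4) ∞ M] in
theorem wedge_at_eq_zero {k l : ℕ} {x : Form (𝓡∂ 4) M k} {p : M} (hx : x p = 0)
    (η : Form (𝓡∂ 4) M l) : wedge x η p = 0 := by
  refine Eq.trans ?_ (congrFun (wedge_zero_left (k := k) η) p)
  change wedgeAlt (x p) _ = _
  rw [hx]
  rfl

omit [IsManifold (𝓡∂ 4) ∞ M] in
theorem covec_wedge_comp_consZeroL (x : Form (𝓡∂ 4) M 1) (η : Form (𝓡∂ 4) M 2) {p : M}
    (h : x p = 0 ∨ (covec η p).compContinuousLinearMap (consZeroL 3) = 0) :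
    (covec (wedge x η : Form (𝓡∂ 4) M 3) p).compContinuousLinearMap (consZeroL 3) = 0 := by
  rcases h with h | h
  · have := wedge_at_eq_zero h η
    change (ContinuousAlternatingMap.compContinuousLinearMap
      (wedge x η p : EuclideanSpace ℝ (Fin 4) [⋀^Fin 3]→L[ℝ] ℝ) (consZeroL 3)) = 0
    erw [this]
    rfl
  · refine (wedgeAlt_compContinuousLinearMap (covec x p) (covec η p) (consZeroL 3)).trans ?_
    rw [h]
    have := wedgeAlt_smul_right (0 : ℝ) ((covec x p).compContinuousLinearMap (consZeroL 3))
      (0 : EuclideanSpace ℝ (Fin 3) [⋀^Fin 2]→L[ℝ] ℝ)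
    rwa [zero_smul, zero_smul] at this

variable [T2Space M] [SigmaCompactSpace M]

/-- Bulk and boundary separate in two stages: for variations supported off the boundary the exact
term integrates to zero, which gives P = 0; then only the exact term remains, and it determines the
pullback of B. -/
theorem eq_zero_of_integralOn_wedge_add_extD (hM : IsOrientedAtlas (𝓡∂ 4) M)
    {P : Form (𝓡∂ 4) M 3} {B : Form (𝓡∂ 4) M 2} (hP : IsSmoothForm P) (hB : IsSmoothForm B)
    (h : ∀ (K : Set M) (x : Form (𝓡∂ 4) M 1), IsCompact K → IsSmoothForm x →
      (∀ p ∉ K, x p = 0) → integralOn K ((wedge x P : Form (𝓡∂ 4) M 4) +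
        extD (wedge x B : Form (𝓡∂ 4) M 3)) = 0) :
    P = 0 ∧ boundaryPullback (n := 3) B = 0 := by
  have hP0 : P = 0 := by
    refine eq_zero_of_covec_eq_zero hP fun p hp =>
      covec_eq_zero_of_integralOn_wedge hM hP (fun S x hS hSb hx hx0 => ?_) hp
    have h1 := h S x hS hx hx0
    have h2 : integralOn S (extD (wedge x B : Form (𝓡∂ 4) M 3)) = 0 :=
      integralOn_extD_eq_zero hM hS (hx.wedge hB) (fun r hr => wedge_at_eq_zero (hx0 r hr) B)
        fun r hr => covec_wedge_comp_consZeroL x B (Or.inl (hx0 r (disjoint_right.1 hSb hr)))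
    rwa [integralOn_add hS (hx.wedge hP) (hx.wedge hB : IsSmoothForm (wedge x B)).extD, h2,
      add_zero] at h1
  refine ⟨hP0, (boundaryPullback_eq_zero_iff B).2 fun p hp =>
    covec_comp_consZeroL_eq_zero hM hB (fun S x hS hx hx0 => ?_) hp⟩
  have h1 := h S x hS hx hx0
  rw [hP0] at h1
  have h3 : (wedge x (0 : Form (𝓡∂ 4) M 3) : Form (𝓡∂ 4) M 4) = 0 := wedge_zero_right x
  rwa [h3, zero_add] at h1

omit [IsManifold (𝓡∂ 4) ∞ M] [T2Space M] [SigmaCompactSpace M] in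
theorem pair_single {k l : ℕ} (i : Fin 3) (x : Form (𝓡∂ 4) M k) (b : Fin 3 → Form (𝓡∂ 4) M l) :
    pair (Pi.single i x) b = wedge x (b i) := by
  rw [pair, Finset.sum_eq_single i]
  · rw [Pi.single_eq_same]
  · intro j _ hj
    rw [Pi.single_eq_of_ne hj, wedge_zero_left]
  · simp

omit [IsManifold (𝓡∂ 4) ∞ M] [T2Space M] [SigmaCompactSpace M] in
theorem pair_zero_left {k l : ℕ} (b : Fin 3 → Form (𝓡∂ 4) M l) :
    pair (0 : Fin 3 → Form (𝓡∂ 4) M k) b = 0 := by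
  have := pair_smul_left (0 : ℝ) (0 : Fin 3 → Form (𝓡∂ 4) M k) b
  rwa [zero_smul, zero_smul] at this

/-- Varying one component of x or a at a time decouples the equations. Conversely the bulk terms
vanish identically and Stokes removes the exact ones. -/
theorem forall_integralOn_eq_zero_iff (hM : IsOrientedAtlas (𝓡∂ 4) M)
    {P Q : Fin 3 → Form (𝓡∂ 4) M 3} {B C : Fin 3 → Form (𝓡∂ 4) M 2}
    (hP : ∀ i, IsSmoothForm (P i)) (hQ : ∀ i, IsSmoothForm (Q i))
    (hB : ∀ i, IsSmoothForm (B i)) (hC : ∀ i, IsSmoothForm (C i)) :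
    (∀ (K : Set M) (x a : Fin 3 → Form (𝓡∂ 4) M 1), IsCompact K →
        (∀ i, IsSmoothForm (x i)) → (∀ i, IsSmoothForm (a i)) →
        (∀ p ∉ K, ∀ i, x i p = 0 ∧ a i p = 0) →
        integralOn K ((pair x P + pair a Q : Form (𝓡∂ 4) M 4) +
          extD (pair x B + pair a C : Form (𝓡∂ 4) M 3)) = 0) ↔
      ((∀ i, P i = 0) ∧ ∀ i, Q i = 0) ∧
        ((∀ i, boundaryPullback (n := 3) (B i) = 0) ∧
          ∀ i, boundaryPullback (n := 3) (C i) = 0) := by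
  constructor
  · intro h
    have hs (i : Fin 3) (x : Form (𝓡∂ 4) M 1) (hx : IsSmoothForm x) (j : Fin 3) :
        IsSmoothForm ((Pi.single i x : Fin 3 → Form (𝓡∂ 4) M 1) j) := by
      by_cases hj : j = i
      · subst hj; rwa [Pi.single_eq_same]
      · rw [Pi.single_eq_of_ne hj]; exact isSmoothForm_zero
    have h0 (K : Set M) (i : Fin 3) (x : Form (𝓡∂ 4) M 1) (hx : ∀ p ∉ K, x p = 0) (p : M)
        (hp : p ∉ K) (j : Fin 3) : (Pi.single i x : Fin 3 → Form (𝓡∂ 4) M 1) j p = 0 := by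
      by_cases hj : j = i
      · subst hj; rw [Pi.single_eq_same]; exact hx p hp
      · rw [Pi.single_eq_of_ne hj]; rfl
    have hz : ∀ i, IsSmoothForm ((0 : Fin 3 → Form (𝓡∂ 4) M 1) i) := fun _ => isSmoothForm_zero
    have h1 (i : Fin 3) := eq_zero_of_integralOn_wedge_add_extD hM (hP i) (hB i)
      fun K x hK hx hx0 => by
        have := h K (Pi.single i x) 0 hK (hs i x hx) hz fun p hp j =>
          ⟨h0 K i x hx0 p hp j, rfl⟩
        rwa [pair_single, pair_single, pair_zero_left, pair_zero_left, add_zero, add_zero] at this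
    have h2 (i : Fin 3) := eq_zero_of_integralOn_wedge_add_extD hM (hQ i) (hC i)
      fun K x hK hx hx0 => by
        have := h K 0 (Pi.single i x) hK hz (hs i x hx) fun p hp j =>
          ⟨rfl, h0 K i x hx0 p hp j⟩
        rwa [pair_single, pair_single, pair_zero_left, pair_zero_left, zero_add, zero_add] at this
    exact ⟨⟨fun i => (h1 i).1, fun i => (h2 i).1⟩, fun i => (h1 i).2, fun i => (h2 i).2⟩
  · rintro ⟨⟨hP0, hQ0⟩, hB0, hC0⟩ K x a hK hx ha h0
    have hpz (y : Fin 3 → Form (𝓡∂ 4) M 1) {R : Fin 3 → Form (𝓡∂ 4) M 3} (hR : ∀ i, R i = 0) :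
        (pair y R : Form (𝓡∂ 4) M 4) = 0 := by
      refine Finset.sum_eq_zero fun i _ => ?_
      rw [hR i]
      exact wedge_zero_right (y i)
    rw [hpz x hP0, hpz a hQ0, add_zero, zero_add]
    have hw (y : Fin 3 → Form (𝓡∂ 4) M 1) (hy : ∀ i, IsSmoothForm (y i))
        (hy0 : ∀ p ∉ K, ∀ i, y i p = 0) {R : Fin 3 → Form (𝓡∂ 4) M 2}
        (hR : ∀ i, IsSmoothForm (R i)) (hR0 : ∀ i, boundaryPullback (n := 3) (R i) = 0) :
        integralOn K (extD (pair y R : Form (𝓡∂ 4) M 3)) = 0 := by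
      have hyR (i : Fin 3) : IsSmoothForm (wedge (y i) (R i) : Form (𝓡∂ 4) M 3) :=
        (hy i).wedge (hR i)
      have h1 : (pair y R : Form (𝓡∂ 4) M 3) = ∑ i, wedge (y i) (R i) := rfl
      rw [h1, extD_sum fun i _ => hyR i, integralOn_sum hK fun i _ => (hyR i).extD]
      refine Finset.sum_eq_zero fun i _ => ?_
      exact integralOn_extD_eq_zero hM hK (hyR i)
        (fun p hp => wedge_at_eq_zero (hy0 p hp i) (R i))
        fun p hp => covec_wedge_comp_consZeroL (y i) (R i)
          (Or.inr ((boundaryPullback_eq_zero_iff (R i)).1 (hR0 i) p hp))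
    have hxB : IsSmoothForm (pair x B : Form (𝓡∂ 4) M 3) := IsSmoothForm.pair hx hB
    have haC : IsSmoothForm (pair a C : Form (𝓡∂ 4) M 3) := IsSmoothForm.pair ha hC
    rw [extD_add hxB haC, integralOn_add hK hxB.extD haC.extD,
      hw x hx (fun p hp i => (h0 p hp i).1) hB hB0, hw a ha (fun p hp i => (h0 p hp i).2) hC hC0,
      add_zero]

theorem isStationary_lagrangian_iff_fieldEquations (hM : IsOrientedAtlas (𝓡∂ 4) M)
    (α₁ α₂ α₃ α₄ α₅ : ℝ) {e A : Fin 3 → Form (𝓡∂ 4) M 1}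
    (he : ∀ i, IsSmoothForm (e i)) (hA : ∀ i, IsSmoothForm (A i)) :
    IsStationary (lagrangian α₁ α₂ α₃ α₄ α₅) e A ↔
      ((∀ i, (α₁ - α₂) • hkCurv e A i = 0) ∧ (∀ i, (α₁ - α₂) • hkTorsion e A i = 0)) ∧
        ((∀ i, boundaryPullback (n := 3) (bdryE α₂ α₄ α₅ e A i) = 0) ∧
          (∀ i, boundaryPullback (n := 3) (bdryA α₁ α₃ α₅ e A i) = 0)) := by
  have hP (i : Fin 3) : IsSmoothForm (((2 * (α₁ - α₂)) • hkCurv e A) i) :=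
    IsSmoothForm.smul _ (IsSmoothForm.bracket he (IsSmoothForm.curv hA) i)
  have hQ (i : Fin 3) : IsSmoothForm (((2 * (α₁ - α₂)) • hkTorsion e A) i) :=
    IsSmoothForm.smul _ (IsSmoothForm.bracket (IsSmoothForm.covD hA he) he i)
  have h2 (η : Form (𝓡∂ 4) M 3) : (2 * (α₁ - α₂)) • η = 0 ↔ (α₁ - α₂) • η = 0 := by
    rw [mul_smul, smul_eq_zero]
    simp
  rw [isStationary_lagrangian_iff α₁ α₂ α₃ α₄ α₅ he hA]
  refine Iff.trans ?_ ((forall_integralOn_eq_zero_iff hM hP hQ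
    (IsSmoothForm.bdryE (α₂ := α₂) (α₄ := α₄) (α₅ := α₅) he hA)
    (IsSmoothForm.bdryA (α₁ := α₁) (α₃ := α₃) (α₅ := α₅) he hA)).trans ?_)
  · refine forall_congr' fun K => forall_congr' fun x => forall_congr' fun a => ?_
    refine forall_congr' fun hK => forall_congr' fun hx => forall_congr' fun ha =>
      forall_congr' fun _ => ?_
    rw [firstVariation_eq he hA hx ha, smul_add, ← pair_smul_right, ← pair_smul_right]
  · exact and_congr_left' (and_congr (forall_congr' fun i => h2 _) (forall_congr' fun i => h2 _))

/-- With α = (¼, −¼, 1, 0, 0) the bulk factor is α₁ − α₂ = ½ and the boundary coefficients are −½T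
and 2(F + ⅛W); the nonzero constants are dropped. -/
theorem isStationary_twoConnLagrangian_iff_fieldEquations (hM : IsOrientedAtlas (𝓡∂ 4) M)
    {e A : Fin 3 → Form (𝓡∂ 4) M 1}
    (he : ∀ i, IsSmoothForm (e i)) (hA : ∀ i, IsSmoothForm (A i)) :
    IsStationary twoConnLagrangian (A + (1 / 2 : ℝ) • e) (A + (-(1 / 2) : ℝ) • e) ↔
      ((∀ i, hkCurv e A i = 0) ∧ (∀ i, hkTorsion e A i = 0)) ∧
        ((∀ i, boundaryPullback (n := 3) (covD A e i) = 0) ∧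
          (∀ i, boundaryPullback (n := 3) (curv A i + (1 / 8 : ℝ) • epsWedge e i) = 0)) := by
  have h3 (c : ℝ) (hc : c ≠ 0) {k : ℕ} (η : Form (𝓡∂ 4) M k) : c • η = 0 ↔ η = 0 :=
    smul_eq_zero_iff_right hc
  have h4 (c : ℝ) (hc : c ≠ 0) (η : Form (𝓡∂ 4) M 2) :
      boundaryPullback (n := 3) (c • η) = 0 ↔ boundaryPullback (n := 3) η = 0 := by
    rw [boundaryPullback_smul]
    exact smul_eq_zero_iff_right hc
  have hE (i : Fin 3) : bdryE (-(1 / 4)) 0 0 e A i = (-(1 / 2) : ℝ) • covD A e i := by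
    rw [bdryE]; module
  have hB (i : Fin 3) : bdryA (1 / 4) 1 0 e A i =
      (2 : ℝ) • (curv A i + (1 / 8 : ℝ) • epsWedge e i) := by
    rw [bdryA]; module
  rw [isStationary_twoConnLagrangian_iff he hA,
    isStationary_lagrangian_iff_fieldEquations hM _ _ _ _ _ he hA]
  refine and_congr (and_congr (forall_congr' fun i => h3 _ (by norm_num) _)
    (forall_congr' fun i => h3 _ (by norm_num) _))
    (and_congr (forall_congr' fun i => ?_) (forall_congr' fun i => ?_))
  · rw [hE, h4 _ (by norm_num)]
  · rw [hB, h4 _ (by norm_num)]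

-- Curvature, torsion and ε e∧e are built from d and ∧, so they commute with pullback; ⅛ is Λ/2 for
-- Λ = ¼.
omit [T2Space M] [SigmaCompactSpace M] in
theorem boundary_equations_iff_euclideanGR3 {e A : Fin 3 → Form (𝓡∂ 4) M 1}
    (he : ∀ i, IsSmoothForm (e i)) (hA : ∀ i, IsSmoothForm (A i)) :
    ((∀ i, boundaryPullback (n := 3) (covD A e i) = 0) ∧
        (∀ i, boundaryPullback (n := 3) (curv A i + (1 / 8 : ℝ) • epsWedge e i) = 0)) ↔
      EuclideanGR3 (1 / 4) (fun i => boundaryPullback (n := 3) (e i))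
        (fun i => boundaryPullback (n := 3) (A i)) := by
  refine and_congr (forall_congr' fun i => ?_) (forall_congr' fun i => ?_)
  · rw [boundaryPullback_covD he]
  · rw [boundaryPullback_add, boundaryPullback_smul, boundaryPullback_curv hA,
      boundaryPullback_epsWedge, show (1 / 4 / 2 : ℝ) = 1 / 8 by norm_num]

end FieldEquations

end HKModel

end

theorem mainTheorem2
    {M : Type*} [TopologicalSpace M] [ChartedSpace (EuclideanHalfSpace 4) M]
    [IsManifold (𝓡∂ 4) ∞ M] [T2Space M] [SigmaCompactSpace M]
    (hM : HKModel.IsOrientedAtlas (𝓡∂ 4) M) :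
    (∀ (α₁ α₂ α₃ α₄ α₅ : ℝ) (e A : Fin 3 → HKModel.Form (𝓡∂ 4) M 1),
      (∀ i, HKModel.IsSmoothForm (e i)) → (∀ i, HKModel.IsSmoothForm (A i)) →
      (HKModel.IsStationary (HKModel.lagrangian α₁ α₂ α₃ α₄ α₅) e A ↔
        ((∀ i, (α₁ - α₂) • HKModel.hkCurv e A i = 0) ∧
          (∀ i, (α₁ - α₂) • HKModel.hkTorsion e A i = 0)) ∧
        ((∀ i, HKModel.boundaryPullback (n := 3) ((2 * α₂) • HKModel.covD A e i +
            α₄ • HKModel.epsWedge e i + α₅ • HKModel.curv A i) = 0) ∧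
          (∀ i, HKModel.boundaryPullback (n := 3) (α₁ • HKModel.epsWedge e i +
            (2 * α₃) • HKModel.curv A i + α₅ • HKModel.covD A e i) = 0)))) ∧
    (∀ Ap Am e A : Fin 3 → HKModel.Form (𝓡∂ 4) M 1,
      (∀ i, HKModel.IsSmoothForm (Ap i)) → (∀ i, HKModel.IsSmoothForm (Am i)) →
      e = Ap - Am → A = (1 / 2 : ℝ) • Am + (1 - 1 / 2 : ℝ) • Ap →
      (HKModel.IsStationary HKModel.twoConnLagrangian Ap Am ↔
        ((∀ i, HKModel.hkCurv e A i = 0) ∧ (∀ i, HKModel.hkTorsion e A i = 0)) ∧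
        ((∀ i, HKModel.boundaryPullback (n := 3) (HKModel.covD A e i) = 0) ∧
          (∀ i, HKModel.boundaryPullback (n := 3)
            (HKModel.curv A i + (1 / 8 : ℝ) • HKModel.epsWedge e i) = 0))) ∧
      (((∀ i, HKModel.boundaryPullback (n := 3) (HKModel.covD A e i) = 0) ∧
          (∀ i, HKModel.boundaryPullback (n := 3)
            (HKModel.curv A i + (1 / 8 : ℝ) • HKModel.epsWedge e i) = 0)) ↔
        HKModel.EuclideanGR3 (1 / 4)
          (fun i => HKModel.boundaryPullback (n := 3) (e i))
          (fun i => HKModel.boundaryPullback (n := 3) (A i)))) := by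
  refine ⟨fun α₁ α₂ α₃ α₄ α₅ e A he hA =>
    HKModel.isStationary_lagrangian_iff_fieldEquations hM α₁ α₂ α₃ α₄ α₅ he hA,
    fun Ap Am e A hp hm he hA => ?_⟩
  have hes : ∀ i, HKModel.IsSmoothForm (e i) := fun i => he ▸ (hp i).sub (hm i)
  have hAs : ∀ i, HKModel.IsSmoothForm (A i) := fun i => hA ▸ ((hm i).smul _).add ((hp i).smul _)
  -- As A is the midpoint of the two connections and e their difference, they are recovered as A ±
  -- ½e.
  have h1 : Ap = A + (1 / 2 : ℝ) • e := by rw [he, hA]; module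
  have h2 : Am = A + (-(1 / 2) : ℝ) • e := by rw [he, hA]; module
  refine ⟨?_, HKModel.boundary_equations_iff_euclideanGR3 hes hAs⟩
  rw [h1, h2]
  exact HKModel.isStationary_twoConnLagrangian_iff_fieldEquations hM hes hAs
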